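/- Let $n\ge 1$. For $-\infty<\frac1p<\infty$ (so $p\in(-\infty,0)\cup(0,\infty]$) define $X^p(\mathbb R^n)$ as follows. If $0<p\le\infty$, then $X^p=L^p$ with its usual norm. If $p<0$, put $p_1=-\left[\frac np+1\right]$ (where $[\cdot]$ is the integer part, i.e. the floor) and $p_2=-\frac np-p_1\in(0,1]$, and let $X^p=C^{p_1,p_2}$ with the norm $$\|u\|_{X^p}=\max_{|\alpha|\le p_1}\sup_{x}|D^\alpha u(x)|+\sum_{|\alpha|=p_1}\sup_{x\ne y}\frac{|D^\alpha u(x)-D^\alpha u(y)|}{|x-y|^{p_2}}.$$ Write $u\in X^{k,p}$ if $D^\alpha u\in X^p$ for all $|\alpha|\le k$, and $\|D^ku\|_{X^p}=\sum_{|\alpha|=k}\|D^\alpha u\|_{X^p}$. Let $-\infty<\frac1p,\frac1q,\frac1r\le 1$ with $\frac2q=\frac1p+\frac1r$; if $n\ge 2$, assume that $\left(\frac1p,\frac1r\right)\ne\left(\frac1n,-\frac1n\right)$. Then there is a constant $C$ (depending only on $n,p,q,r$) such that every real-valued $u\in C_0^\infty(\mathbb R^n)$ with $u\in X^{2,p}(\mathbb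 R^n)\cap X^r(\mathbb R^n)$ satisfies $u\in X^{1,q}(\mathbb R^n)$ and $$\|Du\|_{X^q}^2\le C\,\|D^2u\|_{X^p}\,\|u\|_{X^r}.$$ -/

import Mathlib

open MeasureTheory
open scoped ENNReal NNReal ContDiff

noncomputable section

namespace GagNir

/-- The partial derivative `∂ᵢ u` of a real function on `ℝⁿ`. -/
def partialDeriv {n : ℕ} (i : Fin n) (u : EuclideanSpace ℝ (Fin n) → ℝ) :
    EuclideanSpace ℝ (Fin n) → ℝ :=
  fun x => fderiv ℝ u x (EuclideanSpace.single i 1)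

/-- The classical derivative `D^α u = ∂₁^{α₁} ⋯ ∂ₙ^{αₙ} u` for a multi-index `α`. -/
def multiDeriv {n : ℕ} (α : Fin n → ℕ) (u : EuclideanSpace ℝ (Fin n) → ℝ) :
    EuclideanSpace ℝ (Fin n) → ℝ :=
  (List.finRange n).foldr (fun i f => (partialDeriv i)^[α i] f) u

/-- The finite set of the multi-indices `α` with `|α| = k`. -/
def multiIndices (n k : ℕ) : Finset (Fin n → ℕ) :=
  Finset.piAntidiag Finset.univ k

theorem mem_multiIndices {n k : ℕ} (α : Fin n → ℕ) :
    α ∈ multiIndices n k ↔ ∑ i, α i = k := by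
  simp [multiIndices]

/-- For `1/p = μ < 0`, the number of derivatives `p₁ = -[n/p + 1]`. -/
def holderOrder (n : ℕ) (μ : ℝ) : ℕ := (-⌊(n : ℝ) * μ + 1⌋).toNat

/-- For `1/p = μ < 0`, the Hölder exponent `p₂ = -n/p - p₁`. -/
def holderExponent (n : ℕ) (μ : ℝ) : ℝ := -((n : ℝ) * μ) - (holderOrder n μ : ℝ)

theorem holderOrder_eq {n : ℕ} (hn : 0 < n) {μ : ℝ} (hμ : μ < 0) :
    (holderOrder n μ : ℤ) = -⌊(n : ℝ) * μ + 1⌋ := by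
  have h : (n : ℝ) * μ < 0 := mul_neg_of_pos_of_neg (by exact_mod_cast hn) hμ
  have h2 : ⌊(n : ℝ) * μ + 1⌋ < 1 := by
    rw [Int.floor_lt]; push_cast; linarith
  unfold holderOrder
  omega

theorem holderExponent_mem {n : ℕ} (hn : 0 < n) {μ : ℝ} (hμ : μ < 0) :
    0 < holderExponent n μ ∧ holderExponent n μ ≤ 1 := by
  have h : (holderOrder n μ : ℝ) = -(⌊(n : ℝ) * μ + 1⌋ : ℝ) := by
    exact_mod_cast holderOrder_eq hn hμ
  have h1 := Int.floor_le ((n : ℝ) * μ + 1)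
  have h2 := Int.lt_floor_add_one ((n : ℝ) * μ + 1)
  unfold holderExponent
  rw [h]
  constructor <;> linarith

/-- The full Hölder norm of `C^{m,s}(ℝⁿ)`, with values in `[0, ∞]`:
`max_{|α| ≤ m} sup_x |D^α u(x)| + ∑_{|α| = m} sup_{x ≠ y} |D^α u(x) - D^α u(y)| / |x - y|^s`. -/
def holderNorm {n : ℕ} (m : ℕ) (s : ℝ) (u : EuclideanSpace ℝ (Fin n) → ℝ) : ℝ≥0∞ :=
  (⨆ (α : Fin n → ℕ) (_ : ∑ i, α i ≤ m) (x : EuclideanSpace ℝ (Fin n)), ‖multiDeriv α u x‖ₑ)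
    + ∑ α ∈ multiIndices n m,
        ⨆ (x : EuclideanSpace ℝ (Fin n)) (y : EuclideanSpace ℝ (Fin n)) (_ : x ≠ y),
          ‖multiDeriv α u x - multiDeriv α u y‖ₑ / ‖x - y‖ₑ ^ s

/-- The norm of `X^p(ℝⁿ)`, indexed by the reciprocal `μ = 1/p ∈ ℝ` (so `μ = 0` is `p = ∞`):
the `L^p` norm for `μ > 0`, the `L^∞` norm for `μ = 0`, and the norm of `C^{p₁,p₂}` for `μ < 0`. -/
def xNorm {n : ℕ} (μ : ℝ) (u : EuclideanSpace ℝ (Fin n) → ℝ) : ℝ≥0∞ :=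
  if 0 < μ then eLpNorm u (ENNReal.ofReal (1 / μ)) volume
  else if μ = 0 then eLpNorm u ⊤ volume
  else holderNorm (holderOrder n μ) (holderExponent n μ) u

/-- Membership in `X^p(ℝⁿ)`, where `μ = 1/p`: the function has the regularity that the space
asks for (a.e. strong measurability for `μ ≥ 0`, being of class `C^{p₁}` for `μ < 0`), and its
norm is finite. -/
def MemX {n : ℕ} (μ : ℝ) (u : EuclideanSpace ℝ (Fin n) → ℝ) : Prop :=
  (if 0 ≤ μ then AEStronglyMeasurable u volume else ContDiff ℝ (holderOrder n μ) u)
    ∧ xNorm μ u < ⊤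

/-- Membership in `X^{k,p}(ℝⁿ)`, where `μ = 1/p`: `D^α u ∈ X^p` for all `|α| ≤ k`. The derivatives
are classical, and this is used for smooth functions only. -/
def MemXk {n : ℕ} (k : ℕ) (μ : ℝ) (u : EuclideanSpace ℝ (Fin n) → ℝ) : Prop :=
  ∀ α : Fin n → ℕ, ∑ i, α i ≤ k → MemX μ (multiDeriv α u)

/-- The norm `‖D^k u‖_{X^p}` of the collection of all derivatives of order `k`, where `μ = 1/p`:
the sum of the norms of the components. -/
def xNormD {n : ℕ} (k : ℕ) (μ : ℝ) (u : EuclideanSpace ℝ (Fin n) → ℝ) : ℝ≥0∞ :=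
  ∑ α ∈ multiIndices n k, xNorm μ (multiDeriv α u)

end GagNir

end

namespace GagNir

/-! Give a bound of D^d u in X^t, with μ = 1/t, the order d - nμ. The relation between the exponents
says that the order 1 - n/q of the target is the mean of the orders 2 - n/p and -n/r of the two
data. How this mean of orders becomes a geometric mean of norms depends on the signs of the
reciprocals and on whether the two orders differ.

If 1/q ≤ 0, or if 1/q > 0 and one datum is a Hölder norm, u is cut into dyadic blocks. Let P_δ be
mollification at scale δ. The block at δ = 2^{-j} is (I - P_{2δ})^N - (I - P_δ)^N, which by
telescoping is a sum of smoothings P_δ - P_{2δ} of products of N - 1 errors. The errors gain a power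
of δ for every derivative that the datum controls, and the smoothing absorbs outer derivatives at
the price δ^{-1} each. A datum of order κ thus bounds the derivatives of order k of the block by
2^{j(k-κ)} (`exists_specBound`). Two data of different orders give a two-sided geometric majorant,
whose sum is a geometric mean (`exists_tsum_le`). A full Hölder norm controls a whole interval of
orders, and `exists_tsum_le_sqrt_of_Icc` exploits this freedom. For a Lebesgue target each block is
first estimated between a Lebesgue norm and L^∞ (`exists_eLpNorm_partialDeriv_le_of_ne`).

The series is useless when both orders equal that of the target and cannot be moved. For a Hölder
target this concerns only the top seminorm, which each datum controls by itself
(`exists_holder_listDeriv_le_sqrt_of_eq`). For the target L^∞ it is the pair (1/n, -1/n), excluded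
for n ≥ 2 and elementary for n = 1 (`exists_xNorm_partialDeriv_le_of_one`). For a Lebesgue target it
is the Sobolev relation 1/q = 1/p - 1/n. There a truncation argument of weak type and a Doob
inequality bound Du (`eLpNorm_le_of_abs_mollify_le`), and Sobolev's inequality corrects the powers.

If both data are Lebesgue norms and 1/q > 0, Nirenberg's argument applies on each line parallel to
an axis. An interpolation inequality on an interval is balanced by the choice of the interval, the
balanced intervals are selected by Besicovitch's theorem, and Hölder's inequality sums them and then
integrates over the lines (`exists_lintegral_deriv_rpow_le`,
`exists_eLpNorm_partialDeriv_le_of_lp`). -/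

/-- The class `C_c^∞(ℝⁿ)`. -/
structure IsTest {n : ℕ} (u : EuclideanSpace ℝ (Fin n) → ℝ) : Prop where
  smooth : ContDiff ℝ ∞ u
  compact : HasCompactSupport u

/-- The iterated partial derivative along a list of coordinates. -/
noncomputable def listDeriv {n : ℕ} (l : List (Fin n)) (u : EuclideanSpace ℝ (Fin n) → ℝ) :
    EuclideanSpace ℝ (Fin n) → ℝ :=
  l.foldr partialDeriv u

/-! ### Calculus of iterated partial derivatives -/

section Derivatives

variable {n : ℕ} {u : EuclideanSpace ℝ (Fin n) → ℝ}

@[simp] theorem listDeriv_nil : listDeriv [] u = u := rfl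

@[simp] theorem listDeriv_cons (i : Fin n) (l : List (Fin n)) :
    listDeriv (i :: l) u = partialDeriv i (listDeriv l u) := rfl

theorem listDeriv_append (l₁ l₂ : List (Fin n)) :
    listDeriv (l₁ ++ l₂) u = listDeriv l₁ (listDeriv l₂ u) := by
  simp [listDeriv]

theorem contDiff_partialDeriv (hu : ContDiff ℝ ∞ u) (i : Fin n) :
    ContDiff ℝ ∞ (partialDeriv i u) :=
  (hu.fderiv_right (m := ∞) (by simp)).clm_apply contDiff_const

theorem contDiff_listDeriv (hu : ContDiff ℝ ∞ u) (l : List (Fin n)) :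
    ContDiff ℝ ∞ (listDeriv l u) := by
  induction l with
  | nil => exact hu
  | cons i l ih => exact contDiff_partialDeriv ih i

theorem IsTest.partialDeriv (hu : IsTest u) (i : Fin n) : IsTest (partialDeriv i u) :=
  ⟨contDiff_partialDeriv hu.smooth i, hu.compact.fderiv_apply (𝕜 := ℝ) _⟩

theorem IsTest.listDeriv (hu : IsTest u) (l : List (Fin n)) : IsTest (listDeriv l u) := by
  induction l with
  | nil => exact hu
  | cons i l ih => exact ih.partialDeriv i

theorem IsTest.continuous (hu : IsTest u) : Continuous u := hu.smooth.continuous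

theorem IsTest.differentiable (hu : IsTest u) : Differentiable ℝ u :=
  hu.smooth.differentiable (by simp)

theorem IsTest.memLp (hu : IsTest u) (t : ℝ≥0∞) : MemLp u t volume :=
  hu.continuous.memLp_of_hasCompactSupport hu.compact

theorem IsTest.integrable (hu : IsTest u) : Integrable u volume :=
  hu.continuous.integrable_of_hasCompactSupport hu.compact

theorem IsTest.sub {v : EuclideanSpace ℝ (Fin n) → ℝ} (hu : IsTest u) (hv : IsTest v) :
    IsTest (u - v) :=
  ⟨hu.smooth.sub hv.smooth, hu.compact.sub hv.compact⟩

theorem IsTest.add {v : EuclideanSpace ℝ (Fin n) → ℝ} (hu : IsTest u) (hv : IsTest v) :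
    IsTest (u + v) :=
  ⟨hu.smooth.add hv.smooth, hu.compact.add hv.compact⟩

theorem isTest_zero : IsTest (0 : EuclideanSpace ℝ (Fin n) → ℝ) :=
  ⟨contDiff_const, HasCompactSupport.zero⟩

theorem isTest_sum {ι : Type*} (s : Finset ι) {F : ι → EuclideanSpace ℝ (Fin n) → ℝ}
    (h : ∀ i ∈ s, IsTest (F i)) : IsTest (∑ i ∈ s, F i) := by
  classical
  induction s using Finset.induction_on with
  | empty => simpa using isTest_zero
  | insert a s ha ih =>
    rw [Finset.sum_insert ha]
    exact (h a (by simp)).add (ih fun i hi => h i (by simp [hi]))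

theorem partialDeriv_sub {v : EuclideanSpace ℝ (Fin n) → ℝ} (hu : Differentiable ℝ u)
    (hv : Differentiable ℝ v) (i : Fin n) :
    partialDeriv i (u - v) = partialDeriv i u - partialDeriv i v := by
  ext x
  simp [partialDeriv, fderiv_sub (hu x) (hv x)]

theorem partialDeriv_add {v : EuclideanSpace ℝ (Fin n) → ℝ} (hu : Differentiable ℝ u)
    (hv : Differentiable ℝ v) (i : Fin n) :
    partialDeriv i (u + v) = partialDeriv i u + partialDeriv i v := by
  ext x
  simp [partialDeriv, fderiv_add (hu x) (hv x)]

theorem partialDeriv_zero (i : Fin n) :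
    partialDeriv i (0 : EuclideanSpace ℝ (Fin n) → ℝ) = 0 := by
  ext x
  simp [partialDeriv]

theorem listDeriv_zero (l : List (Fin n)) :
    listDeriv l (0 : EuclideanSpace ℝ (Fin n) → ℝ) = 0 := by
  induction l with
  | nil => rfl
  | cons i l ih => rw [listDeriv_cons, ih, partialDeriv_zero]

theorem listDeriv_sub {v : EuclideanSpace ℝ (Fin n) → ℝ} (hu : IsTest u) (hv : IsTest v)
    (l : List (Fin n)) : listDeriv l (u - v) = listDeriv l u - listDeriv l v := by
  induction l with
  | nil => rfl
  | cons i l ih =>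
    rw [listDeriv_cons, ih, partialDeriv_sub (hu.listDeriv l).differentiable
      (hv.listDeriv l).differentiable]
    rfl

theorem listDeriv_add {v : EuclideanSpace ℝ (Fin n) → ℝ} (hu : IsTest u) (hv : IsTest v)
    (l : List (Fin n)) : listDeriv l (u + v) = listDeriv l u + listDeriv l v := by
  induction l with
  | nil => rfl
  | cons i l ih =>
    rw [listDeriv_cons, ih, partialDeriv_add (hu.listDeriv l).differentiable
      (hv.listDeriv l).differentiable]
    rfl

theorem listDeriv_sum {ι : Type*} (s : Finset ι) {F : ι → EuclideanSpace ℝ (Fin n) → ℝ}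
    (h : ∀ i ∈ s, IsTest (F i)) (l : List (Fin n)) :
    listDeriv l (∑ i ∈ s, F i) = ∑ i ∈ s, listDeriv l (F i) := by
  classical
  induction s using Finset.induction_on with
  | empty => simp [listDeriv_zero]
  | insert a s ha ih =>
    rw [Finset.sum_insert ha, Finset.sum_insert ha,
      listDeriv_add (h a (by simp)) (isTest_sum s fun i hi => h i (by simp [hi])),
      ih fun i hi => h i (by simp [hi])]

theorem partialDeriv_comm (hu : ContDiff ℝ ∞ u) (i j : Fin n) :
    partialDeriv i (partialDeriv j u) = partialDeriv j (partialDeriv i u) := by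
  have h2 : ContDiff ℝ 2 u := contDiff_infty.1 hu 2
  have hd : Differentiable ℝ (fderiv ℝ u) :=
    (hu.fderiv_right (m := ∞) (by simp)).differentiable (by simp)
  ext x
  have hs : IsSymmSndFDerivAt ℝ u x := h2.contDiffAt.isSymmSndFDerivAt (by simp)
  have key : ∀ a b : Fin n, partialDeriv a (partialDeriv b u) x =
      fderiv ℝ (fderiv ℝ u) x (EuclideanSpace.single a 1) (EuclideanSpace.single b 1) := by
    intro a b
    unfold partialDeriv
    rw [fderiv_clm_apply (hd x) (by fun_prop)]
    simp
  rw [key, key]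
  exact hs _ _

theorem listDeriv_perm (hu : ContDiff ℝ ∞ u) {l₁ l₂ : List (Fin n)} (h : l₁.Perm l₂) :
    listDeriv l₁ u = listDeriv l₂ u := by
  induction h with
  | nil => rfl
  | cons a _ ih => simp [ih]
  | swap a b l => exact partialDeriv_comm (contDiff_listDeriv hu l) _ _
  | trans _ _ h1 h2 => exact h1.trans h2

/-- Lists of directions replace multi-indices in the estimates: concatenation is composition of
derivatives, and an induction on the order peels off one direction at a time. For smooth functions
the order of the directions is immaterial. -/
theorem multiDeriv_eq_listDeriv_flatMap (α : Fin n → ℕ) (u : EuclideanSpace ℝ (Fin n) → ℝ) :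
    multiDeriv α u =
      listDeriv ((List.finRange n).flatMap fun i => List.replicate (α i) i) u := by
  have hrep : ∀ (k : ℕ) (i : Fin n) (f : EuclideanSpace ℝ (Fin n) → ℝ),
      (partialDeriv i)^[k] f = listDeriv (List.replicate k i) f := by
    intro k i f
    induction k with
    | zero => rfl
    | succ k ih => rw [Function.iterate_succ_apply', ih, List.replicate_succ, listDeriv_cons]
  unfold multiDeriv
  generalize List.finRange n = L
  induction L with
  | nil => rfl
  | cons i L ih => rw [List.foldr_cons, ih, hrep, List.flatMap_cons, listDeriv_append]

theorem exists_multiDeriv_eq_listDeriv (α : Fin n → ℕ) :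
    ∃ l : List (Fin n), l.length = ∑ i, α i ∧
      ∀ u : EuclideanSpace ℝ (Fin n) → ℝ, multiDeriv α u = listDeriv l u := by
  refine ⟨_, ?_, multiDeriv_eq_listDeriv_flatMap α⟩
  rw [List.length_flatMap]
  simp [← List.ofFn_eq_map, List.sum_ofFn]

theorem listDeriv_eq_multiDeriv (hu : ContDiff ℝ ∞ u) (l : List (Fin n)) :
    listDeriv l u = multiDeriv (fun i => l.count i) u := by
  rw [multiDeriv_eq_listDeriv_flatMap]
  apply listDeriv_perm hu
  rw [List.perm_iff_count]
  intro a
  rw [List.count_flatMap]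
  simp only [Function.comp_def, List.count_replicate, beq_iff_eq]
  rw [← List.ofFn_eq_map, List.sum_ofFn]
  simp

theorem sum_count_eq_length (l : List (Fin n)) : ∑ i, l.count i = l.length := by
  induction l with
  | nil => simp
  | cons a l ih => simp [List.count_cons, Finset.sum_add_distrib, ih]

end Derivatives

/-! ### Test functions have finite norms -/

section Finiteness

variable {n : ℕ} {u : EuclideanSpace ℝ (Fin n) → ℝ}

theorem IsTest.exists_bound (hu : IsTest u) : ∃ M : ℝ, 0 ≤ M ∧ ∀ x, |u x| ≤ M := by
  obtain ⟨M, hM⟩ := hu.continuous.bounded_above_of_compact_support hu.compact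
  exact ⟨M, (norm_nonneg _).trans (hM 0), hM⟩

theorem norm_fderiv_le_sum (x : EuclideanSpace ℝ (Fin n)) :
    ‖fderiv ℝ u x‖ ≤ ∑ i, |partialDeriv i u x| := by
  refine ContinuousLinearMap.opNorm_le_bound _ (Finset.sum_nonneg fun i _ => abs_nonneg _) ?_
  intro h
  have hh : h = ∑ i, h i • EuclideanSpace.single i (1 : ℝ) := by
    ext j
    simp [Finset.sum_apply, Pi.single_apply]
  have e : fderiv ℝ u x h = ∑ i, h i * partialDeriv i u x := by
    conv_lhs => rw [hh]
    rw [map_sum]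
    simp [partialDeriv]
  rw [e, Finset.sum_mul]
  refine (norm_sum_le _ _).trans (Finset.sum_le_sum fun i _ => ?_)
  rw [norm_mul, mul_comm, Real.norm_eq_abs (partialDeriv i u x)]
  gcongr
  exact PiLp.norm_apply_le h i

theorem abs_sub_le_of_partialDeriv_le (hu : Differentiable ℝ u) {M : ℝ}
    (h : ∀ i x, |partialDeriv i u x| ≤ M) (x y : EuclideanSpace ℝ (Fin n)) :
    |u x - u y| ≤ n * M * ‖x - y‖ := by
  have := Convex.norm_image_sub_le_of_norm_fderiv_le (𝕜 := ℝ) (f := u) (s := Set.univ)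
    (C := n * M) (fun z _ => hu z) (fun z _ => ?_) convex_univ (Set.mem_univ y) (Set.mem_univ x)
  · simpa using this
  · refine (norm_fderiv_le_sum z).trans ?_
    refine (Finset.sum_le_sum fun i _ => h i z).trans ?_
    simp

/-- At distance at most 1 the mean value inequality applies, and a distance below 1 is at most its
power `s ≤ 1`. At larger distance twice the supremum suffices. -/
theorem IsTest.exists_holder (hu : IsTest u) {s : ℝ} (hs0 : 0 < s) (hs1 : s ≤ 1) :
    ∃ M : ℝ, 0 ≤ M ∧ ∀ x y, |u x - u y| ≤ M * ‖x - y‖ ^ s := by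
  obtain ⟨M, hM0, hM⟩ := hu.exists_bound
  choose L hL0 hL using fun i => (hu.partialDeriv i).exists_bound
  have hLs : ∀ i, L i ≤ ∑ j, L j := fun i =>
    Finset.single_le_sum (fun j _ => hL0 j) (Finset.mem_univ i)
  have hS : 0 ≤ ∑ j, L j := Finset.sum_nonneg fun j _ => hL0 j
  refine ⟨2 * M + n * ∑ j, L j, by positivity, fun x y => ?_⟩
  rcases le_total ‖x - y‖ 1 with h | h
  · refine (abs_sub_le_of_partialDeriv_le hu.differentiable
      (fun i z => (hL i z).trans (hLs i)) x y).trans ?_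
    have : ‖x - y‖ ≤ ‖x - y‖ ^ s := by
      conv_lhs => rw [← Real.rpow_one ‖x - y‖]
      rcases (norm_nonneg (x - y)).eq_or_lt with h0 | h0
      · rw [← h0, Real.zero_rpow hs0.ne', Real.zero_rpow one_ne_zero]
      · exact Real.rpow_le_rpow_of_exponent_ge h0 h hs1
    gcongr
    linarith
  · have h1 : 1 ≤ ‖x - y‖ ^ s := Real.one_le_rpow h hs0.le
    have h2 : |u x - u y| ≤ 2 * M := by
      have := abs_sub (u x) (u y)
      linarith [hM x, hM y]
    have : 0 ≤ (n : ℝ) * ∑ j, L j := by positivity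
    nlinarith

theorem enorm_sub_div_le {u : EuclideanSpace ℝ (Fin n) → ℝ} {s M : ℝ}
    {x y : EuclideanSpace ℝ (Fin n)} (hxy : x ≠ y) (h : |u x - u y| ≤ M * ‖x - y‖ ^ s) :
    ‖u x - u y‖ₑ / ‖x - y‖ₑ ^ s ≤ ENNReal.ofReal M := by
  have hpos : 0 < ‖x - y‖ := norm_pos_iff.2 (sub_ne_zero.2 hxy)
  have hp : (0 : ℝ) < ‖x - y‖ ^ s := Real.rpow_pos_of_pos hpos _
  rw [← ofReal_norm (x - y), ENNReal.ofReal_rpow_of_pos hpos,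
    Real.enorm_eq_ofReal_abs, ← ENNReal.ofReal_div_of_pos hp]
  exact ENNReal.ofReal_le_ofReal ((div_le_iff₀ hp).2 h)

theorem abs_sub_le_of_enorm_sub_div_le {u : EuclideanSpace ℝ (Fin n) → ℝ} {s M : ℝ} (hM : 0 ≤ M)
    (x y : EuclideanSpace ℝ (Fin n)) (h : x ≠ y → ‖u x - u y‖ₑ / ‖x - y‖ₑ ^ s ≤ ENNReal.ofReal M) :
    |u x - u y| ≤ M * ‖x - y‖ ^ s := by
  rcases eq_or_ne x y with rfl | hxy
  · simpa using mul_nonneg hM (Real.rpow_nonneg le_rfl _)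
  have hpos : 0 < ‖x - y‖ := norm_pos_iff.2 (sub_ne_zero.2 hxy)
  have hp : (0 : ℝ) < ‖x - y‖ ^ s := Real.rpow_pos_of_pos hpos _
  have hdiv := h hxy
  rw [← ofReal_norm (x - y), ENNReal.ofReal_rpow_of_pos hpos,
    Real.enorm_eq_ofReal_abs, ← ENNReal.ofReal_div_of_pos hp, ENNReal.ofReal_le_ofReal_iff hM] at hdiv
  exact (div_le_iff₀ hp).1 hdiv

/-- A bound of the Hölder norm by bounds of the derivatives along lists. -/
theorem holderNorm_le {m : ℕ} {s M : ℝ}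
    (h1 : ∀ l : List (Fin n), l.length ≤ m → ∀ x, |listDeriv l u x| ≤ M)
    (h2 : ∀ l : List (Fin n), l.length = m → ∀ x y,
      |listDeriv l u x - listDeriv l u y| ≤ M * ‖x - y‖ ^ s) :
    holderNorm m s u ≤ ((multiIndices n m).card + 1 : ℕ) * ENNReal.ofReal M := by
  unfold holderNorm
  have e : (((multiIndices n m).card + 1 : ℕ) : ℝ≥0∞) * ENNReal.ofReal M =
      ENNReal.ofReal M + ∑ α ∈ multiIndices n m, ENNReal.ofReal M := by
    rw [Finset.sum_const, nsmul_eq_mul]; push_cast; ring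
  rw [e]
  refine add_le_add ?_ (Finset.sum_le_sum fun α hα => ?_)
  · refine iSup_le fun α => iSup_le fun hα => iSup_le fun x => ?_
    obtain ⟨l, hl, hlu⟩ := exists_multiDeriv_eq_listDeriv α
    rw [hlu, Real.enorm_eq_ofReal_abs]
    exact ENNReal.ofReal_le_ofReal (h1 l (hl ▸ hα) x)
  · obtain ⟨l, hl, hlu⟩ := exists_multiDeriv_eq_listDeriv α
    rw [mem_multiIndices] at hα
    refine iSup_le fun x => iSup_le fun y => iSup_le fun hxy => ?_
    rw [hlu]
    exact enorm_sub_div_le hxy (h2 l (hl.trans hα) x y)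

theorem IsTest.holderNorm_lt_top (hu : IsTest u) {m : ℕ} {s : ℝ} (hs0 : 0 < s) (hs1 : s ≤ 1) :
    holderNorm m s u < ⊤ := by
  unfold holderNorm
  refine ENNReal.add_lt_top.2 ⟨?_, ENNReal.sum_lt_top.2 fun α _ => ?_⟩
  · choose l hl hlu using exists_multiDeriv_eq_listDeriv (n := n)
    choose M hM0 hM using fun α : Fin n → ℕ => (hu.listDeriv (l α)).exists_bound
    have hfin : {α : Fin n → ℕ | ∑ i, α i ≤ m}.Finite := by
      refine (Set.finite_Iic (fun _ : Fin n => m)).subset fun α hα i => ?_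
      exact (Finset.single_le_sum (fun j _ => Nat.zero_le (α j)) (Finset.mem_univ i)).trans hα
    refine lt_of_le_of_lt (b := ∑ α ∈ hfin.toFinset, ENNReal.ofReal (M α)) ?_
      (ENNReal.sum_lt_top.2 fun _ _ => ENNReal.ofReal_lt_top)
    refine iSup_le fun α => iSup_le fun hα => iSup_le fun x => ?_
    refine le_trans ?_ (Finset.single_le_sum (f := fun α => ENNReal.ofReal (M α))
      (fun _ _ => zero_le) (hfin.mem_toFinset.2 hα))
    rw [hlu, Real.enorm_eq_ofReal_abs]
    exact ENNReal.ofReal_le_ofReal (hM α x)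
  · obtain ⟨l, hl, hlu⟩ := exists_multiDeriv_eq_listDeriv α
    obtain ⟨M, hM0, hM⟩ := (hu.listDeriv l).exists_holder hs0 hs1
    refine lt_of_le_of_lt ?_ (ENNReal.ofReal_lt_top (r := M))
    refine iSup_le fun x => iSup_le fun y => iSup_le fun hxy => ?_
    rw [hlu]
    exact enorm_sub_div_le hxy (hM x y)

theorem IsTest.xNorm_lt_top (hn : 0 < n) (hu : IsTest u) (μ : ℝ) : xNorm μ u < ⊤ := by
  unfold xNorm
  split_ifs with h1 h2
  · exact (hu.memLp _).2
  · exact (hu.memLp _).2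
  · have hμ : μ < 0 := lt_of_le_of_ne (not_lt.1 h1) h2
    obtain ⟨h3, h4⟩ := holderExponent_mem hn hμ
    exact hu.holderNorm_lt_top h3 h4

theorem IsTest.memX (hn : 0 < n) (hu : IsTest u) (μ : ℝ) : MemX μ u := by
  refine ⟨?_, hu.xNorm_lt_top hn μ⟩
  split_ifs
  · exact hu.continuous.aestronglyMeasurable
  · exact hu.smooth.of_le (by exact_mod_cast le_top)

theorem IsTest.memXk (hn : 0 < n) (hu : IsTest u) (k : ℕ) (μ : ℝ) : MemXk k μ u := by
  intro α _
  obtain ⟨l, -, hlu⟩ := exists_multiDeriv_eq_listDeriv α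
  rw [hlu]
  exact (hu.listDeriv l).memX hn μ

end Finiteness

end GagNir

namespace GagNir

/-! ### Averages of translates -/

section Averages

/-- Hölder's inequality against the constant 1, that is, Jensen's inequality for a measure that is
not normalised. -/
theorem lintegral_rpow_le_measure_univ_rpow_mul {Ω : Type*} [MeasurableSpace Ω] (ν : Measure Ω)
    {g : Ω → ℝ≥0∞} (hg : AEMeasurable g ν) {t : ℝ} (ht : 1 ≤ t) :
    (∫⁻ w, g w ∂ν) ^ t ≤ ν Set.univ ^ (t - 1) * ∫⁻ w, g w ^ t ∂ν := by
  rcases ht.eq_or_lt with rfl | ht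
  · simp
  have ht0 : 0 < t := by linarith
  have h := ENNReal.lintegral_mul_le_Lp_mul_Lq ν (Real.HolderConjugate.conjExponent ht) hg
    (aemeasurable_const (b := (1 : ℝ≥0∞)))
  simp only [Pi.mul_apply, mul_one, ENNReal.one_rpow, lintegral_const, one_mul] at h
  have h2 := ENNReal.rpow_le_rpow h ht0.le
  rw [ENNReal.mul_rpow_of_nonneg _ _ ht0.le, ← ENNReal.rpow_mul, ← ENNReal.rpow_mul,
    one_div_mul_cancel ht0.ne', ENNReal.rpow_one, mul_comm] at h2
  refine h2.trans_eq ?_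
  congr 2
  rw [Real.conjExponent]
  have : t - 1 ≠ 0 := by linarith
  field_simp

variable {n : ℕ} {Ω : Type*} [MeasurableSpace Ω]

/-- Averages of translates are bounded on every `L^t`. -/
theorem eLpNorm_lintegral_translate_le (ν : Measure Ω) [SFinite ν]
    {Y : Ω → EuclideanSpace ℝ (Fin n)} (hY : Measurable Y)
    {F : EuclideanSpace ℝ (Fin n) → ℝ≥0∞} (hF : Measurable F) {t : ℝ≥0∞} (ht : 1 ≤ t) :
    eLpNorm (fun x => ∫⁻ w, F (x - Y w) ∂ν) t volume ≤ ν Set.univ * eLpNorm F t volume := by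
  have hm : Measurable fun p : EuclideanSpace ℝ (Fin n) × Ω => F (p.1 - Y p.2) :=
    hF.comp (measurable_fst.sub (hY.comp measurable_snd))
  rcases eq_or_ne t ⊤ with rfl | htop
  · simp only [eLpNorm_exponent_top]
    set K := eLpNormEssSup F volume with hK
    have hs : MeasurableSet {p : EuclideanSpace ℝ (Fin n) × Ω | ¬ F (p.1 - Y p.2) ≤ K} :=
      (measurableSet_le hm measurable_const).compl
    have hnull : (volume.prod ν) {p : EuclideanSpace ℝ (Fin n) × Ω | ¬ F (p.1 - Y p.2) ≤ K} = 0 := by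
      rw [Measure.prod_apply_symm hs]
      -- Each section is a translate of the null set where `F` exceeds its essential supremum.
      refine (lintegral_congr fun w => ?_).trans (lintegral_zero)
      have : (fun x => (x, w)) ⁻¹' {p : EuclideanSpace ℝ (Fin n) × Ω | ¬ F (p.1 - Y p.2) ≤ K} =
          (fun x => x - Y w) ⁻¹' {x | ¬ F x ≤ K} := rfl
      rw [this]
      have h0 : volume {x | ¬ F x ≤ K} = 0 := ae_le_eLpNormEssSup (f := F) (μ := volume)
      exact (measurePreserving_sub_right volume (Y w)).quasiMeasurePreserving.preimage_null h0
    have hae : ∀ᵐ p ∂(volume.prod ν), F (p.1 - Y p.2) ≤ K := hnull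
    refine eLpNormEssSup_le_of_ae_enorm_bound ?_
    filter_upwards [Measure.ae_ae_of_ae_prod hae] with x hx
    calc _ ≤ ∫⁻ _, K ∂ν := lintegral_mono_ae hx
      _ = _ := by rw [lintegral_const, mul_comm]
  · have ht0 : t ≠ 0 := (zero_lt_one.trans_le ht).ne'
    have ht1 : 1 ≤ t.toReal := by
      rw [← ENNReal.toReal_one]; exact (ENNReal.toReal_le_toReal (by simp) htop).2 ht
    have htp : 0 < t.toReal := by linarith
    rw [eLpNorm_eq_lintegral_rpow_enorm_toReal ht0 htop,
      eLpNorm_eq_lintegral_rpow_enorm_toReal ht0 htop, one_div, ENNReal.rpow_inv_le_iff htp,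
      ENNReal.mul_rpow_of_nonneg _ _ htp.le, ← ENNReal.rpow_mul, inv_mul_cancel₀ htp.ne',
      ENNReal.rpow_one]
    simp only [enorm_eq_self]
    calc ∫⁻ x, (∫⁻ w, F (x - Y w) ∂ν) ^ t.toReal
        ≤ ∫⁻ x, ν Set.univ ^ (t.toReal - 1) * ∫⁻ w, F (x - Y w) ^ t.toReal ∂ν :=
          lintegral_mono fun x => lintegral_rpow_le_measure_univ_rpow_mul ν
            (hm.comp measurable_prodMk_left).aemeasurable ht1
      _ = ν Set.univ ^ (t.toReal - 1) * ∫⁻ x, ∫⁻ w, F (x - Y w) ^ t.toReal ∂ν := by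
          rw [lintegral_const_mul _ (hm.pow_const _).lintegral_prod_right']
      _ = ν Set.univ ^ (t.toReal - 1) * (ν Set.univ * ∫⁻ x, F x ^ t.toReal) := by
          rw [lintegral_lintegral_swap (hm.pow_const _).aemeasurable]
          congr 1
          rw [mul_comm, ← lintegral_const]
          exact lintegral_congr fun w => lintegral_sub_right_eq_self (fun x => F x ^ t.toReal) (Y w)
      _ = _ := by
          rw [← mul_assoc]
          congr 1
          conv_lhs => rw [mul_comm, ← ENNReal.rpow_one (ν Set.univ), ← ENNReal.rpow_mul, one_mul,
            ← ENNReal.rpow_add_of_nonneg _ _ zero_le_one (by linarith)]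
          congr 1
          ring

theorem lintegral_comp_sub_smul (F : EuclideanSpace ℝ (Fin n) → ℝ≥0∞) (hF : Measurable F)
    {δ : ℝ} (hδ : 0 < δ) (x : EuclideanSpace ℝ (Fin n)) :
    ∫⁻ z, F (x - δ • z) = ENNReal.ofReal ((δ ^ n)⁻¹) * ∫⁻ z, F z := by
  have h := Measure.map_addHaar_smul (volume : Measure (EuclideanSpace ℝ (Fin n))) hδ.ne'
  rw [finrank_euclideanSpace_fin, abs_of_nonneg (by positivity)] at h
  calc ∫⁻ z, F (x - δ • z) = ∫⁻ y, F (x - y) ∂(Measure.map (fun z => δ • z) volume) := by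
        rw [lintegral_map (f := fun y => F (x - y)) (hF.comp (by fun_prop)) (by fun_prop)]
    _ = _ := by rw [h, lintegral_smul_measure, lintegral_sub_left_eq_self F x, smul_eq_mul]

end Averages

/-! ### Convolution with dilated kernels -/

section Convolution

variable {n : ℕ}

/-- The convolution of two real functions on `ℝⁿ`. -/
noncomputable def conv (k f : EuclideanSpace ℝ (Fin n) → ℝ) : EuclideanSpace ℝ (Fin n) → ℝ :=
  convolution k f (ContinuousLinearMap.mul ℝ ℝ) volume

/-- The dilate `δ⁻ⁿ χ(·/δ)`. -/
noncomputable def dil (δ : ℝ) (χ : EuclideanSpace ℝ (Fin n) → ℝ) :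
    EuclideanSpace ℝ (Fin n) → ℝ :=
  fun z => (δ ^ n)⁻¹ * χ (δ⁻¹ • z)

variable {k f g χ : EuclideanSpace ℝ (Fin n) → ℝ} {δ : ℝ}

theorem conv_apply (k f : EuclideanSpace ℝ (Fin n) → ℝ) (x : EuclideanSpace ℝ (Fin n)) :
    conv k f x = ∫ z, k z * f (x - z) := rfl

theorem conv_comm (k f : EuclideanSpace ℝ (Fin n) → ℝ) : conv k f = conv f k := by
  ext x
  rw [conv, convolution_mul_swap, conv_apply]
  exact integral_congr_ae (.of_forall fun z => mul_comm _ _)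

theorem IsTest.convolutionExists (hk : IsTest k) (hf : IsTest f) :
    ConvolutionExists k f (ContinuousLinearMap.mul ℝ ℝ) volume :=
  hf.compact.convolutionExists_right _ hk.integrable.locallyIntegrable hf.continuous

theorem IsTest.conv (hk : IsTest k) (hf : IsTest f) : IsTest (conv k f) :=
  ⟨hf.compact.contDiff_convolution_right _ hk.integrable.locallyIntegrable hf.smooth,
    hk.compact.convolution _ hf.compact⟩

theorem partialDeriv_conv_right (hk : IsTest k) (hf : IsTest f) (i : Fin n) :
    partialDeriv i (conv k f) = conv k (partialDeriv i f) := by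
  ext x
  have h := hf.compact.hasFDerivAt_convolution_right (ContinuousLinearMap.mul ℝ ℝ)
    hk.integrable.locallyIntegrable (hf.smooth.of_le (by simp)) x
  unfold partialDeriv conv
  rw [h.fderiv, convolution_precompR_apply _ hk.integrable.locallyIntegrable
    (hf.compact.fderiv (𝕜 := ℝ)) (hf.smooth.continuous_fderiv (by simp))]

theorem partialDeriv_conv_left (hk : IsTest k) (hf : IsTest f) (i : Fin n) :
    partialDeriv i (conv k f) = conv (partialDeriv i k) f := by
  rw [conv_comm, partialDeriv_conv_right hf hk, conv_comm]

theorem listDeriv_conv_right (hk : IsTest k) (hf : IsTest f) (l : List (Fin n)) :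
    listDeriv l (conv k f) = conv k (listDeriv l f) := by
  induction l with
  | nil => rfl
  | cons i l ih =>
    rw [listDeriv_cons, ih, partialDeriv_conv_right hk (hf.listDeriv l), listDeriv_cons]

theorem listDeriv_conv_left (hk : IsTest k) (hf : IsTest f) (l : List (Fin n)) :
    listDeriv l (conv k f) = conv (listDeriv l k) f := by
  rw [conv_comm, listDeriv_conv_right hf hk, conv_comm]

theorem IsTest.abs (hf : IsTest f) :
    Continuous (fun x => ‖f x‖) ∧ HasCompactSupport fun x => ‖f x‖ :=
  ⟨hf.continuous.norm, hf.compact.norm⟩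

/-- Compact supports make the iterated integrals absolutely convergent. Associativity is what makes
mollifications at different scales commute. -/
theorem conv_assoc (hk : IsTest k) (hf : IsTest f) (hg : IsTest g) :
    conv (conv k f) g = conv k (conv f g) := by
  ext x
  unfold conv
  refine convolution_assoc (ContinuousLinearMap.mul ℝ ℝ) (ContinuousLinearMap.mul ℝ ℝ)
    (ContinuousLinearMap.mul ℝ ℝ) (ContinuousLinearMap.mul ℝ ℝ) (fun a b c => ?_)
    hk.continuous.aestronglyMeasurable hf.continuous.aestronglyMeasurable
    hg.continuous.aestronglyMeasurable (.of_forall fun y => hk.convolutionExists hf y)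
    (.of_forall fun y => ?_) ?_
  · simp [mul_assoc]
  · exact hg.abs.2.convolutionExists_right _
      (hf.abs.1.integrable_of_hasCompactSupport hf.abs.2).locallyIntegrable hg.abs.1 y
  · refine HasCompactSupport.convolutionExists_right _ (hf.abs.2.convolution _ hg.abs.2)
      (hk.abs.1.integrable_of_hasCompactSupport hk.abs.2).locallyIntegrable
      (hg.abs.2.continuous_convolution_right _
        (hf.abs.1.integrable_of_hasCompactSupport hf.abs.2).locallyIntegrable hg.abs.1) x

theorem conv_left_comm (hk : IsTest k) (hf : IsTest f) (hg : IsTest g) :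
    conv k (conv f g) = conv f (conv k g) := by
  rw [← conv_assoc hk hf hg, conv_comm k f, conv_assoc hf hk hg]

theorem conv_sub (hk : IsTest k) (hf : IsTest f) (hg : IsTest g) :
    conv k (f - g) = conv k f - conv k g := by
  ext x
  have h1 := hk.convolutionExists hf x
  have h2 := hk.convolutionExists hg x
  simp only [conv_apply, Pi.sub_apply, mul_sub]
  exact integral_sub h1 h2

theorem IsTest.dil (hχ : IsTest χ) (hδ : 0 < δ) : IsTest (dil δ χ) := by
  refine ⟨contDiff_const.mul (hχ.smooth.comp (contDiff_const_smul _)), ?_⟩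
  exact (hχ.compact.comp_smul (inv_ne_zero hδ.ne')).mul_left

/-- Rescaling the variable exhibits the convolution as an average of translates by δz with the fixed
weight χ; this is why the `L^t` bounds do not depend on δ. -/
theorem conv_dil_apply (hδ : 0 < δ) (x : EuclideanSpace ℝ (Fin n)) :
    conv (dil δ χ) f x = ∫ z, χ z * f (x - δ • z) := by
  rw [conv_apply]
  have h := Measure.integral_comp_inv_smul (volume : Measure (EuclideanSpace ℝ (Fin n)))
    (fun z => χ z * f (x - δ • z)) δ
  rw [finrank_euclideanSpace_fin, abs_of_nonneg (by positivity)] at h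
  have e : ∀ z, dil δ χ z * f (x - z) = (δ ^ n)⁻¹ * (χ (δ⁻¹ • z) * f (x - δ • δ⁻¹ • z)) := by
    intro z
    rw [smul_inv_smul₀ hδ.ne', dil, mul_assoc]
  simp_rw [e]
  rw [integral_const_mul, h, smul_eq_mul, ← mul_assoc, inv_mul_cancel₀ (by positivity), one_mul]

theorem partialDeriv_dil (hχ : IsTest χ) (i : Fin n) :
    partialDeriv i (dil δ χ) = δ⁻¹ • dil δ (partialDeriv i χ) := by
  ext x
  have h1 : HasFDerivAt (fun z => χ (δ⁻¹ • z))
      ((fderiv ℝ χ (δ⁻¹ • x)).comp (δ⁻¹ • ContinuousLinearMap.id ℝ _)) x :=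
    (hχ.differentiable (δ⁻¹ • x)).hasFDerivAt.comp x
      ((ContinuousLinearMap.id ℝ (EuclideanSpace ℝ (Fin n))).hasFDerivAt.const_smul δ⁻¹)
  have h2 := h1.const_mul (δ ^ n)⁻¹
  unfold partialDeriv dil
  rw [h2.fderiv]
  simp
  ring

theorem conv_smul_left (c : ℝ) (k f : EuclideanSpace ℝ (Fin n) → ℝ) :
    conv (c • k) f = c • conv k f := by
  exact smul_convolution

theorem listDeriv_dil (hχ : IsTest χ) (hδ : 0 < δ) (l : List (Fin n)) :
    listDeriv l (dil δ χ) = (δ⁻¹ ^ l.length) • dil δ (listDeriv l χ) := by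
  induction l with
  | nil => simp
  | cons i l ih =>
    rw [listDeriv_cons, ih]
    have : partialDeriv i (δ⁻¹ ^ l.length • dil δ (listDeriv l χ)) =
        δ⁻¹ ^ l.length • partialDeriv i (dil δ (listDeriv l χ)) := by
      ext x
      unfold partialDeriv
      rw [fderiv_const_smul (((hχ.listDeriv l).dil hδ).differentiable x)]
      rfl
    rw [this, partialDeriv_dil (hχ.listDeriv l), smul_smul, List.length_cons, pow_succ,
      listDeriv_cons]

theorem IsTest.lintegral_enorm_lt_top (hχ : IsTest χ) : ∫⁻ z, ‖χ z‖ₑ < ⊤ :=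
  hχ.integrable.2

theorem enorm_conv_dil_le (hδ : 0 < δ) (hχ : IsTest χ) (hf : IsTest f)
    (x : EuclideanSpace ℝ (Fin n)) :
    ‖conv (dil δ χ) f x‖ₑ ≤
      ∫⁻ z, ‖f (x - δ • z)‖ₑ ∂(volume.withDensity fun z => ‖χ z‖ₑ) := by
  rw [conv_dil_apply hδ]
  refine (enorm_integral_le_lintegral_enorm _).trans_eq ?_
  have hm : Measurable fun z => ‖f (x - δ • z)‖ₑ :=
    (hf.continuous.comp (by fun_prop : Continuous fun z => x - δ • z)).measurable.enorm
  rw [lintegral_withDensity_eq_lintegral_mul _ hχ.continuous.measurable.enorm hm]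
  simp [enorm_mul]

theorem eLpNorm_conv_dil_le (hδ : 0 < δ) (hχ : IsTest χ) (hf : IsTest f) {t : ℝ≥0∞}
    (ht : 1 ≤ t) :
    eLpNorm (conv (dil δ χ) f) t volume ≤ (∫⁻ z, ‖χ z‖ₑ) * eLpNorm f t volume := by
  have h := eLpNorm_lintegral_translate_le (volume.withDensity fun z => ‖χ z‖ₑ)
    (Y := fun z => δ • z) (by fun_prop) hf.continuous.measurable.enorm ht
  rw [withDensity_apply _ MeasurableSet.univ, setLIntegral_univ, eLpNorm_enorm] at h
  refine le_trans ?_ h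
  exact eLpNorm_mono_enorm fun x => (enorm_conv_dil_le hδ hχ hf x).trans_eq (enorm_eq_self _).symm

/-- The set where the inequality holds is closed by continuity, and dense because its complement is
null. -/
theorem IsTest.enorm_le_eLpNorm_top (hf : IsTest f) (x : EuclideanSpace ℝ (Fin n)) :
    ‖f x‖ₑ ≤ eLpNorm f ⊤ volume := by
  have hc : IsClosed {y | ‖f y‖ₑ ≤ eLpNorm f ⊤ volume} :=
    isClosed_le hf.continuous.enorm continuous_const
  have hd : Dense {y | ‖f y‖ₑ ≤ eLpNorm f ⊤ volume} := by
    refine Measure.dense_of_ae (μ := volume) ?_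
    rw [eLpNorm_exponent_top]
    exact ae_le_eLpNormEssSup
  have hx : x ∈ {y | ‖f y‖ₑ ≤ eLpNorm f ⊤ volume} := by
    rw [← hc.closure_eq, hd.closure_eq]; exact Set.mem_univ x
  exact hx

/-- Convolution with a dilated kernel maps `L^t` to `L^∞`. -/
theorem exists_enorm_conv_dil_le (hχ : IsTest χ) {t : ℝ≥0∞} (ht : 1 ≤ t) :
    ∃ C : ℝ≥0, ∀ {δ : ℝ}, 0 < δ → ∀ {f : EuclideanSpace ℝ (Fin n) → ℝ}, IsTest f → ∀ x,
      ‖conv (dil δ χ) f x‖ₑ ≤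
        C * ENNReal.ofReal (δ ^ (-((n : ℝ) * t.toReal⁻¹))) * eLpNorm f t volume := by
  obtain ⟨M, hM0, hM⟩ := hχ.exists_bound
  set I := ∫⁻ z, ‖χ z‖ₑ with hI
  have hItop : I ≠ ⊤ := hχ.lintegral_enorm_lt_top.ne
  -- At `t = ⊤` the convention `⊤.toReal⁻¹ = 0` makes the power of δ trivial.
  rcases eq_or_ne t ⊤ with rfl | htop
  · refine ⟨I.toNNReal, fun {δ} hδ {f} hf x => ?_⟩
    refine (enorm_conv_dil_le hδ hχ hf x).trans ?_
    refine (lintegral_mono fun z => hf.enorm_le_eLpNorm_top _).trans ?_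
    rw [lintegral_const, withDensity_apply _ MeasurableSet.univ, setLIntegral_univ, ← hI,
      ENNReal.coe_toNNReal hItop]
    simp [mul_comm]
  · have ht0 : t ≠ 0 := (zero_lt_one.trans_le ht).ne'
    have ht1 : 1 ≤ t.toReal := by
      rw [← ENNReal.toReal_one]; exact (ENNReal.toReal_le_toReal (by simp) htop).2 ht
    set T := t.toReal with hT
    have htp : 0 < T := by linarith
    have hK : (I ^ (T - 1) * ENNReal.ofReal M) ^ T⁻¹ ≠ ⊤ :=
      ENNReal.rpow_ne_top_of_nonneg (by positivity) (ENNReal.mul_ne_top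
        (ENNReal.rpow_ne_top_of_nonneg (by linarith) hItop) ENNReal.ofReal_ne_top)
    refine ⟨((I ^ (T - 1) * ENNReal.ofReal M) ^ T⁻¹).toNNReal, fun {δ} hδ {f} hf x => ?_⟩
    rw [ENNReal.coe_toNNReal hK]
    have hm : Measurable fun z => ‖f (x - δ • z)‖ₑ :=
      (hf.continuous.comp (by fun_prop : Continuous fun z => x - δ • z)).measurable.enorm
    -- Jensen's inequality for the measure |χ| dz comes first. Replacing |χ| by its bound `M` then
    -- leaves Lebesgue measure, whose change of variables produces δ⁻ⁿ.
    have h1 : ‖conv (dil δ χ) f x‖ₑ ^ T ≤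
        I ^ (T - 1) * ENNReal.ofReal M * (ENNReal.ofReal ((δ ^ n)⁻¹) * ∫⁻ z, ‖f z‖ₑ ^ T) := by
      calc ‖conv (dil δ χ) f x‖ₑ ^ T
          ≤ (∫⁻ z, ‖f (x - δ • z)‖ₑ ∂(volume.withDensity fun z => ‖χ z‖ₑ)) ^ T :=
            ENNReal.rpow_le_rpow (enorm_conv_dil_le hδ hχ hf x) htp.le
        _ ≤ I ^ (T - 1) * ∫⁻ z, ‖f (x - δ • z)‖ₑ ^ T ∂(volume.withDensity fun z => ‖χ z‖ₑ) := by
            refine (lintegral_rpow_le_measure_univ_rpow_mul _ hm.aemeasurable ht1).trans_eq ?_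
            rw [withDensity_apply _ MeasurableSet.univ, setLIntegral_univ]
        _ ≤ I ^ (T - 1) * ∫⁻ z, ENNReal.ofReal M * ‖f (x - δ • z)‖ₑ ^ T := by
            rw [lintegral_withDensity_eq_lintegral_mul _ hχ.continuous.measurable.enorm
              (hm.pow_const _)]
            gcongr with z
            rw [Pi.mul_apply]
            gcongr
            rw [Real.enorm_eq_ofReal_abs]
            exact ENNReal.ofReal_le_ofReal (hM z)
        _ = _ := by
            rw [lintegral_const_mul _ (hm.pow_const _), mul_assoc,
              lintegral_comp_sub_smul (fun y => ‖f y‖ₑ ^ T)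
                (hf.continuous.measurable.enorm.pow_const _) hδ x]
    rw [eLpNorm_eq_lintegral_rpow_enorm_toReal ht0 htop, ← hT, one_div]
    have h2 := ENNReal.rpow_le_rpow h1 (inv_nonneg.2 htp.le)
    rw [← ENNReal.rpow_mul, mul_inv_cancel₀ htp.ne', ENNReal.rpow_one,
      ENNReal.mul_rpow_of_nonneg _ _ (inv_nonneg.2 htp.le),
      ENNReal.mul_rpow_of_nonneg _ (∫⁻ _, _) (inv_nonneg.2 htp.le)] at h2
    refine h2.trans_eq ?_
    rw [← mul_assoc]
    congr 2
    rw [ENNReal.ofReal_rpow_of_nonneg (by positivity) (inv_nonneg.2 htp.le),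
      ← Real.rpow_natCast, ← Real.rpow_neg hδ.le, ← Real.rpow_mul hδ.le, neg_mul]

theorem IsTest.abs_le_of_eLpNorm_top_le (hf : IsTest f) {A : ℝ} (hA : 0 ≤ A)
    (h : eLpNorm f ⊤ volume ≤ ENNReal.ofReal A) (x : EuclideanSpace ℝ (Fin n)) : |f x| ≤ A := by
  have h2 := (hf.enorm_le_eLpNorm_top x).trans h
  rwa [Real.enorm_eq_ofReal_abs, ENNReal.ofReal_le_ofReal_iff hA] at h2

theorem eLpNorm_top_le_of_abs_le {A : ℝ} (h : ∀ x, |f x| ≤ A) :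
    eLpNorm f ⊤ volume ≤ ENNReal.ofReal A := by
  rw [eLpNorm_exponent_top]
  refine eLpNormEssSup_le_of_ae_enorm_bound (.of_forall fun x => ?_)
  rw [Real.enorm_eq_ofReal_abs]
  exact ENNReal.ofReal_le_ofReal (h x)

end Convolution

end GagNir

namespace GagNir

/-! ### The mollification error and what it gains -/

section Mollifier

variable {n : ℕ}

/-- A standard mollifier, supported in the unit ball. -/
noncomputable def moll (n : ℕ) : EuclideanSpace ℝ (Fin n) → ℝ :=
  (⟨1 / 2, 1, by norm_num, by norm_num⟩ :
    ContDiffBump (0 : EuclideanSpace ℝ (Fin n))).normed volume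

theorem isTest_moll : IsTest (moll n) :=
  ⟨ContDiffBump.contDiff_normed _, ContDiffBump.hasCompactSupport_normed _⟩

theorem moll_nonneg (z : EuclideanSpace ℝ (Fin n)) : 0 ≤ moll n z :=
  ContDiffBump.nonneg_normed _ _

theorem integral_moll : ∫ z, moll n z = 1 :=
  ContDiffBump.integral_normed _

theorem norm_le_one_of_moll_ne_zero {z : EuclideanSpace ℝ (Fin n)} (h : moll n z ≠ 0) :
    ‖z‖ ≤ 1 := by
  have h1 : z ∈ tsupport (moll n) := subset_tsupport _ h
  rw [moll, ContDiffBump.tsupport_normed_eq] at h1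
  simpa using h1

theorem lintegral_enorm_moll : ∫⁻ z, ‖moll n z‖ₑ = 1 := by
  have h := ofReal_integral_eq_lintegral_ofReal (isTest_moll (n := n)).integrable
    (.of_forall moll_nonneg)
  rw [integral_moll, ENNReal.ofReal_one] at h
  rw [h]
  exact lintegral_congr fun z => Real.enorm_of_nonneg (moll_nonneg z)

/-- Mollification at scale `δ`. -/
noncomputable def mollify (δ : ℝ) (f : EuclideanSpace ℝ (Fin n) → ℝ) :
    EuclideanSpace ℝ (Fin n) → ℝ :=
  conv (dil δ (moll n)) f

/-- The mollification error at scale `δ`. -/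
noncomputable def mollErr (δ : ℝ) (f : EuclideanSpace ℝ (Fin n) → ℝ) :
    EuclideanSpace ℝ (Fin n) → ℝ :=
  f - mollify δ f

variable {f g : EuclideanSpace ℝ (Fin n) → ℝ} {δ : ℝ}

theorem IsTest.mollify (hf : IsTest f) (hδ : 0 < δ) : IsTest (mollify δ f) :=
  (isTest_moll.dil hδ).conv hf

theorem IsTest.mollErr (hf : IsTest f) (hδ : 0 < δ) : IsTest (mollErr δ f) :=
  hf.sub (hf.mollify hδ)

theorem mollify_sub (hδ : 0 < δ) (hf : IsTest f) (hg : IsTest g) :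
    mollify δ (f - g) = mollify δ f - mollify δ g :=
  conv_sub (isTest_moll.dil hδ) hf hg

theorem mollErr_comm {ε : ℝ} (hδ : 0 < δ) (hε : 0 < ε) (hf : IsTest f) :
    mollErr δ (mollErr ε f) = mollErr ε (mollErr δ f) := by
  have h : mollify δ (mollify ε f) = mollify ε (mollify δ f) :=
    conv_left_comm (isTest_moll.dil hδ) (isTest_moll.dil hε) hf
  unfold mollErr
  rw [mollify_sub hδ hf (hf.mollify hε), mollify_sub hε hf (hf.mollify hδ), h]
  abel

theorem listDeriv_mollify (hδ : 0 < δ) (hf : IsTest f) (l : List (Fin n)) :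
    listDeriv l (mollify δ f) = mollify δ (listDeriv l f) :=
  listDeriv_conv_right (isTest_moll.dil hδ) hf l

theorem listDeriv_mollErr (hδ : 0 < δ) (hf : IsTest f) (l : List (Fin n)) :
    listDeriv l (mollErr δ f) = mollErr δ (listDeriv l f) := by
  unfold mollErr
  rw [listDeriv_sub hf (hf.mollify hδ), listDeriv_mollify hδ hf]

theorem mollErr_apply (hδ : 0 < δ) (hf : IsTest f) (x : EuclideanSpace ℝ (Fin n)) :
    mollErr δ f x = ∫ z, moll n z * (f x - f (x - δ • z)) := by
  have h1 : Integrable (fun z => moll n z * f x) := isTest_moll.integrable.mul_const _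
  have h2 : Integrable (fun z => moll n z * f (x - δ • z)) := by
    refine Continuous.integrable_of_hasCompactSupport ?_ (isTest_moll.compact.mul_right)
    exact isTest_moll.continuous.mul (hf.continuous.comp (by fun_prop))
  simp only [mul_sub]
  rw [integral_sub h1 h2, integral_mul_const, integral_moll, one_mul, mollErr, Pi.sub_apply,
    mollify, conv_dil_apply hδ]

theorem enorm_mollErr_le (hδ : 0 < δ) (hf : IsTest f) (x : EuclideanSpace ℝ (Fin n)) :
    ‖mollErr δ f x‖ₑ ≤
      ∫⁻ z, ‖f x - f (x - δ • z)‖ₑ ∂(volume.withDensity fun z => ‖moll n z‖ₑ) := by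
  rw [mollErr_apply hδ hf]
  refine (enorm_integral_le_lintegral_enorm _).trans_eq ?_
  have hm : Measurable fun z => ‖f x - f (x - δ • z)‖ₑ := by
    refine (Continuous.enorm ?_).measurable
    exact continuous_const.sub (hf.continuous.comp (by fun_prop))
  rw [lintegral_withDensity_eq_lintegral_mul _ isTest_moll.continuous.measurable.enorm hm]
  simp [enorm_mul]

/-- The probability measure with density the mollifier. -/
noncomputable def mollMeasure (n : ℕ) : Measure (EuclideanSpace ℝ (Fin n)) :=
  volume.withDensity fun z => ‖moll n z‖ₑ

theorem mollMeasure_univ : mollMeasure n Set.univ = 1 := by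
  rw [mollMeasure, withDensity_apply _ MeasurableSet.univ, setLIntegral_univ, lintegral_enorm_moll]

theorem ae_mollMeasure_norm_le : ∀ᵐ z ∂(mollMeasure n), ‖z‖ ≤ 1 := by
  rw [mollMeasure, ae_withDensity_iff isTest_moll.continuous.measurable.enorm]
  exact .of_forall fun z hz => norm_le_one_of_moll_ne_zero (by simpa using hz)

/-- The mollifier has mass one and lives in the unit ball, so the error is an average of increments
of `f` over distances at most δ. -/
theorem abs_mollErr_le_of_holder (hδ : 0 < δ) (hf : IsTest f) {H σ : ℝ} (hH : 0 ≤ H) (hσ : 0 < σ)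
    (h : ∀ x y, |f x - f y| ≤ H * ‖x - y‖ ^ σ) (x : EuclideanSpace ℝ (Fin n)) :
    |mollErr δ f x| ≤ H * δ ^ σ := by
  have h1 : ‖mollErr δ f x‖ₑ ≤ ENNReal.ofReal (H * δ ^ σ) := by
    refine (enorm_mollErr_le hδ hf x).trans ?_
    calc _ ≤ ∫⁻ _, ENNReal.ofReal (H * δ ^ σ) ∂(mollMeasure n) := by
          refine lintegral_mono_ae ?_
          filter_upwards [ae_mollMeasure_norm_le] with z hz
          rw [Real.enorm_eq_ofReal_abs]
          refine ENNReal.ofReal_le_ofReal ((h _ _).trans ?_)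
          have : ‖x - (x - δ • z)‖ ≤ δ := by
            rw [sub_sub_cancel, norm_smul, Real.norm_of_nonneg hδ.le]
            nlinarith
          gcongr
      _ = _ := by rw [lintegral_const, mollMeasure_univ, mul_one]
  rwa [Real.enorm_eq_ofReal_abs, ENNReal.ofReal_le_ofReal_iff (by positivity)] at h1

/-- The averaging measure that controls the mollification error by the gradient. -/
noncomputable def segMeasure (n : ℕ) : Measure (EuclideanSpace ℝ (Fin n) × ℝ) :=
  (mollMeasure n).prod (volume.restrict (Set.Icc (0 : ℝ) 1))

theorem segMeasure_univ : segMeasure n Set.univ = 1 := by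
  rw [segMeasure, ← Set.univ_prod_univ, Measure.prod_prod, mollMeasure_univ]
  simp

instance : IsProbabilityMeasure (segMeasure n) := ⟨segMeasure_univ⟩

/-- The sum of the moduli of the first partial derivatives. -/
noncomputable def gradSum (f : EuclideanSpace ℝ (Fin n) → ℝ) :
    EuclideanSpace ℝ (Fin n) → ℝ≥0∞ :=
  fun x => ∑ i, ‖partialDeriv i f x‖ₑ

theorem IsTest.measurable_gradSum (hf : IsTest f) : Measurable (gradSum f) :=
  Finset.measurable_sum _ fun i _ => (hf.partialDeriv i).continuous.measurable.enorm

theorem enorm_fderiv_le_gradSum (x : EuclideanSpace ℝ (Fin n)) :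
    ‖fderiv ℝ f x‖ₑ ≤ gradSum f x := by
  have h := norm_fderiv_le_sum (u := f) x
  rw [← ofReal_norm, gradSum]
  refine (ENNReal.ofReal_le_ofReal h).trans_eq ?_
  rw [ENNReal.ofReal_sum_of_nonneg fun i _ => abs_nonneg _]
  simp [Real.enorm_eq_ofReal_abs]

theorem enorm_sub_translate_le (hf : IsTest f) (x h : EuclideanSpace ℝ (Fin n)) :
    ‖f x - f (x - h)‖ₑ ≤ ‖h‖ₑ * ∫⁻ s in Set.Icc (0 : ℝ) 1, gradSum f (x - s • h) := by
  have hd : ∀ s : ℝ, HasDerivAt (fun s : ℝ => f (x - s • h)) (-(fderiv ℝ f (x - s • h) h)) s := by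
    intro s
    have h1 : HasDerivAt (fun s : ℝ => x - s • h) (-h) s := by
      simpa using ((hasDerivAt_id s).smul_const h).const_sub x
    have h2 := (hf.differentiable (x - s • h)).hasFDerivAt.comp_hasDerivAt s h1
    rw [map_neg] at h2
    exact h2
  have hc : Continuous fun s : ℝ => -(fderiv ℝ f (x - s • h) h) :=
    (((hf.smooth.continuous_fderiv (by simp)).comp (by fun_prop)).clm_apply continuous_const).neg
  have hi := intervalIntegral.integral_eq_sub_of_hasDerivAt (a := 0) (b := 1)
    (fun s _ => hd s) (hc.intervalIntegrable _ _)
  simp only [one_smul, zero_smul, sub_zero] at hi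
  rw [← enorm_neg, neg_sub, ← hi, intervalIntegral.integral_of_le zero_le_one,
    ← integral_Icc_eq_integral_Ioc]
  refine (enorm_integral_le_lintegral_enorm _).trans ?_
  have hm : Measurable fun s : ℝ => gradSum f (x - s • h) :=
    hf.measurable_gradSum.comp (by fun_prop)
  rw [← lintegral_const_mul _ hm]
  refine lintegral_mono fun s => ?_
  rw [enorm_neg, mul_comm]
  refine (ContinuousLinearMap.le_opENorm _ _).trans ?_
  gcongr
  exact enorm_fderiv_le_gradSum _

theorem enorm_mollErr_le_average (hδ : 0 < δ) (hf : IsTest f) (x : EuclideanSpace ℝ (Fin n)) :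
    ‖mollErr δ f x‖ₑ ≤
      ENNReal.ofReal δ * ∫⁻ p, gradSum f (x - (p.2 * δ) • p.1) ∂(segMeasure n) := by
  refine (enorm_mollErr_le hδ hf x).trans ?_
  have hm : Measurable fun p : EuclideanSpace ℝ (Fin n) × ℝ =>
      gradSum f (x - (p.2 * δ) • p.1) :=
    hf.measurable_gradSum.comp (by fun_prop)
  rw [segMeasure, lintegral_prod _ hm.aemeasurable,
    ← lintegral_const_mul _ hm.lintegral_prod_right']
  refine lintegral_mono_ae ?_
  filter_upwards [ae_mollMeasure_norm_le] with z hz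
  refine (enorm_sub_translate_le hf x (δ • z)).trans ?_
  have h1 : ‖δ • z‖ₑ ≤ ENNReal.ofReal δ := by
    rw [← ofReal_norm, norm_smul, Real.norm_of_nonneg hδ.le]
    exact ENNReal.ofReal_le_ofReal (by nlinarith)
  simp only [smul_smul]
  gcongr

theorem eLpNorm_gradSum_le (hf : IsTest f) {t A : ℝ≥0∞} (ht : 1 ≤ t)
    (h : ∀ i, eLpNorm (partialDeriv i f) t volume ≤ A) :
    eLpNorm (gradSum f) t volume ≤ n * A := by
  have e : gradSum f = ∑ i, fun x => ‖partialDeriv i f x‖ₑ := by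
    ext x; simp [gradSum]
  rw [e]
  refine (eLpNorm_sum_le (fun i _ =>
    (hf.partialDeriv i).continuous.measurable.enorm.aestronglyMeasurable) ht).trans ?_
  refine (Finset.sum_le_sum fun i _ => (eLpNorm_enorm _).trans_le (h i)).trans ?_
  simp

/-- One derivative buys one factor δ: the error is at most δ times an average of translates of the
gradient along short segments, and such averages do not increase the norm. The factor `n` counts the
partial derivatives. -/
theorem eLpNorm_mollErr_le_of_deriv (hδ : 0 < δ) (hf : IsTest f) {t A : ℝ≥0∞} (ht : 1 ≤ t)
    (h : ∀ i, eLpNorm (partialDeriv i f) t volume ≤ A) :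
    eLpNorm (mollErr δ f) t volume ≤ ENNReal.ofReal δ * (n * A) := by
  have h1 := eLpNorm_lintegral_translate_le (segMeasure n)
    (Y := fun p : EuclideanSpace ℝ (Fin n) × ℝ => (p.2 * δ) • p.1) (by fun_prop)
    hf.measurable_gradSum ht
  rw [segMeasure_univ, one_mul] at h1
  set F := fun x => ∫⁻ p, gradSum f (x - (p.2 * δ) • p.1) ∂(segMeasure n) with hF
  have h2 : eLpNorm (mollErr δ f) t volume ≤ δ.toNNReal • eLpNorm F t volume := by
    refine eLpNorm_le_nnreal_smul_eLpNorm_of_ae_le_mul' (.of_forall fun x => ?_) t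
    refine (enorm_mollErr_le_average hδ hf x).trans_eq ?_
    rw [enorm_eq_self]
    rfl
  refine h2.trans ?_
  rw [ENNReal.smul_def, smul_eq_mul, ENNReal.ofReal]
  gcongr
  exact h1.trans (eLpNorm_gradSum_le hf ht h)

theorem eLpNorm_mollify_le (hδ : 0 < δ) (hf : IsTest f) {t : ℝ≥0∞} (ht : 1 ≤ t) :
    eLpNorm (mollify δ f) t volume ≤ eLpNorm f t volume := by
  have h := eLpNorm_conv_dil_le hδ isTest_moll hf ht
  rwa [lintegral_enorm_moll, one_mul] at h

theorem eLpNorm_mollErr_le (hδ : 0 < δ) (hf : IsTest f) {t : ℝ≥0∞} (ht : 1 ≤ t) :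
    eLpNorm (mollErr δ f) t volume ≤ 2 * eLpNorm f t volume := by
  refine (eLpNorm_sub_le hf.continuous.aestronglyMeasurable
    (hf.mollify hδ).continuous.aestronglyMeasurable ht).trans ?_
  rw [two_mul]
  gcongr
  exact eLpNorm_mollify_le hδ hf ht

end Mollifier

end GagNir

namespace GagNir

/-! ### Products of mollification errors -/

section Words

variable {n : ℕ}

/-- The composition of the mollification errors at the scales of a list. -/
noncomputable def errWord (ds : List ℝ) (f : EuclideanSpace ℝ (Fin n) → ℝ) :
    EuclideanSpace ℝ (Fin n) → ℝ :=
  ds.foldr mollErr f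

variable {f g : EuclideanSpace ℝ (Fin n) → ℝ} {δ ρ : ℝ} {ds : List ℝ}

@[simp] theorem errWord_nil : errWord [] f = f := rfl

@[simp] theorem errWord_cons (d : ℝ) : errWord (d :: ds) f = mollErr d (errWord ds f) := rfl

theorem errWord_append (ds₁ ds₂ : List ℝ) :
    errWord (ds₁ ++ ds₂) f = errWord ds₁ (errWord ds₂ f) := by
  simp [errWord]

theorem IsTest.errWord (hf : IsTest f) (h : ∀ d ∈ ds, 0 < d) : IsTest (errWord ds f) := by
  induction ds with
  | nil => exact hf
  | cons d ds ih =>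
    exact (ih fun e he => h e (by simp [he])).mollErr (h d (by simp))

theorem listDeriv_errWord (hf : IsTest f) (h : ∀ d ∈ ds, 0 < d) (l : List (Fin n)) :
    listDeriv l (errWord ds f) = errWord ds (listDeriv l f) := by
  induction ds with
  | nil => rfl
  | cons d ds ih =>
    have h' : ∀ e ∈ ds, 0 < e := fun e he => h e (by simp [he])
    rw [errWord_cons, listDeriv_mollErr (h d (by simp)) (hf.errWord h'), ih h', errWord_cons]

theorem errWord_mollErr (hf : IsTest f) (h : ∀ d ∈ ds, 0 < d) (hδ : 0 < δ) :
    errWord ds (mollErr δ f) = mollErr δ (errWord ds f) := by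
  induction ds with
  | nil => rfl
  | cons d ds ih =>
    have h' : ∀ e ∈ ds, 0 < e := fun e he => h e (by simp [he])
    rw [errWord_cons, ih h', mollErr_comm (h d (by simp)) hδ (hf.errWord h'), errWord_cons]

theorem eLpNorm_errWord_le (hf : IsTest f) (h : ∀ d ∈ ds, 0 < d) {t : ℝ≥0∞} (ht : 1 ≤ t) :
    eLpNorm (errWord ds f) t volume ≤ 2 ^ ds.length * eLpNorm f t volume := by
  induction ds with
  | nil => simp
  | cons d ds ih =>
    have h' : ∀ e ∈ ds, 0 < e := fun e he => h e (by simp [he])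
    refine (eLpNorm_mollErr_le (h d (by simp)) (hf.errWord h') ht).trans ?_
    rw [List.length_cons, pow_succ', mul_assoc]
    gcongr
    exact ih h'

/-- Each of the `k` outermost errors is spent on one derivative and gains `ρ n`; each remaining one
costs at most a factor 2. Errors commute with derivatives, so the induction passes from `f` to its
partial derivatives. -/
theorem eLpNorm_errWord_le_of_deriv {t : ℝ≥0∞} (ht : 1 ≤ t) {k : ℕ} :
    ∀ {ds : List ℝ} {f : EuclideanSpace ℝ (Fin n) → ℝ} {A : ℝ≥0∞}, IsTest f → k ≤ ds.length →
      (∀ d ∈ ds, 0 < d ∧ d ≤ ρ) →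
      (∀ l : List (Fin n), l.length = k → eLpNorm (listDeriv l f) t volume ≤ A) →
      eLpNorm (errWord ds f) t volume ≤ 2 ^ ds.length * (ENNReal.ofReal ρ * n) ^ k * A := by
  induction k with
  | zero =>
    intro ds f A hf _ h hA
    refine (eLpNorm_errWord_le hf (fun d hd => (h d hd).1) ht).trans ?_
    rw [pow_zero, mul_one]
    gcongr
    exact hA [] rfl
  | succ k ih =>
    intro ds f A hf hk h hA
    cases ds with
    | nil => simp at hk
    | cons d ds =>
      have h' : ∀ e ∈ ds, 0 < e ∧ e ≤ ρ := fun e he => h e (by simp [he])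
      have hd := h d (by simp)
      have h0 : ∀ e ∈ ds, 0 < e := fun e he => (h' e he).1
      have hstep : ∀ i, eLpNorm (partialDeriv i (errWord ds f)) t volume ≤
          2 ^ ds.length * (ENNReal.ofReal ρ * n) ^ k * A := by
        intro i
        have e : partialDeriv i (errWord ds f) = errWord ds (partialDeriv i f) :=
          listDeriv_errWord hf h0 [i]
        rw [e]
        refine ih (hf.partialDeriv i) (by simpa using hk) h' fun l hl => ?_
        have := hA (l ++ [i]) (by simp [hl])
        rwa [listDeriv_append] at this
      refine (eLpNorm_mollErr_le_of_deriv hd.1 (hf.errWord h0) ht hstep).trans ?_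
      calc ENNReal.ofReal d * (n * (2 ^ ds.length * (ENNReal.ofReal ρ * n) ^ k * A))
          ≤ ENNReal.ofReal ρ * (n * (2 ^ ds.length * (ENNReal.ofReal ρ * n) ^ k * A)) := by
            gcongr; exact hd.2
        _ = 2 ^ ds.length * (ENNReal.ofReal ρ * n) ^ (k + 1) * A := by ring
        _ ≤ _ := by
            gcongr
            · exact one_le_two
            · simp

/-- The innermost error absorbs the Hölder modulus and gains `ρ ^ σ`; the `k` derivatives need `k`
further errors, whence the strict inequality. -/
theorem eLpNorm_top_errWord_le_of_holder {k : ℕ} {H σ : ℝ} (hf : IsTest f) (hk : k < ds.length)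
    (h : ∀ d ∈ ds, 0 < d ∧ d ≤ ρ) (hH : 0 ≤ H) (hσ : 0 < σ)
    (hA : ∀ l : List (Fin n), l.length = k → ∀ x y,
      |listDeriv l f x - listDeriv l f y| ≤ H * ‖x - y‖ ^ σ) :
    eLpNorm (errWord ds f) ⊤ volume ≤
      2 ^ ds.length * (ENNReal.ofReal ρ * n) ^ k * ENNReal.ofReal (H * ρ ^ σ) := by
  rcases List.eq_nil_or_concat ds with rfl | ⟨ds', d, rfl⟩
  · simp at hk
  rw [List.concat_eq_append] at *
  have h' : ∀ e ∈ ds', 0 < e ∧ e ≤ ρ := fun e he => h e (by simp [he])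
  have hd := h d (by simp)
  rw [errWord_append, errWord_cons, errWord_nil]
  refine (eLpNorm_errWord_le_of_deriv (A := ENNReal.ofReal (H * ρ ^ σ)) le_top
    (hf.mollErr hd.1) (by simpa [Nat.lt_succ_iff] using hk) h' fun l hl => ?_).trans ?_
  · rw [listDeriv_mollErr hd.1 hf]
    refine eLpNorm_top_le_of_abs_le fun x => ?_
    refine (abs_mollErr_le_of_holder hd.1 (hf.listDeriv l) hH hσ (hA l hl) x).trans ?_
    have := hd.1.le
    have := hd.2
    gcongr
  · gcongr
    · exact one_le_two
    · simp

end Words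

/-! ### Frequency blocks at one scale -/

section Blocks

variable {n : ℕ} {f g u : EuclideanSpace ℝ (Fin n) → ℝ} {δ : ℝ}

/-- The frequency block at scale `δ`, of order `N`. -/
noncomputable def lpBlock (N : ℕ) (δ : ℝ) (f : EuclideanSpace ℝ (Fin n) → ℝ) :
    EuclideanSpace ℝ (Fin n) → ℝ :=
  errWord (List.replicate N (2 * δ)) f - errWord (List.replicate N δ) f

theorem forall_mem_replicate_pos (hδ : 0 < δ) (N : ℕ) : ∀ d ∈ List.replicate N δ, 0 < d := by
  intro d hd
  rw [List.eq_of_mem_replicate hd]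
  exact hδ

theorem IsTest.lpBlock (hf : IsTest f) (hδ : 0 < δ) (N : ℕ) : IsTest (lpBlock N δ f) :=
  (hf.errWord (forall_mem_replicate_pos (by positivity) N)).sub
    (hf.errWord (forall_mem_replicate_pos hδ N))

theorem listDeriv_lpBlock (hf : IsTest f) (hδ : 0 < δ) (N : ℕ) (l : List (Fin n)) :
    listDeriv l (lpBlock N δ f) = lpBlock N δ (listDeriv l f) := by
  have h2 : 0 < 2 * δ := by positivity
  unfold lpBlock
  rw [listDeriv_sub (hf.errWord (forall_mem_replicate_pos h2 N))
    (hf.errWord (forall_mem_replicate_pos hδ N)),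
    listDeriv_errWord hf (forall_mem_replicate_pos h2 N),
    listDeriv_errWord hf (forall_mem_replicate_pos hδ N)]

/-- With A = I - P_{2δ} and B = I - P_δ this is A^N - B^N = ∑ A^i (A - B) B^{N-1-i}, where A - B =
P_δ - P_{2δ} and all factors commute. Every term is a smoothing of a word of N - 1 errors at mixed
scales, which is why words carry a list of scales. -/
theorem lpBlock_eq_sum (hδ : 0 < δ) (N : ℕ) : ∀ {f : EuclideanSpace ℝ (Fin n) → ℝ}, IsTest f →
    lpBlock N δ f = ∑ i ∈ Finset.range N,
      (mollify δ (errWord (List.replicate i (2 * δ) ++ List.replicate (N - 1 - i) δ) f) -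
        mollify (2 * δ)
          (errWord (List.replicate i (2 * δ) ++ List.replicate (N - 1 - i) δ) f)) := by
  have h2 : 0 < 2 * δ := by positivity
  induction N with
  | zero => intro f _; simp [lpBlock]
  | succ N ih =>
    intro f hf
    have r2 := forall_mem_replicate_pos h2 N
    have r1 := forall_mem_replicate_pos hδ N
    have e1 : lpBlock (N + 1) δ f = lpBlock N δ (mollErr δ f) +
        (mollify δ (errWord (List.replicate N (2 * δ)) f) -
          mollify (2 * δ) (errWord (List.replicate N (2 * δ)) f)) := by
      unfold lpBlock
      rw [errWord_mollErr hf r2 hδ, errWord_mollErr hf r1 hδ, List.replicate_succ,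
        List.replicate_succ, errWord_cons, errWord_cons]
      unfold mollErr
      abel
    rw [e1, ih (hf.mollErr hδ), Finset.sum_range_succ]
    congr 1
    · refine Finset.sum_congr rfl fun i hi => ?_
      have hi' : i < N := Finset.mem_range.1 hi
      have e2 : errWord (List.replicate i (2 * δ) ++ List.replicate (N - 1 - i) δ) (mollErr δ f) =
          errWord (List.replicate i (2 * δ) ++ List.replicate (N + 1 - 1 - i) δ) f := by
        have e3 : N + 1 - 1 - i = (N - 1 - i) + 1 := by omega
        rw [e3, List.replicate_succ', ← List.append_assoc, errWord_append _ [δ]]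
        rfl
      rw [e2]
    · simp

theorem exists_uniform_list {K : ℕ} {P : List (Fin n) → ℝ≥0 → Prop}
    (hmono : ∀ l C C', C ≤ C' → P l C → P l C') (h : ∀ l, ∃ C, P l C) :
    ∃ C, ∀ l : List (Fin n), l.length ≤ K → P l C := by
  choose C hC using h
  have hfin : {l : List (Fin n) | l.length ≤ K}.Finite := List.finite_length_le _ _
  refine ⟨∑ l ∈ hfin.toFinset, C l, fun l hl => hmono l _ _ ?_ (hC l)⟩
  exact Finset.single_le_sum (f := C) (fun _ _ => zero_le) (hfin.mem_toFinset.2 hl)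

theorem listDeriv_mollify_eq (hδ : 0 < δ) (hg : IsTest g) (l : List (Fin n)) :
    listDeriv l (mollify δ g) = δ⁻¹ ^ l.length • conv (dil δ (listDeriv l (moll n))) g := by
  rw [mollify, listDeriv_conv_left (isTest_moll.dil hδ) hg, listDeriv_dil isTest_moll hδ,
    conv_smul_left]

/-- The derivatives in `l` fall on the kernel of the outer mollification and cost a power of δ⁻¹.
The rest of the block is a word of `M` errors, so any bound `W` of such words is inherited. -/
theorem exists_eLpNorm_lpBlock_le {t : ℝ≥0∞} (ht : 1 ≤ t) (M K : ℕ) :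
    ∃ C : ℝ≥0, ∀ l : List (Fin n), l.length ≤ K → ∀ {δ : ℝ}, 0 < δ →
      ∀ {u : EuclideanSpace ℝ (Fin n) → ℝ}, IsTest u → ∀ {W : ℝ≥0∞},
      (∀ ds : List ℝ, ds.length = M → (∀ d ∈ ds, 0 < d ∧ d ≤ 2 * δ) →
        eLpNorm (errWord ds u) t volume ≤ W) →
      eLpNorm (listDeriv l (lpBlock (M + 1) δ u)) t volume ≤
        C * ENNReal.ofReal (δ ^ (-(l.length : ℝ))) * W := by
  refine exists_uniform_list (fun l C C' hC h δ hδ u hu W hW =>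
    (h hδ hu hW).trans (by gcongr)) fun l => ?_
  set I := ∫⁻ z, ‖listDeriv l (moll n) z‖ₑ with hI
  have hItop : I ≠ ⊤ := (isTest_moll.listDeriv l).lintegral_enorm_lt_top.ne
  refine ⟨(M + 1) * (2 * I.toNNReal), fun {δ} hδ {u} hu {W} hW => ?_⟩
  have h2 : 0 < 2 * δ := by positivity
  rw [lpBlock_eq_sum hδ (M + 1) hu]
  -- Both smoothing scales, δ and 2δ, are covered at once, since a nonpositive power decreases with
  -- the scale.
  have key : ∀ {ε : ℝ}, δ ≤ ε → ∀ {g : EuclideanSpace ℝ (Fin n) → ℝ}, IsTest g →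
      eLpNorm g t volume ≤ W → eLpNorm (listDeriv l (mollify ε g)) t volume ≤
        I * ENNReal.ofReal (δ ^ (-(l.length : ℝ))) * W := by
    intro ε hε g hg hgW
    have hε0 : 0 < ε := hδ.trans_le hε
    rw [listDeriv_mollify_eq hε0 hg, eLpNorm_const_smul, mul_comm I, mul_assoc]
    gcongr
    · rw [Real.enorm_of_nonneg (by positivity), Real.rpow_neg hδ.le, Real.rpow_natCast, ← inv_pow]
      refine ENNReal.ofReal_le_ofReal ?_
      gcongr
    · exact (eLpNorm_conv_dil_le hε0 (isTest_moll.listDeriv l) hg ht).trans (by gcongr)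
  have hw : ∀ i ∈ Finset.range (M + 1), (∀ d ∈ List.replicate i (2 * δ) ++
      List.replicate (M + 1 - 1 - i) δ, 0 < d ∧ d ≤ 2 * δ) ∧
      (List.replicate i (2 * δ) ++ List.replicate (M + 1 - 1 - i) δ).length = M := by
    intro i hi
    refine ⟨fun d hd => ?_, ?_⟩
    · rcases List.mem_append.1 hd with h | h
      · rw [List.eq_of_mem_replicate h]; exact ⟨h2, le_rfl⟩
      · rw [List.eq_of_mem_replicate h]; exact ⟨hδ, by linarith⟩
    · have := Finset.mem_range.1 hi
      simp; omega
  have htest : ∀ i ∈ Finset.range (M + 1), IsTest (errWord (List.replicate i (2 * δ) ++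
      List.replicate (M + 1 - 1 - i) δ) u) := fun i hi =>
    hu.errWord fun d hd => ((hw i hi).1 d hd).1
  rw [listDeriv_sum _ fun i hi => ((htest i hi).mollify hδ).sub ((htest i hi).mollify h2)]
  refine (eLpNorm_sum_le (fun i hi => ((((htest i hi).mollify hδ).sub
    ((htest i hi).mollify h2)).listDeriv l).continuous.aestronglyMeasurable) ht).trans ?_
  refine (Finset.sum_le_sum (g := fun _ =>
    2 * (I * ENNReal.ofReal (δ ^ (-(l.length : ℝ))) * W)) fun i hi => ?_).trans_eq ?_
  · rw [listDeriv_sub ((htest i hi).mollify hδ) ((htest i hi).mollify h2)]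
    refine (eLpNorm_sub_le (((htest i hi).mollify hδ).listDeriv l).continuous.aestronglyMeasurable
      (((htest i hi).mollify h2).listDeriv l).continuous.aestronglyMeasurable ht).trans ?_
    have hWi := hW _ (hw i hi).2 (hw i hi).1
    exact (add_le_add (key le_rfl (htest i hi) hWi)
      (key (by linarith : δ ≤ 2 * δ) (htest i hi) hWi)).trans_eq (two_mul _).symm
  · rw [Finset.sum_const, Finset.card_range, nsmul_eq_mul]
    push_cast
    rw [ENNReal.coe_toNNReal hItop]
    ring

/-- As for the `L^t` bound, but the kernel now maps L^t to L^∞, which costs n/t further powers of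
δ⁻¹ (Bernstein's inequality). -/
theorem exists_enorm_lpBlock_le {t : ℝ≥0∞} (ht : 1 ≤ t) (M K : ℕ) :
    ∃ C : ℝ≥0, ∀ l : List (Fin n), l.length ≤ K → ∀ {δ : ℝ}, 0 < δ →
      ∀ {u : EuclideanSpace ℝ (Fin n) → ℝ}, IsTest u → ∀ {W : ℝ≥0∞},
      (∀ ds : List ℝ, ds.length = M → (∀ d ∈ ds, 0 < d ∧ d ≤ 2 * δ) →
        eLpNorm (errWord ds u) t volume ≤ W) → ∀ x,
      ‖listDeriv l (lpBlock (M + 1) δ u) x‖ₑ ≤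
        C * ENNReal.ofReal (δ ^ (-(l.length + n * t.toReal⁻¹ : ℝ))) * W := by
  refine exists_uniform_list (fun l C C' hC h δ hδ u hu W hW x =>
    (h hδ hu hW x).trans (by gcongr)) fun l => ?_
  obtain ⟨C, hC⟩ := exists_enorm_conv_dil_le (isTest_moll.listDeriv (n := n) l) ht
  refine ⟨(M + 1) * (2 * C), fun {δ} hδ {u} hu {W} hW x => ?_⟩
  have h2 : 0 < 2 * δ := by positivity
  rw [lpBlock_eq_sum hδ (M + 1) hu]
  have key : ∀ {ε : ℝ}, δ ≤ ε → ∀ {g : EuclideanSpace ℝ (Fin n) → ℝ}, IsTest g →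
      eLpNorm g t volume ≤ W → ‖listDeriv l (mollify ε g) x‖ₑ ≤
        C * ENNReal.ofReal (δ ^ (-(l.length + n * t.toReal⁻¹ : ℝ))) * W := by
    intro ε hε g hg hgW
    have hε0 : 0 < ε := hδ.trans_le hε
    rw [listDeriv_mollify_eq hε0 hg, Pi.smul_apply, enorm_smul]
    have h3 : δ ^ (-(l.length + n * t.toReal⁻¹ : ℝ)) =
        δ ^ (-(l.length : ℝ)) * δ ^ (-(n * t.toReal⁻¹ : ℝ)) := by
      rw [← Real.rpow_add hδ]; congr 1; ring
    rw [h3, ENNReal.ofReal_mul (by positivity)]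
    calc _ ≤ ENNReal.ofReal (δ ^ (-(l.length : ℝ))) *
          (C * ENNReal.ofReal (δ ^ (-(n * t.toReal⁻¹ : ℝ))) * W) := by
          gcongr
          · rw [Real.enorm_of_nonneg (by positivity), Real.rpow_neg hδ.le, Real.rpow_natCast,
              ← inv_pow]
            refine ENNReal.ofReal_le_ofReal ?_
            gcongr
          · refine (hC hε0 hg x).trans ?_
            refine mul_le_mul' (mul_le_mul' le_rfl (ENNReal.ofReal_le_ofReal ?_)) hgW
            have : (0 : ℝ) ≤ n * t.toReal⁻¹ := by positivity
            exact Real.rpow_le_rpow_of_nonpos hδ hε (neg_nonpos.2 this)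
      _ = _ := by ring
  have hw : ∀ i ∈ Finset.range (M + 1), (∀ d ∈ List.replicate i (2 * δ) ++
      List.replicate (M + 1 - 1 - i) δ, 0 < d ∧ d ≤ 2 * δ) ∧
      (List.replicate i (2 * δ) ++ List.replicate (M + 1 - 1 - i) δ).length = M := by
    intro i hi
    refine ⟨fun d hd => ?_, ?_⟩
    · rcases List.mem_append.1 hd with h | h
      · rw [List.eq_of_mem_replicate h]; exact ⟨h2, le_rfl⟩
      · rw [List.eq_of_mem_replicate h]; exact ⟨hδ, by linarith⟩
    · have := Finset.mem_range.1 hi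
      simp; omega
  have htest : ∀ i ∈ Finset.range (M + 1), IsTest (errWord (List.replicate i (2 * δ) ++
      List.replicate (M + 1 - 1 - i) δ) u) := fun i hi =>
    hu.errWord fun d hd => ((hw i hi).1 d hd).1
  rw [listDeriv_sum _ fun i hi => ((htest i hi).mollify hδ).sub ((htest i hi).mollify h2),
    Finset.sum_apply]
  refine (enorm_sum_le _ _).trans ?_
  refine (Finset.sum_le_sum (g := fun _ =>
    2 * (C * ENNReal.ofReal (δ ^ (-(l.length + n * t.toReal⁻¹ : ℝ))) * W)) fun i hi => ?_).trans_eq ?_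
  · rw [listDeriv_sub ((htest i hi).mollify hδ) ((htest i hi).mollify h2), Pi.sub_apply]
    refine (enorm_sub_le).trans ?_
    have hWi := hW _ (hw i hi).2 (hw i hi).1
    exact (add_le_add (key le_rfl (htest i hi) hWi)
      (key (by linarith : δ ≤ 2 * δ) (htest i hi) hWi)).trans_eq (two_mul _).symm
  · rw [Finset.sum_const, Finset.card_range, nsmul_eq_mul]
    push_cast
    ring

end Blocks

end GagNir

namespace GagNir

/-! ### Two-sided geometric series -/

section Sums

theorem summable_geometric_int {r : ℝ} (h0 : 0 ≤ r) (h1 : r < 1) :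
    Summable fun j : ℤ => r ^ |j|.toNat := by
  refine Summable.of_nat_of_neg ?_ ?_
  · simpa using summable_geometric_of_lt_one h0 h1
  · simpa using summable_geometric_of_lt_one h0 h1

/-- The increasing and the decreasing majorant cross at one point; their common value there is the
geometric mean, and away from it the smaller one decays geometrically. -/
theorem exists_tsum_le_of_pos {ε₁ ε₂ : ℝ} (h1 : 0 < ε₁) (h2 : 0 < ε₂) :
    ∃ C : ℝ, 0 ≤ C ∧ ∀ {A₁ A₂ : ℝ}, 0 ≤ A₁ → 0 ≤ A₂ → ∀ {d : ℤ → ℝ}, (∀ j, 0 ≤ d j) →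
      (∀ j : ℤ, d j ≤ 2 ^ (j * ε₁) * A₁) → (∀ j : ℤ, d j ≤ 2 ^ (-(j * ε₂)) * A₂) →
      Summable d ∧ ∑' j, d j ≤ C * (A₁ ^ (ε₂ / (ε₁ + ε₂)) * A₂ ^ (ε₁ / (ε₁ + ε₂))) := by
  set c := min ε₁ ε₂ with hc
  have hc0 : 0 < c := lt_min h1 h2
  set r : ℝ := 2 ^ (-c) with hr
  have hr0 : 0 ≤ r := by positivity
  have hr1 : r < 1 := Real.rpow_lt_one_of_one_lt_of_neg one_lt_two (by linarith)
  have hs := summable_geometric_int hr0 hr1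
  refine ⟨2 ^ c * ∑' j : ℤ, r ^ |j|.toNat, mul_nonneg (by positivity)
    (tsum_nonneg fun j => by positivity), fun {A₁ A₂} hA1 hA2 {d} hd hd1 hd2 => ?_⟩
  have hS : 0 ≤ ∑' j : ℤ, r ^ |j|.toNat := tsum_nonneg fun j => by positivity
  by_cases hz : A₁ = 0 ∨ A₂ = 0
  · have hd0 : d = 0 := by
      ext j
      refine le_antisymm ?_ (hd j)
      rcases hz with rfl | rfl
      · simpa using hd1 j
      · simpa using hd2 j
    subst hd0
    refine ⟨summable_zero, ?_⟩
    simp only [Pi.zero_apply, tsum_zero]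
    positivity
  push Not at hz
  have hp1 : 0 < A₁ := lt_of_le_of_ne hA1 hz.1.symm
  have hp2 : 0 < A₂ := lt_of_le_of_ne hA2 hz.2.symm
  have hs12 : 0 < ε₁ + ε₂ := by linarith
  -- The real index at which the two majorants agree, both being equal to `m`.
  set j₀ : ℝ := Real.logb 2 (A₂ / A₁) / (ε₁ + ε₂) with hj0
  set m : ℝ := A₁ ^ (ε₂ / (ε₁ + ε₂)) * A₂ ^ (ε₁ / (ε₁ + ε₂)) with hm
  have hm0 : 0 < m := by positivity
  have hpow : ∀ e : ℝ, (2 : ℝ) ^ (j₀ * e) = A₂ ^ (e / (ε₁ + ε₂)) * A₁ ^ (-(e / (ε₁ + ε₂))) := by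
    intro e
    have : j₀ * e = Real.logb 2 (A₂ / A₁) * (e / (ε₁ + ε₂)) := by rw [hj0]; ring
    rw [this, Real.rpow_mul (by norm_num), Real.rpow_logb (by norm_num) (by norm_num)
      (by positivity), Real.div_rpow hA2 hA1, Real.rpow_neg hA1]
    rfl
  have e1 : (2 : ℝ) ^ (j₀ * ε₁) * A₁ = m := by
    rw [hpow, hm, mul_assoc, mul_comm]
    congr 1
    nth_rewrite 2 [← Real.rpow_one A₁]
    rw [← Real.rpow_add hp1]
    congr 1
    field_simp
    ring
  have e2 : (2 : ℝ) ^ (-(j₀ * ε₂)) * A₂ = m := by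
    rw [← mul_neg, hpow, hm, neg_div, neg_neg, mul_right_comm, mul_comm]
    congr 1
    nth_rewrite 2 [← Real.rpow_one A₂]
    rw [← Real.rpow_add hp2]
    congr 1
    field_simp
    ring
  set k : ℤ := ⌊j₀⌋ with hk
  -- The factor `2 ^ c` pays for rounding the crossing index down to an integer.
  have hbound : ∀ j : ℤ, d j ≤ m * 2 ^ c * r ^ |j - k|.toNat := by
    intro j
    have hrj : r ^ |j - k|.toNat = 2 ^ (-(c * |(j : ℝ) - k|)) := by
      rw [hr, ← Real.rpow_natCast, ← Real.rpow_mul (by norm_num), neg_mul]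
      congr 3
      have : ((|j - k|.toNat : ℤ) : ℝ) = ((|j - k| : ℤ) : ℝ) := by
        rw [Int.toNat_of_nonneg (abs_nonneg _)]
      rw [Int.cast_natCast] at this
      rw [this]
      push_cast
      ring
    have hk1 : (k : ℝ) ≤ j₀ := Int.floor_le _
    have hk2 : j₀ < k + 1 := Int.lt_floor_add_one _
    rw [hrj, mul_assoc, ← Real.rpow_add (by norm_num)]
    rcases le_total (j : ℝ) j₀ with hjk | hjk
    · refine (hd1 j).trans ?_
      have : (2 : ℝ) ^ (j * ε₁) * A₁ = m * 2 ^ ((j - j₀) * ε₁) := by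
        rw [← e1, mul_right_comm, ← Real.rpow_add (by norm_num)]
        congr 2
        ring
      rw [this]
      refine mul_le_mul_of_nonneg_left ?_ hm0.le
      refine Real.rpow_le_rpow_of_exponent_le (by norm_num) ?_
      have h3 : c ≤ ε₁ := min_le_left _ _
      have h4 : |(j : ℝ) - k| ≤ j₀ - j + 1 := by rw [abs_le]; constructor <;> linarith
      nlinarith [mul_le_mul_of_nonneg_left h4 hc0.le, mul_le_mul_of_nonneg_right h3
        (sub_nonneg.2 hjk)]
    · refine (hd2 j).trans ?_
      have : (2 : ℝ) ^ (-(j * ε₂)) * A₂ = m * 2 ^ (-((j - j₀) * ε₂)) := by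
        rw [← e2, mul_right_comm, ← Real.rpow_add (by norm_num)]
        congr 2
        ring
      rw [this]
      refine mul_le_mul_of_nonneg_left ?_ hm0.le
      refine Real.rpow_le_rpow_of_exponent_le (by norm_num) ?_
      have h3 : c ≤ ε₂ := min_le_right _ _
      have h4 : |(j : ℝ) - k| ≤ j - j₀ + 1 := by rw [abs_le]; constructor <;> linarith
      nlinarith [mul_le_mul_of_nonneg_left h4 hc0.le, mul_le_mul_of_nonneg_right h3
        (sub_nonneg.2 hjk)]
  have hsh : Summable fun j : ℤ => m * 2 ^ c * r ^ |j - k|.toNat :=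
    (((Equiv.subRight k).summable_iff (f := fun j : ℤ => r ^ |j|.toNat)).2 hs).mul_left _
  refine ⟨Summable.of_nonneg_of_le hd hbound hsh, ?_⟩
  refine ((Summable.of_nonneg_of_le hd hbound hsh).tsum_le_tsum hbound hsh).trans_eq ?_
  have e := (Equiv.subRight k).tsum_eq (fun j : ℤ => r ^ |j|.toNat)
  simp only [Equiv.subRight_apply] at e
  rw [tsum_mul_left, e]
  ring

/-- A two-sided geometric majorant sums to the geometric mean of the two data. -/
theorem exists_tsum_le {ε₁ ε₂ : ℝ} (h : 0 < ε₁ * ε₂) :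
    ∃ C : ℝ, 0 ≤ C ∧ ∀ {A₁ A₂ : ℝ}, 0 ≤ A₁ → 0 ≤ A₂ → ∀ {d : ℤ → ℝ}, (∀ j, 0 ≤ d j) →
      (∀ j : ℤ, d j ≤ 2 ^ (j * ε₁) * A₁) → (∀ j : ℤ, d j ≤ 2 ^ (-(j * ε₂)) * A₂) →
      Summable d ∧ ∑' j, d j ≤ C * (A₁ ^ (ε₂ / (ε₁ + ε₂)) * A₂ ^ (ε₁ / (ε₁ + ε₂))) := by
  rcases pos_and_pos_or_neg_and_neg_of_mul_pos h with ⟨h1, h2⟩ | ⟨h1, h2⟩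
  · exact exists_tsum_le_of_pos h1 h2
  -- When both exponents are negative the two majorants exchange their roles.
  · obtain ⟨C, hC0, hC⟩ := exists_tsum_le_of_pos (ε₁ := -ε₂) (ε₂ := -ε₁) (by linarith) (by linarith)
    refine ⟨C, hC0, fun {A₁ A₂} hA1 hA2 {d} hd hd1 hd2 => ?_⟩
    obtain ⟨h3, h4⟩ := hC hA2 hA1 hd (fun j => by simpa using hd2 j) (fun j => by simpa using hd1 j)
    refine ⟨h3, h4.trans_eq ?_⟩
    have e1 : -ε₁ / (-ε₂ + -ε₁) = ε₁ / (ε₁ + ε₂) := by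
      rw [show -ε₂ + -ε₁ = -(ε₁ + ε₂) by ring, neg_div_neg_eq]
    have e2 : -ε₂ / (-ε₂ + -ε₁) = ε₂ / (ε₁ + ε₂) := by
      rw [show -ε₂ + -ε₁ = -(ε₁ + ε₂) by ring, neg_div_neg_eq]
    rw [e1, e2, mul_comm (A₂ ^ _)]

end Sums

/-! ### Dyadic decomposition and block estimates -/

section Dyadic

variable {n : ℕ} {f u : EuclideanSpace ℝ (Fin n) → ℝ}

/-- The dyadic frequency block. -/
noncomputable def dyBlock (M : ℕ) (j : ℤ) (f : EuclideanSpace ℝ (Fin n) → ℝ) :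
    EuclideanSpace ℝ (Fin n) → ℝ :=
  lpBlock (M + 1) ((2 : ℝ) ^ (-(j : ℝ))) f

theorem IsTest.dyBlock (hf : IsTest f) (M : ℕ) (j : ℤ) : IsTest (dyBlock M j f) :=
  hf.lpBlock (by positivity) _

theorem listDeriv_dyBlock (hf : IsTest f) (M : ℕ) (j : ℤ) (l : List (Fin n)) :
    listDeriv l (dyBlock M j f) = dyBlock M j (listDeriv l f) :=
  listDeriv_lpBlock hf (by positivity) _ l

theorem tendsto_errWord_zero (hf : IsTest f) (M : ℕ) (x : EuclideanSpace ℝ (Fin n)) :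
    Filter.Tendsto (fun J : ℕ => errWord (List.replicate (M + 1) ((2 : ℝ) ^ (-(J : ℝ)))) f x)
      Filter.atTop (nhds 0) := by
  choose L hL0 hL using fun i => (hf.partialDeriv i).exists_bound
  set S := ∑ i, L i
  have hS : 0 ≤ S := Finset.sum_nonneg fun i _ => hL0 i
  have hb : ∀ J : ℕ, |errWord (List.replicate (M + 1) ((2 : ℝ) ^ (-(J : ℝ)))) f x| ≤
      2 ^ (M + 1) * (2 ^ (-(J : ℝ)) * n) * S := by
    intro J
    have hp : (0 : ℝ) < 2 ^ (-(J : ℝ)) := by positivity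
    refine (hf.errWord (forall_mem_replicate_pos hp _)).abs_le_of_eLpNorm_top_le (by positivity) ?_ x
    refine (eLpNorm_errWord_le_of_deriv (ρ := 2 ^ (-(J : ℝ))) (k := 1) (A := ENNReal.ofReal S)
      le_top hf (by simp) (fun d hd => ?_) fun l hl => ?_).trans_eq ?_
    · rw [List.eq_of_mem_replicate hd]; exact ⟨hp, le_rfl⟩
    · obtain ⟨i, rfl⟩ := List.length_eq_one_iff.1 hl
      refine eLpNorm_top_le_of_abs_le fun y => (hL i y).trans ?_
      exact Finset.single_le_sum (fun j _ => hL0 j) (Finset.mem_univ i)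
    · rw [ENNReal.ofReal_mul (by positivity), ENNReal.ofReal_mul (by positivity),
        ENNReal.ofReal_mul (by positivity), ENNReal.ofReal_pow (by norm_num)]
      simp
  refine squeeze_zero_norm hb ?_
  have h0 : Filter.Tendsto (fun J : ℕ => (2 : ℝ) ^ (-(J : ℝ))) Filter.atTop (nhds 0) := by
    have := tendsto_pow_atTop_nhds_zero_of_lt_one (r := (1 / 2 : ℝ)) (by norm_num) (by norm_num)
    refine this.congr fun J => ?_
    rw [Real.rpow_neg (by norm_num), Real.rpow_natCast, one_div, inv_pow]
  have := ((h0.mul_const (n : ℝ)).const_mul (2 ^ (M + 1) : ℝ)).mul_const S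
  simpa using this

/-- At large scales mollification kills a test function: the bound from `L^1` to `L^∞` decays like
δ⁻ⁿ, and this needs `n > 0`. Hence each error tends to the identity. -/
theorem tendsto_errWord_self (hn : 0 < n) (hf : IsTest f) (N : ℕ)
    (x : EuclideanSpace ℝ (Fin n)) :
    Filter.Tendsto (fun δ : ℝ => errWord (List.replicate N δ) f x) Filter.atTop (nhds (f x)) := by
  induction N with
  | zero => simp
  | succ N ih =>
    obtain ⟨C, hC⟩ := exists_enorm_conv_dil_le (isTest_moll (n := n)) (t := 1) le_rfl
    set A := (eLpNorm f 1 volume).toReal with hA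
    have hAtop : eLpNorm f 1 volume ≠ ⊤ := (hf.memLp 1).2.ne
    have hb : ∀ᶠ δ : ℝ in Filter.atTop,
        ‖mollify δ (errWord (List.replicate N δ) f) x‖ ≤ C * δ ^ (-(n : ℝ)) * (2 ^ N * A) := by
      filter_upwards [Filter.eventually_gt_atTop 0] with δ hδ
      have hr := forall_mem_replicate_pos hδ N
      have h1 := hC hδ (hf.errWord hr) x
      have h2 := eLpNorm_errWord_le hf hr (t := 1) le_rfl
      rw [List.length_replicate, ← ENNReal.ofReal_toReal hAtop, ← hA] at h2
      have h3 : ‖mollify δ (errWord (List.replicate N δ) f) x‖ₑ ≤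
          ENNReal.ofReal (C * δ ^ (-(n : ℝ)) * (2 ^ N * A)) := by
        refine h1.trans ?_
        refine (mul_le_mul' le_rfl h2).trans_eq ?_
        have hA0 : 0 ≤ A := ENNReal.toReal_nonneg
        rw [ENNReal.ofReal_mul (by positivity), ENNReal.ofReal_mul (by positivity),
          ENNReal.ofReal_mul (by positivity), ENNReal.ofReal_pow (by norm_num)]
        simp
      rw [← ofReal_norm, ENNReal.ofReal_le_ofReal_iff (by positivity)] at h3
      exact h3
    have h0 : Filter.Tendsto (fun δ : ℝ => mollify δ (errWord (List.replicate N δ) f) x)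
        Filter.atTop (nhds 0) := by
      refine squeeze_zero_norm' hb ?_
      have := ((tendsto_rpow_neg_atTop (y := (n : ℝ)) (by exact_mod_cast hn)).const_mul
        (C : ℝ)).mul_const (2 ^ N * A)
      simpa using this
    have := ih.sub h0
    simpa [List.replicate_succ, mollErr] using this

/-- The blocks with |j| ≤ J telescope to the word at scale 2^{J+1}, which tends to `f`, minus the
word at scale 2^{-J}, which tends to zero. -/
theorem tendsto_sum_dyBlock (hn : 0 < n) (hf : IsTest f) (M : ℕ) (x : EuclideanSpace ℝ (Fin n)) :
    Filter.Tendsto (fun J : ℕ => ∑ i ∈ Finset.range (2 * J + 1), dyBlock M ((J : ℤ) - i) f x)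
      Filter.atTop (nhds (f x)) := by
  have e : ∀ J : ℕ, ∑ i ∈ Finset.range (2 * J + 1), dyBlock M ((J : ℤ) - i) f x =
      errWord (List.replicate (M + 1) ((2 : ℝ) ^ ((J : ℝ) + 1))) f x -
        errWord (List.replicate (M + 1) ((2 : ℝ) ^ (-(J : ℝ)))) f x := by
    intro J
    set h : ℕ → ℝ := fun i => errWord (List.replicate (M + 1) ((2 : ℝ) ^ (-(J : ℝ) + i))) f x
    have h1 : ∀ i : ℕ, dyBlock M ((J : ℤ) - i) f x = h (i + 1) - h i := by
      intro i
      simp only [dyBlock, lpBlock, h, Pi.sub_apply]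
      have e1 : (2 : ℝ) * 2 ^ (-(((J : ℤ) - i : ℤ) : ℝ)) = 2 ^ (-(J : ℝ) + (i + 1 : ℕ)) := by
        nth_rewrite 1 [← Real.rpow_one 2]
        rw [← Real.rpow_add (by norm_num)]
        congr 1
        push_cast
        ring
      have e2 : (2 : ℝ) ^ (-(((J : ℤ) - i : ℤ) : ℝ)) = 2 ^ (-(J : ℝ) + i) := by
        congr 1
        push_cast
        ring
      rw [e1, e2]
    simp_rw [h1]
    rw [Finset.sum_range_sub]
    simp only [h]
    congr 4
    · push_cast; ring_nf
    · simp
  simp_rw [e]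
  have h1 : Filter.Tendsto (fun J : ℕ => (2 : ℝ) ^ ((J : ℝ) + 1)) Filter.atTop Filter.atTop := by
    have := (tendsto_pow_atTop_atTop_of_one_lt (r := (2 : ℝ)) one_lt_two).comp
      (Filter.tendsto_add_atTop_nat 1)
    refine this.congr fun J => ?_
    rw [Function.comp_apply, ← Real.rpow_natCast]
    push_cast
    rfl
  simpa using ((tendsto_errWord_self hn hf (M + 1) x).comp h1).sub (tendsto_errWord_zero hf M x)

theorem sum_range_le_tsum {d : ℤ → ℝ} (hd : Summable d) (h0 : ∀ j, 0 ≤ d j) (J : ℕ) :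
    ∑ i ∈ Finset.range (2 * J + 1), d ((J : ℤ) - i) ≤ ∑' j, d j := by
  have hinj : Set.InjOn (fun i : ℕ => (J : ℤ) - i) (Finset.range (2 * J + 1)) := by
    intro a _ b _ hab
    simpa using hab
  rw [← Finset.sum_image (f := d) hinj]
  exact hd.sum_le_tsum _ fun j _ => h0 j

theorem abs_le_tsum_of_dyBlock (hn : 0 < n) (hf : IsTest f) {M : ℕ} {d : ℤ → ℝ} (hd : Summable d)
    {x : EuclideanSpace ℝ (Fin n)} (h : ∀ j, |dyBlock M j f x| ≤ d j) : |f x| ≤ ∑' j, d j := by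
  refine le_of_tendsto (tendsto_sum_dyBlock hn hf M x).abs (.of_forall fun J => ?_)
  refine (Finset.abs_sum_le_sum_abs _ _).trans ?_
  refine (Finset.sum_le_sum fun i _ => h _).trans ?_
  exact sum_range_le_tsum hd (fun j => (abs_nonneg _).trans (h j)) J

theorem abs_sub_le_tsum_of_dyBlock (hn : 0 < n) (hf : IsTest f) {M : ℕ} {d : ℤ → ℝ}
    (hd : Summable d) {x y : EuclideanSpace ℝ (Fin n)}
    (h : ∀ j, |dyBlock M j f x - dyBlock M j f y| ≤ d j) : |f x - f y| ≤ ∑' j, d j := by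
  refine le_of_tendsto ((tendsto_sum_dyBlock hn hf M x).sub (tendsto_sum_dyBlock hn hf M y)).abs
    (.of_forall fun J => ?_)
  rw [← Finset.sum_sub_distrib]
  refine (Finset.abs_sum_le_sum_abs _ _).trans ?_
  refine (Finset.sum_le_sum fun i _ => h _).trans ?_
  exact sum_range_le_tsum hd (fun j => (abs_nonneg _).trans (h j)) J

/-- Fatou's lemma turns the pointwise convergence of the partial sums into a norm bound, without
convergence in `L^q`. -/
theorem eLpNorm_le_tsum_of_dyBlock (hn : 0 < n) (hf : IsTest f) {M : ℕ} {d : ℤ → ℝ}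
    (hd : Summable d) (h0 : ∀ j, 0 ≤ d j) {q : ℝ≥0∞} (hq : 1 ≤ q)
    (h : ∀ j, eLpNorm (dyBlock M j f) q volume ≤ ENNReal.ofReal (d j)) :
    eLpNorm f q volume ≤ ENNReal.ofReal (∑' j, d j) := by
  have hm : ∀ J : ℕ, AEStronglyMeasurable
      (∑ i ∈ Finset.range (2 * J + 1), dyBlock M ((J : ℤ) - i) f) volume := fun J =>
    (isTest_sum _ fun i _ => hf.dyBlock M _).continuous.aestronglyMeasurable
  refine (Lp.eLpNorm_lim_le_liminf_eLpNorm hm f (.of_forall fun x => ?_)).trans ?_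
  · simpa using tendsto_sum_dyBlock hn hf M x
  · refine (Filter.liminf_le_liminf (v := fun _ => ENNReal.ofReal (∑' j, d j))
      (.of_forall fun J => ?_)).trans_eq (Filter.liminf_const _)
    refine (eLpNorm_sum_le (fun i _ => (hf.dyBlock M _).continuous.aestronglyMeasurable)
      hq).trans ?_
    refine (Finset.sum_le_sum fun i _ => h _).trans ?_
    rw [← ENNReal.ofReal_sum_of_nonneg fun i _ => h0 _]
    exact ENNReal.ofReal_le_ofReal (sum_range_le_tsum hd h0 J)

theorem word_const_eq {M k : ℕ} {δ A : ℝ} (hδ : 0 < δ) :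
    (2 : ℝ≥0∞) ^ M * (ENNReal.ofReal (2 * δ) * n) ^ k * ENNReal.ofReal A =
      ENNReal.ofReal (2 ^ M * (2 * n) ^ k) * ENNReal.ofReal (δ ^ (k : ℝ)) * ENNReal.ofReal A := by
  rw [← ENNReal.ofReal_mul (by positivity)]
  congr 1
  have : (2 : ℝ) ^ M * (2 * n) ^ k * δ ^ (k : ℝ) = 2 ^ M * ((2 * δ) * n) ^ k := by
    rw [Real.rpow_natCast, mul_assoc, ← mul_pow]; ring
  rw [this, ENNReal.ofReal_mul (p := 2 ^ M) (by positivity), ENNReal.ofReal_pow (by norm_num),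
    ENNReal.ofReal_pow (by positivity), ENNReal.ofReal_mul (p := 2 * δ) (by positivity)]
  simp

theorem dyadic_rpow_mul (j : ℤ) (a b : ℝ) :
    ((2 : ℝ) ^ (-(j : ℝ))) ^ (-a) * ((2 : ℝ) ^ (-(j : ℝ))) ^ b = 2 ^ ((j : ℝ) * (a - b)) := by
  rw [← Real.rpow_mul (by norm_num), ← Real.rpow_mul (by norm_num), ← Real.rpow_add (by norm_num)]
  congr 1
  ring

/-- The words inside the block have `M ≥ k` errors, enough to spend `k` derivatives of `u` on them,
a gain of 2^{-jk}; the derivatives in `l` cost 2^j each. -/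
theorem exists_eLpNorm_dyBlock_le {t : ℝ≥0∞} (ht : 1 ≤ t) {M k : ℕ} (hk : k ≤ M) (K : ℕ) :
    ∃ C : ℝ, 0 ≤ C ∧ ∀ {u : EuclideanSpace ℝ (Fin n) → ℝ}, IsTest u → ∀ {A : ℝ}, 0 ≤ A →
      (∀ l : List (Fin n), l.length = k → eLpNorm (listDeriv l u) t volume ≤ ENNReal.ofReal A) →
      ∀ l : List (Fin n), l.length ≤ K → ∀ j : ℤ,
        eLpNorm (listDeriv l (dyBlock M j u)) t volume ≤
          ENNReal.ofReal (C * 2 ^ ((j : ℝ) * (l.length - k)) * A) := by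
  obtain ⟨C, hC⟩ := exists_eLpNorm_lpBlock_le (n := n) ht M K
  refine ⟨C * (2 ^ M * (2 * n) ^ k), by positivity, fun {u} hu {A} hA h l hl j => ?_⟩
  set δ : ℝ := 2 ^ (-(j : ℝ)) with hδ
  have hδ0 : 0 < δ := by positivity
  refine (hC l hl hδ0 hu (W := 2 ^ M * (ENNReal.ofReal (2 * δ) * n) ^ k * ENNReal.ofReal A)
    fun ds hds hd => ?_).trans_eq ?_
  · rw [← hds]
    exact eLpNorm_errWord_le_of_deriv ht hu (hds ▸ hk) hd h
  · rw [word_const_eq hδ0, ← dyadic_rpow_mul, ← hδ]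
    rw [← ENNReal.ofReal_coe_nnreal, ← ENNReal.ofReal_mul (by positivity),
      ← ENNReal.ofReal_mul (by positivity), ← ENNReal.ofReal_mul (by positivity),
      ← ENNReal.ofReal_mul (by positivity)]
    congr 1
    ring

theorem exists_abs_dyBlock_le {t : ℝ≥0∞} (ht : 1 ≤ t) {M k : ℕ} (hk : k ≤ M) (K : ℕ) :
    ∃ C : ℝ, 0 ≤ C ∧ ∀ {u : EuclideanSpace ℝ (Fin n) → ℝ}, IsTest u → ∀ {A : ℝ}, 0 ≤ A →
      (∀ l : List (Fin n), l.length = k → eLpNorm (listDeriv l u) t volume ≤ ENNReal.ofReal A) →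
      ∀ l : List (Fin n), l.length ≤ K → ∀ j : ℤ, ∀ x,
        |listDeriv l (dyBlock M j u) x| ≤
          C * 2 ^ ((j : ℝ) * (l.length - (k - n * t.toReal⁻¹))) * A := by
  obtain ⟨C, hC⟩ := exists_enorm_lpBlock_le (n := n) ht M K
  refine ⟨C * (2 ^ M * (2 * n) ^ k), by positivity, fun {u} hu {A} hA h l hl j x => ?_⟩
  set δ : ℝ := 2 ^ (-(j : ℝ)) with hδ
  have hδ0 : 0 < δ := by positivity
  have h1 := hC l hl hδ0 hu (W := 2 ^ M * (ENNReal.ofReal (2 * δ) * n) ^ k * ENNReal.ofReal A)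
    (fun ds hds hd => by rw [← hds]; exact eLpNorm_errWord_le_of_deriv ht hu (hds ▸ hk) hd h) x
  rw [← ENNReal.ofReal_le_ofReal_iff (by positivity), ← Real.enorm_eq_ofReal_abs]
  refine h1.trans_eq ?_
  have e : (l.length : ℝ) - (k - n * t.toReal⁻¹) = (l.length + n * t.toReal⁻¹) - k := by ring
  rw [word_const_eq hδ0, e, ← dyadic_rpow_mul, ← hδ]
  rw [← ENNReal.ofReal_coe_nnreal, ← ENNReal.ofReal_mul (by positivity),
    ← ENNReal.ofReal_mul (by positivity), ← ENNReal.ofReal_mul (by positivity),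
    ← ENNReal.ofReal_mul (by positivity)]
  congr 1
  ring

theorem exists_abs_dyBlock_le_of_holder {M k : ℕ} (hk : k < M) (K : ℕ) {σ : ℝ} (hσ : 0 < σ) :
    ∃ C : ℝ, 0 ≤ C ∧ ∀ {u : EuclideanSpace ℝ (Fin n) → ℝ}, IsTest u → ∀ {H : ℝ}, 0 ≤ H →
      (∀ l : List (Fin n), l.length = k → ∀ x y,
        |listDeriv l u x - listDeriv l u y| ≤ H * ‖x - y‖ ^ σ) →
      ∀ l : List (Fin n), l.length ≤ K → ∀ j : ℤ, ∀ x,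
        |listDeriv l (dyBlock M j u) x| ≤
          C * 2 ^ ((j : ℝ) * (l.length - (k + σ))) * H := by
  obtain ⟨C, hC⟩ := exists_enorm_lpBlock_le (n := n) (t := ⊤) le_top M K
  refine ⟨C * (2 ^ M * (2 * n) ^ k) * 2 ^ σ, by positivity, fun {u} hu {H} hH h l hl j x => ?_⟩
  set δ : ℝ := 2 ^ (-(j : ℝ)) with hδ
  have hδ0 : 0 < δ := by positivity
  have h1 := hC l hl hδ0 hu
    (W := 2 ^ M * (ENNReal.ofReal (2 * δ) * n) ^ k * ENNReal.ofReal (H * (2 * δ) ^ σ))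
    (fun ds hds hd => by
      rw [← hds]; exact eLpNorm_top_errWord_le_of_holder hu (hds ▸ hk) hd hH hσ h) x
  rw [← ENNReal.ofReal_le_ofReal_iff (by positivity), ← Real.enorm_eq_ofReal_abs]
  refine h1.trans_eq ?_
  rw [word_const_eq hδ0, ← dyadic_rpow_mul, ← hδ, Real.mul_rpow (by norm_num) hδ0.le,
    Real.rpow_add hδ0]
  simp only [ENNReal.toReal_top, inv_zero, mul_zero, add_zero]
  rw [← ENNReal.ofReal_coe_nnreal, ← ENNReal.ofReal_mul (by positivity),
    ← ENNReal.ofReal_mul (by positivity), ← ENNReal.ofReal_mul (by positivity),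
    ← ENNReal.ofReal_mul (by positivity)]
  congr 1
  ring

end Dyadic

end GagNir

namespace GagNir

/-! ### What the norms of the data control -/

section Extraction

variable {n : ℕ} {u v : EuclideanSpace ℝ (Fin n) → ℝ}

theorem abs_listDeriv_le_of_holderNorm (hv : ContDiff ℝ ∞ v) {m : ℕ} {s X : ℝ} (hX : 0 ≤ X)
    (h : holderNorm m s v ≤ ENNReal.ofReal X) {l : List (Fin n)} (hl : l.length ≤ m)
    (x : EuclideanSpace ℝ (Fin n)) : |listDeriv l v x| ≤ X := by
  have h1 := le_self_add.trans h
  rw [listDeriv_eq_multiDeriv hv]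
  have h2 : ‖multiDeriv (fun i => l.count i) v x‖ₑ ≤ ENNReal.ofReal X := by
    refine le_trans ?_ h1
    refine le_iSup₂_of_le (fun i => l.count i) ((sum_count_eq_length l).trans_le hl) ?_
    exact le_iSup (fun x => ‖multiDeriv (fun i => l.count i) v x‖ₑ) x
  rwa [Real.enorm_eq_ofReal_abs, ENNReal.ofReal_le_ofReal_iff hX] at h2

theorem holder_listDeriv_of_holderNorm (hv : ContDiff ℝ ∞ v) {m : ℕ} {s X : ℝ} (hX : 0 ≤ X)
    (h : holderNorm m s v ≤ ENNReal.ofReal X) {l : List (Fin n)} (hl : l.length = m)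
    (x y : EuclideanSpace ℝ (Fin n)) :
    |listDeriv l v x - listDeriv l v y| ≤ X * ‖x - y‖ ^ s := by
  have h1 := le_add_self.trans h
  rw [listDeriv_eq_multiDeriv hv]
  refine abs_sub_le_of_enorm_sub_div_le hX x y fun hxy => ?_
  refine le_trans ?_ h1
  have hmem : (fun i => l.count i) ∈ multiIndices n m := by
    rw [mem_multiIndices, sum_count_eq_length, hl]
  refine le_trans ?_ (Finset.single_le_sum (f := fun α => ⨆ (x : EuclideanSpace ℝ (Fin n))
    (y : EuclideanSpace ℝ (Fin n)) (_ : x ≠ y),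
      ‖multiDeriv α v x - multiDeriv α v y‖ₑ / ‖x - y‖ₑ ^ s) (fun _ _ => zero_le) hmem)
  exact le_iSup_of_le x (le_iSup₂_of_le y hxy le_rfl)

theorem xNorm_listDeriv_le (hu : ContDiff ℝ ∞ u) {k : ℕ} {μ : ℝ} {l : List (Fin n)}
    (hl : l.length = k) : xNorm μ (listDeriv l u) ≤ xNormD k μ u := by
  rw [listDeriv_eq_multiDeriv hu]
  exact Finset.single_le_sum (f := fun α => xNorm μ (multiDeriv α u)) (fun _ _ => zero_le)
    (by rw [mem_multiIndices, sum_count_eq_length, hl])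

theorem xNormD_zero (μ : ℝ) (u : EuclideanSpace ℝ (Fin n) → ℝ) : xNormD 0 μ u = xNorm μ u := by
  have : multiIndices n 0 = {0} := by
    ext α
    simp [mem_multiIndices, funext_iff]
  rw [xNormD, this, Finset.sum_singleton]
  obtain ⟨l, hl, hlu⟩ := exists_multiDeriv_eq_listDeriv (0 : Fin n → ℕ)
  have : l = [] := by simpa using hl
  rw [hlu, this, listDeriv_nil]

theorem IsTest.xNormD_lt_top (hn : 0 < n) (hu : IsTest u) (k : ℕ) (μ : ℝ) :
    xNormD k μ u < ⊤ :=
  ENNReal.sum_lt_top.2 fun α hα => (hu.memXk hn k μ α ((mem_multiIndices α).1 hα).le).2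

/-- Hölder and Lebesgue data thus follow the same count of orders, d - nμ. -/
theorem holderOrder_add_holderExponent (n : ℕ) (μ : ℝ) :
    (holderOrder n μ : ℝ) + holderExponent n μ = -(n * μ) := by
  unfold holderExponent; ring

theorem eLpNorm_listDeriv_le_of_nonneg (hn : 0 < n) (hu : IsTest u) {d : ℕ} {μ : ℝ} (hμ : 0 ≤ μ)
    {l : List (Fin n)} (hl : l.length = d) :
    eLpNorm (listDeriv l u) (if 0 < μ then ENNReal.ofReal (1 / μ) else ⊤) volume ≤
      ENNReal.ofReal (xNormD d μ u).toReal := by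
  rw [ENNReal.ofReal_toReal (hu.xNormD_lt_top hn d μ).ne]
  refine le_trans (le_of_eq ?_) (xNorm_listDeriv_le hu.smooth hl)
  unfold xNorm
  split_ifs with h1 h2
  · rfl
  · rfl
  · exact absurd (le_antisymm (not_lt.1 h1) hμ) h2

theorem holderNorm_listDeriv_le_of_neg (hn : 0 < n) (hu : IsTest u) {d : ℕ} {μ : ℝ} (hμ : μ < 0)
    {l : List (Fin n)} (hl : l.length = d) :
    holderNorm (holderOrder n μ) (holderExponent n μ) (listDeriv l u) ≤
      ENNReal.ofReal (xNormD d μ u).toReal := by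
  rw [ENNReal.ofReal_toReal (hu.xNormD_lt_top hn d μ).ne]
  refine le_trans (le_of_eq ?_) (xNorm_listDeriv_le hu.smooth hl)
  unfold xNorm
  rw [if_neg (by linarith), if_neg hμ.ne]

/-- The last `d` letters of the list act first and select one of the functions measured in `xNormD`;
the remaining ones are derivatives inside its Hölder norm. -/
theorem abs_listDeriv_le_of_neg (hn : 0 < n) (hu : IsTest u) {d : ℕ} {μ : ℝ} (hμ : μ < 0)
    {l : List (Fin n)} (hl : d ≤ l.length) (hl' : l.length ≤ holderOrder n μ + d)
    (x : EuclideanSpace ℝ (Fin n)) : |listDeriv l u x| ≤ (xNormD d μ u).toReal := by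
  rw [← List.take_append_drop (l.length - d) l, listDeriv_append]
  refine abs_listDeriv_le_of_holderNorm (hu.listDeriv _).smooth ENNReal.toReal_nonneg
    (holderNorm_listDeriv_le_of_neg hn hu hμ ?_) ?_ x
  · rw [List.length_drop]; omega
  · rw [List.length_take]; omega

theorem holder_listDeriv_le_of_neg (hn : 0 < n) (hu : IsTest u) {d : ℕ} {μ : ℝ} (hμ : μ < 0)
    {l : List (Fin n)} (hl : l.length = holderOrder n μ + d) (x y : EuclideanSpace ℝ (Fin n)) :
    |listDeriv l u x - listDeriv l u y| ≤
      (xNormD d μ u).toReal * ‖x - y‖ ^ holderExponent n μ := by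
  rw [← List.take_append_drop (l.length - d) l, listDeriv_append]
  refine holder_listDeriv_of_holderNorm (hu.listDeriv _).smooth ENNReal.toReal_nonneg
    (holderNorm_listDeriv_le_of_neg hn hu hμ ?_) ?_ x y
  · rw [List.length_drop]; omega
  · rw [List.length_take]; omega

theorem one_le_exponent {μ : ℝ} (hμ : μ ≤ 1) :
    1 ≤ (if 0 < μ then ENNReal.ofReal (1 / μ) else ⊤) := by
  split_ifs with h
  · rw [ENNReal.one_le_ofReal, le_div_iff₀ h]; linarith
  · exact le_top

theorem toReal_exponent_inv {μ : ℝ} (hμ : 0 ≤ μ) :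
    (if 0 < μ then ENNReal.ofReal (1 / μ) else (⊤ : ℝ≥0∞)).toReal⁻¹ = μ := by
  split_ifs with h
  · rw [ENNReal.toReal_ofReal (by positivity)]; simp
  · simp [le_antisymm (not_lt.1 h) hμ]

end Extraction

/-! ### Admissible orders of a datum -/

section Spectral

variable {n : ℕ} {u : EuclideanSpace ℝ (Fin n) → ℝ}

/-- The derivatives of order at most `K` of the dyadic blocks of `u` behave as those of a function
with `κ` derivatives bounded by `X`. -/
def SpecBound (M K : ℕ) (κ X : ℝ) (u : EuclideanSpace ℝ (Fin n) → ℝ) : Prop :=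
  ∀ l : List (Fin n), l.length ≤ K → ∀ (j : ℤ) (x : EuclideanSpace ℝ (Fin n)),
    |listDeriv l (dyBlock M j u) x| ≤ 2 ^ ((j : ℝ) * (l.length - κ)) * X

theorem SpecBound.mono {M K : ℕ} {κ X X' : ℝ} (h : SpecBound M K κ X u) (hX : X ≤ X') :
    SpecBound M K κ X' u := fun l hl j x => (h l hl j x).trans (by gcongr)

/-- For j ≥ 0 the bound with the larger order is the stronger one, for j ≤ 0 the bound with the
smaller order. -/
theorem SpecBound.between {M K : ℕ} {κ₀ κ₁ κ X : ℝ} (hX : 0 ≤ X) (h0 : SpecBound M K κ₀ X u)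
    (h1 : SpecBound M K κ₁ X u) (hκ : κ ∈ Set.Icc κ₀ κ₁) : SpecBound M K κ X u := by
  intro l hl j x
  rcases le_total 0 j with hj | hj
  · have hj' : (0 : ℝ) ≤ j := by exact_mod_cast hj
    refine (h1 l hl j x).trans (mul_le_mul_of_nonneg_right ?_ hX)
    exact Real.rpow_le_rpow_of_exponent_le (by norm_num) (by nlinarith [hκ.2])
  · have hj' : (j : ℝ) ≤ 0 := by exact_mod_cast hj
    refine (h0 l hl j x).trans (mul_le_mul_of_nonneg_right ?_ hX)
    exact Real.rpow_le_rpow_of_exponent_le (by norm_num) (by nlinarith [hκ.1])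

/-- The smallest order that the norm of `X^{d,1/μ}` controls. -/
noncomputable def lowOrder (n d : ℕ) (μ : ℝ) : ℝ := if 0 ≤ μ then d - n * μ else d

theorem exists_specBound (hn : 0 < n) (d : ℕ) {μ : ℝ} (hμ : μ ≤ 1) {M : ℕ}
    (hM : d + holderOrder n μ < M) (K : ℕ) :
    ∃ C : ℝ, 0 ≤ C ∧ ∀ {u : EuclideanSpace ℝ (Fin n) → ℝ}, IsTest u →
      ∀ κ ∈ Set.Icc (lowOrder n d μ) (d - n * μ),
        SpecBound M K κ (C * (xNormD d μ u).toReal) u := by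
  rcases le_or_gt 0 μ with h0 | h0
  · obtain ⟨C, hC0, hC⟩ := exists_abs_dyBlock_le (n := n) (one_le_exponent hμ) (M := M) (k := d)
      (by omega) K
    refine ⟨C, hC0, fun {u} hu κ hκ => ?_⟩
    rw [lowOrder, if_pos h0, Set.Icc_self, Set.mem_singleton_iff] at hκ
    subst hκ
    intro l hl j x
    have := hC hu ENNReal.toReal_nonneg (fun l hl => eLpNorm_listDeriv_le_of_nonneg hn hu h0 hl)
      l hl j x
    rw [toReal_exponent_inv h0] at this
    exact this.trans_eq (by ring)
  -- The supremum of the derivatives of order `d` gives the lower end of the interval of orders, the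
  -- Hölder seminorm the upper end.
  · obtain ⟨C₀, hC00, hC0⟩ := exists_abs_dyBlock_le (n := n) (t := ⊤) le_top (M := M) (k := d)
      (by omega) K
    obtain ⟨C₁, hC10, hC1⟩ := exists_abs_dyBlock_le_of_holder (n := n) (M := M)
      (k := d + holderOrder n μ) hM K (holderExponent_mem hn h0).1
    refine ⟨C₀ + C₁, by positivity, fun {u} hu κ hκ => ?_⟩
    rw [lowOrder, if_neg (not_le.2 h0)] at hκ
    set X := (xNormD d μ u).toReal
    have hX : 0 ≤ X := ENNReal.toReal_nonneg
    refine SpecBound.between (by positivity) ?_ ?_ hκ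
    · intro l hl j x
      have := hC0 hu hX (fun l hl => eLpNorm_top_le_of_abs_le
        (abs_listDeriv_le_of_neg hn hu h0 hl.ge (by omega))) l hl j x
      simp only [ENNReal.toReal_top, inv_zero, mul_zero, sub_zero] at this
      refine this.trans ?_
      have : 0 ≤ 2 ^ ((j : ℝ) * (l.length - d)) * (C₁ * X) := by positivity
      linarith
    · intro l hl j x
      have := hC1 hu hX (fun l hl => holder_listDeriv_le_of_neg hn hu h0 (by omega)) l hl j x
      have e : ((d + holderOrder n μ : ℕ) : ℝ) + holderExponent n μ = d - n * μ := by
        push_cast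
        rw [add_assoc, holderOrder_add_holderExponent]
        ring
      rw [e] at this
      refine this.trans ?_
      have : 0 ≤ 2 ^ ((j : ℝ) * (l.length - (d - n * μ))) * (C₀ * X) := by positivity
      linarith

end Spectral

/-! ### Summation to the square root of a product -/

section GeometricMean

theorem rpow_half_mul_rpow_half {A B : ℝ} (hA : 0 ≤ A) : A ^ (1 / 2 : ℝ) * B ^ (1 / 2 : ℝ) =
    √(A * B) := by
  rw [← Real.sqrt_eq_rpow, ← Real.sqrt_eq_rpow, ← Real.sqrt_mul hA]

/-- The exponents m - x and m - y are opposite and nonzero, so the majorants cross with equal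
weights. -/
theorem exists_tsum_le_sqrt {m x y : ℝ} (hxy : x + y = 2 * m) (hne : x ≠ y) :
    ∃ C : ℝ, 0 ≤ C ∧ ∀ {A B : ℝ}, 0 ≤ A → 0 ≤ B → ∀ {d : ℤ → ℝ}, (∀ j, 0 ≤ d j) →
      (∀ j : ℤ, d j ≤ 2 ^ ((j : ℝ) * (m - x)) * A) →
      (∀ j : ℤ, d j ≤ 2 ^ ((j : ℝ) * (m - y)) * B) →
      Summable d ∧ ∑' j, d j ≤ C * √(A * B) := by
  have hm : m - x ≠ 0 := by
    intro h; apply hne; linarith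
  have e : m - y = -(m - x) := by linarith
  obtain ⟨C, hC0, hC⟩ := exists_tsum_le (ε₁ := m - x) (ε₂ := m - x)
    (mul_self_pos.2 hm)
  refine ⟨C, hC0, fun {A B} hA hB {d} hd h1 h2 => ?_⟩
  have := hC hA hB hd h1 (fun j => (h2 j).trans_eq (by rw [e, mul_neg]))
  have e2 : (m - x) / (m - x + (m - x)) = 1 / 2 := by field_simp; norm_num
  rwa [e2, rpow_half_mul_rpow_half hA] at this

/-- The datum `A` has exactly the order of the target and gives no decay, but its geometric mean
with either bound from `B` decays on one side, already with the factor √(AB). -/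
theorem exists_tsum_le_sqrt_of_mem_Ioo {m y₀ y₁ : ℝ} (h0 : y₀ < m) (h1 : m < y₁) :
    ∃ C : ℝ, 0 ≤ C ∧ ∀ {A B : ℝ}, 0 ≤ A → 0 ≤ B → ∀ {d : ℤ → ℝ}, (∀ j, 0 ≤ d j) →
      (∀ j : ℤ, d j ≤ A) → (∀ j : ℤ, d j ≤ 2 ^ ((j : ℝ) * (m - y₀)) * B) →
      (∀ j : ℤ, d j ≤ 2 ^ ((j : ℝ) * (m - y₁)) * B) →
      Summable d ∧ ∑' j, d j ≤ C * √(A * B) := by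
  obtain ⟨C, hC0, hC⟩ := exists_tsum_le (ε₁ := (m - y₀) / 2) (ε₂ := (y₁ - m) / 2)
    (mul_pos (by linarith) (by linarith))
  refine ⟨C, hC0, fun {A B} hA hB {d} hd hdA hd0 hd1 => ?_⟩
  have key : ∀ (e : ℝ) (j : ℤ), d j ≤ 2 ^ ((j : ℝ) * e) * B →
      d j ≤ 2 ^ ((j : ℝ) * (e / 2)) * √(A * B) := by
    intro e j h
    have hp : (2 : ℝ) ^ ((j : ℝ) * (e / 2)) = √(2 ^ ((j : ℝ) * e)) := by
      rw [Real.sqrt_eq_rpow, ← Real.rpow_mul (by norm_num)]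
      congr 1; ring
    rw [hp, ← Real.sqrt_mul (by positivity)]
    refine Real.le_sqrt_of_sq_le ?_
    calc d j ^ 2 = d j * d j := sq _
      _ ≤ A * (2 ^ ((j : ℝ) * e) * B) := mul_le_mul (hdA j) h (hd j) hA
      _ = _ := by ring
  have := hC (Real.sqrt_nonneg (A * B)) (Real.sqrt_nonneg (A * B)) hd (fun j => key _ j (hd0 j))
    (fun j => by
      have := key _ j (hd1 j)
      rwa [show (j : ℝ) * ((m - y₁) / 2) = -(j * ((y₁ - m) / 2)) by ring] at this)
  have hs : (m - y₀) / 2 + (y₁ - m) / 2 ≠ 0 := by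
    have : (m - y₀) / 2 + (y₁ - m) / 2 = (y₁ - y₀) / 2 := by ring
    rw [this]
    have : y₀ < y₁ := h0.trans h1
    exact (by linarith : (0 : ℝ) < (y₁ - y₀) / 2).ne'
  rw [← Real.rpow_add_of_nonneg (Real.sqrt_nonneg _) (by
    apply div_nonneg <;> linarith) (by apply div_nonneg <;> linarith), ← add_div, add_comm,
    div_self hs, Real.rpow_one] at this
  exact this

/-- Summation of a sequence controlled by two families of orders whose mean is `m`. -/
theorem exists_tsum_le_sqrt_of_Icc {m x₀ x₁ y₀ y₁ : ℝ} (hx : x₀ ≤ x₁) (hy : y₀ ≤ y₁)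
    (hlow : x₀ + y₀ ≤ 2 * m) (hupp : 2 * m ≤ x₁ + y₁) (hy₀ : y₀ < m)
    (hne : ¬ (m = x₁ ∧ m = y₁)) :
    ∃ C : ℝ, 0 ≤ C ∧ ∀ {A B : ℝ}, 0 ≤ A → 0 ≤ B → ∀ {d : ℤ → ℝ}, (∀ j, 0 ≤ d j) →
      (∀ κ ∈ Set.Icc x₀ x₁, ∀ j : ℤ, d j ≤ 2 ^ ((j : ℝ) * (m - κ)) * A) →
      (∀ κ ∈ Set.Icc y₀ y₁, ∀ j : ℤ, d j ≤ 2 ^ ((j : ℝ) * (m - κ)) * B) →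
      Summable d ∧ ∑' j, d j ≤ C * √(A * B) := by
  -- The sums of admissible orders fill an interval that contains 2m. If the chosen orders differ
  -- they suffice; otherwise both equal `m` and must be moved.
  obtain ⟨x, y, hxy, hxm, hym⟩ : ∃ x y, x + y = 2 * m ∧ x ∈ Set.Icc x₀ x₁ ∧ y ∈ Set.Icc y₀ y₁ := by
    rcases le_total x₀ (2 * m - y₁) with h | h
    · exact ⟨2 * m - y₁, y₁, by ring, ⟨h, by linarith⟩, ⟨hy, le_rfl⟩⟩
    · exact ⟨x₀, 2 * m - x₀, by ring, ⟨le_rfl, hx⟩, ⟨by linarith, by linarith⟩⟩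
  by_cases hne' : x = y
  · have hx' : x = m := by linarith
    have hy' : y = m := by linarith
    rw [hx'] at hxm
    rw [hy'] at hym
    rcases hym.2.lt_or_eq with h | h
    · obtain ⟨C, hC0, hC⟩ := exists_tsum_le_sqrt_of_mem_Ioo hy₀ h
      refine ⟨C, hC0, fun {A B} hA hB {d} hd h1 h2 => hC hA hB hd (fun j => ?_)
        (h2 _ ⟨le_rfl, hy⟩) (h2 _ ⟨hy, le_rfl⟩)⟩
      simpa using h1 m hxm j
    -- Here `B` admits nothing above `m`, so `hne` leaves room above `m` for `A`; the orders are
    -- moved to m + ε and m - ε.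
    · have h' : m < x₁ := lt_of_le_of_ne hxm.2 fun h'' => hne ⟨h'', h⟩
      set ε := min (x₁ - m) (m - y₀) with hε
      have hε0 : 0 < ε := lt_min (by linarith) (by linarith)
      have hε1 : ε ≤ x₁ - m := min_le_left _ _
      have hε2 : ε ≤ m - y₀ := min_le_right _ _
      obtain ⟨C, hC0, hC⟩ := exists_tsum_le_sqrt (m := m) (x := m + ε) (y := m - ε) (by ring)
        (by intro h; linarith)
      exact ⟨C, hC0, fun {A B} hA hB {d} hd h1 h2 => hC hA hB hd
        (h1 _ ⟨by linarith [hxm.1], by linarith⟩) (h2 _ ⟨by linarith, by linarith⟩)⟩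
  · obtain ⟨C, hC0, hC⟩ := exists_tsum_le_sqrt hxy hne'
    exact ⟨C, hC0, fun {A B} hA hB {d} hd h1 h2 => hC hA hB hd (h1 _ hxm) (h2 _ hym)⟩

end GeometricMean

end GagNir

namespace GagNir

/-! ### Suprema, Hölder seminorms and Morrey's inequality -/

section UniformBounds

variable {n : ℕ}

/-- For ‖x - y‖ 2^j ≥ 1 the supremum bound is used at both points, otherwise the mean value
inequality. In each case the power σ ∈ [0, 1] of ‖x - y‖ 2^j only weakens the estimate. -/
theorem SpecBound.abs_sub_le {u : EuclideanSpace ℝ (Fin n) → ℝ} (hu : IsTest u) {M k : ℕ}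
    {κ X σ : ℝ} (hX : 0 ≤ X) (h : SpecBound M (k + 1) κ X u) (hσ0 : 0 ≤ σ) (hσ1 : σ ≤ 1)
    {l : List (Fin n)} (hl : l.length = k) (j : ℤ) {x y : EuclideanSpace ℝ (Fin n)} (hxy : x ≠ y) :
    |listDeriv l (dyBlock M j u) x - listDeriv l (dyBlock M j u) y| ≤
      (2 + n) * ‖x - y‖ ^ σ * (2 ^ ((j : ℝ) * (k + σ - κ)) * X) := by
  set r := ‖x - y‖ with hr
  have hr0 : 0 < r := norm_pos_iff.2 (sub_ne_zero.2 hxy)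
  set p : ℝ := 2 ^ (j : ℝ) with hp
  have hp0 : 0 < p := by positivity
  set a : ℝ := 2 ^ ((j : ℝ) * (k - κ)) with ha
  have ha0 : 0 < a := by positivity
  have h1 : |listDeriv l (dyBlock M j u) x - listDeriv l (dyBlock M j u) y| ≤ 2 * (a * X) := by
    have e1 := h l (by omega) j x
    have e2 := h l (by omega) j y
    rw [hl] at e1 e2
    have := abs_sub (listDeriv l (dyBlock M j u) x) (listDeriv l (dyBlock M j u) y)
    linarith
  have h2 : |listDeriv l (dyBlock M j u) x - listDeriv l (dyBlock M j u) y| ≤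
      n * (a * p * X) * r := by
    refine abs_sub_le_of_partialDeriv_le ((hu.dyBlock M j).listDeriv l).differentiable
      (fun i z => ?_) x y
    have e1 := h (i :: l) (by simp [hl]) j z
    rw [List.length_cons, hl] at e1
    refine e1.trans_eq ?_
    rw [ha, hp, ← Real.rpow_add (by norm_num)]
    congr 2
    push_cast
    ring
  have e : r ^ σ * (2 ^ ((j : ℝ) * (k + σ - κ)) * X) = a * X * (r * p) ^ σ := by
    rw [Real.mul_rpow hr0.le hp0.le, hp, ← Real.rpow_mul (by norm_num), ha]
    have : (2 : ℝ) ^ ((j : ℝ) * (k + σ - κ)) = 2 ^ ((j : ℝ) * (k - κ)) * 2 ^ ((j : ℝ) * σ) := by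
      rw [← Real.rpow_add (by norm_num)]; congr 1; ring
    rw [this]; ring
  rw [mul_assoc, e]
  have haX : 0 ≤ a * X := by positivity
  have hn0 : (0 : ℝ) ≤ n := by positivity
  rcases le_total 1 (r * p) with hrp | hrp
  · have : 1 ≤ (r * p) ^ σ := Real.one_le_rpow hrp hσ0
    refine h1.trans ?_
    have h3 : a * X ≤ a * X * (r * p) ^ σ := le_mul_of_one_le_right haX this
    nlinarith
  · have : r * p ≤ (r * p) ^ σ := by
      conv_lhs => rw [← Real.rpow_one (r * p)]
      exact Real.rpow_le_rpow_of_exponent_ge (by positivity) hrp hσ1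
    refine h2.trans ?_
    have h3 : a * X * (r * p) ≤ a * X * (r * p) ^ σ := mul_le_mul_of_nonneg_left this haX
    have h4 : 0 ≤ a * X * (r * p) ^ σ := haX.trans' le_rfl |> fun h => mul_nonneg h (by positivity)
    calc n * (a * p * X) * r = n * (a * X * (r * p)) := by ring
      _ ≤ n * (a * X * (r * p) ^ σ) := by gcongr
      _ ≤ _ := by nlinarith

theorem lowOrder_le {d : ℕ} {μ : ℝ} : lowOrder n d μ ≤ d := by
  unfold lowOrder
  split_ifs with h
  · have : 0 ≤ (n : ℝ) * μ := by positivity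
    linarith
  · exact le_rfl

theorem lowOrder_le_top {d : ℕ} {μ : ℝ} : lowOrder n d μ ≤ d - n * μ := by
  unfold lowOrder
  split_ifs with h
  · exact le_rfl
  · have : (n : ℝ) * μ ≤ 0 := mul_nonpos_of_nonneg_of_nonpos (by positivity) (by linarith)
    linarith

variable {ip iq ir : ℝ}

/-- The interpolation inequality for the uniform norm of derivatives of integer order. -/
theorem exists_abs_listDeriv_le_sqrt (hn : 0 < n) (hp : ip ≤ 1) (hr : ir ≤ 1)
    (hpqr : 2 * iq = ip + ir) {m : ℕ} (hm1 : 1 ≤ m) (hm2 : (m : ℝ) ≤ 1 - n * iq)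
    (hne : ¬ ((m : ℝ) = 2 - n * ip ∧ (m : ℝ) = -(n * ir))) :
    ∃ C : ℝ, 0 ≤ C ∧ ∀ {u : EuclideanSpace ℝ (Fin n) → ℝ}, IsTest u →
      ∀ l : List (Fin n), l.length = m → ∀ x,
        |listDeriv l u x| ≤ C * √((xNormD 2 ip u).toReal * (xNormD 0 ir u).toReal) := by
  set M := max (2 + holderOrder n ip) (0 + holderOrder n ir) + 1
  obtain ⟨CA, hCA0, hCA⟩ := exists_specBound hn 2 hp (M := M)
    (Nat.lt_succ_of_le (le_max_left _ _)) m
  obtain ⟨CB, hCB0, hCB⟩ := exists_specBound hn 0 hr (M := M)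
    (Nat.lt_succ_of_le (le_max_right _ _)) m
  have hm1' : (1 : ℝ) ≤ m := by exact_mod_cast hm1
  have hlA := lowOrder_le (n := n) (d := 2) (μ := ip)
  have hlB := lowOrder_le (n := n) (d := 0) (μ := ir)
  have hsum : (n : ℝ) * ip + n * ir = 2 * (n * iq) := by rw [← mul_add, ← hpqr]; ring
  push_cast at hlA hlB
  -- The lowest orders are at most 2 and 0, so m ≥ 1 gives the lower condition and y₀ < m; the
  -- highest orders add up to 2 - 2n/q, which gives the upper one.
  obtain ⟨C, hC0, hC⟩ := exists_tsum_le_sqrt_of_Icc (m := m)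
    (lowOrder_le_top (n := n) (d := 2) (μ := ip)) (lowOrder_le_top (n := n) (d := 0) (μ := ir))
    (by linarith) (by push_cast; linarith) (by linarith) (by push_cast; simpa using hne)
  refine ⟨C * √(CA * CB), by positivity, fun {u} hu l hl x => ?_⟩
  set A := (xNormD 2 ip u).toReal with hA
  set B := (xNormD 0 ir u).toReal with hB
  have hA0 : 0 ≤ A := ENNReal.toReal_nonneg
  have hB0 : 0 ≤ B := ENNReal.toReal_nonneg
  obtain ⟨hs, hle⟩ := hC (A := CA * A) (B := CB * B) (by positivity) (by positivity)
    (d := fun j => |listDeriv l (dyBlock M j u) x|) (fun j => abs_nonneg _)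
    (fun κ hκ j => by have := hCA hu κ hκ l hl.le j x; rwa [hl] at this)
    (fun κ hκ j => by have := hCB hu κ hκ l hl.le j x; rwa [hl] at this)
  refine (abs_le_tsum_of_dyBlock hn (hu.listDeriv l) hs (M := M) fun j => ?_).trans
    (hle.trans_eq ?_)
  · rw [listDeriv_dyBlock hu]
  · rw [mul_assoc C, ← Real.sqrt_mul (by positivity)]
    congr 2
    ring

/-- The interpolation inequality for Hölder seminorms. -/
theorem exists_holder_listDeriv_le_sqrt (hn : 0 < n) (hp : ip ≤ 1) (hr : ir ≤ 1)
    (hpqr : 2 * iq = ip + ir) {k : ℕ} {σ : ℝ} (hσ0 : 0 < σ) (hσ1 : σ ≤ 1) (hm1 : 1 ≤ k + σ)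
    (hm2 : k + σ ≤ 1 - n * iq) (hne : ¬ (k + σ = 2 - n * ip ∧ k + σ = -(n * ir))) :
    ∃ C : ℝ, 0 ≤ C ∧ ∀ {u : EuclideanSpace ℝ (Fin n) → ℝ}, IsTest u →
      ∀ l : List (Fin n), l.length = k → ∀ x y,
        |listDeriv l u x - listDeriv l u y| ≤
          C * √((xNormD 2 ip u).toReal * (xNormD 0 ir u).toReal) * ‖x - y‖ ^ σ := by
  set M := max (2 + holderOrder n ip) (0 + holderOrder n ir) + 1
  obtain ⟨CA, hCA0, hCA⟩ := exists_specBound hn 2 hp (M := M)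
    (Nat.lt_succ_of_le (le_max_left _ _)) (k + 1)
  obtain ⟨CB, hCB0, hCB⟩ := exists_specBound hn 0 hr (M := M)
    (Nat.lt_succ_of_le (le_max_right _ _)) (k + 1)
  have hlA := lowOrder_le (n := n) (d := 2) (μ := ip)
  have hlB := lowOrder_le (n := n) (d := 0) (μ := ir)
  have hsum : (n : ℝ) * ip + n * ir = 2 * (n * iq) := by rw [← mul_add, ← hpqr]; ring
  push_cast at hlA hlB
  obtain ⟨C, hC0, hC⟩ := exists_tsum_le_sqrt_of_Icc (m := k + σ)
    (lowOrder_le_top (n := n) (d := 2) (μ := ip)) (lowOrder_le_top (n := n) (d := 0) (μ := ir))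
    (by linarith) (by push_cast; linarith) (by linarith) (by push_cast; simpa using hne)
  refine ⟨C * ((2 + n) * √(CA * CB)), by positivity, fun {u} hu l hl x y => ?_⟩
  set A := (xNormD 2 ip u).toReal with hA
  set B := (xNormD 0 ir u).toReal with hB
  have hA0 : 0 ≤ A := ENNReal.toReal_nonneg
  have hB0 : 0 ≤ B := ENNReal.toReal_nonneg
  rcases eq_or_ne x y with rfl | hxy
  · simp [Real.zero_rpow hσ0.ne']
  have hr0 : 0 < ‖x - y‖ := norm_pos_iff.2 (sub_ne_zero.2 hxy)
  set w : ℝ := (2 + n) * ‖x - y‖ ^ σ with hw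
  have hw0 : 0 < w := by positivity
  have hdiv : ∀ {X κ : ℝ}, 0 ≤ X → SpecBound M (k + 1) κ X u → ∀ j : ℤ,
      |listDeriv l (dyBlock M j u) x - listDeriv l (dyBlock M j u) y| / w ≤
        2 ^ ((j : ℝ) * (k + σ - κ)) * X := by
    intro X κ hX h j
    rw [div_le_iff₀ hw0, mul_comm _ w]
    exact h.abs_sub_le hu hX hσ0.le hσ1 hl j hxy
  obtain ⟨hs, hle⟩ := hC (A := CA * A) (B := CB * B) (by positivity) (by positivity)
    (d := fun j => |listDeriv l (dyBlock M j u) x - listDeriv l (dyBlock M j u) y| / w)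
    (fun j => by positivity)
    (fun κ hκ => hdiv (by positivity) (hCA hu κ hκ))
    (fun κ hκ => hdiv (by positivity) (hCB hu κ hκ))
  have hs' := hs.mul_right w
  refine (abs_sub_le_tsum_of_dyBlock hn (hu.listDeriv l) hs' (M := M) fun j => ?_).trans ?_
  · rw [listDeriv_dyBlock hu, div_mul_cancel₀ _ hw0.ne']
  · rw [tsum_mul_right]
    refine (mul_le_mul_of_nonneg_right hle hw0.le).trans_eq ?_
    have : √(CA * A * (CB * B)) = √(CA * CB) * √(A * B) := by
      rw [← Real.sqrt_mul (by positivity)]; congr 1; ring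
    rw [this, hw]
    ring

/-- Morrey's inequality for the first derivatives of a function with second derivatives in
`L^p`. -/
theorem exists_holder_partialDeriv_le (hn : 0 < n) (h0 : 0 < ip) (hp : ip ≤ 1)
    (h1 : n * ip < 1) :
    ∃ C : ℝ, 0 ≤ C ∧ ∀ {u : EuclideanSpace ℝ (Fin n) → ℝ}, IsTest u → ∀ i x y,
      |partialDeriv i u x - partialDeriv i u y| ≤
        C * (xNormD 2 ip u).toReal * ‖x - y‖ ^ (1 - n * ip) := by
  have hnip : 0 < (n : ℝ) * ip := by positivity
  set σ := 1 - n * ip with hσ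
  obtain ⟨CA, hCA0, hCA⟩ := exists_specBound hn 2 hp (M := 2 + holderOrder n ip + 1)
    (Nat.lt_succ_self _) 2
  set M := 2 + holderOrder n ip + 1
  have hσ0 : 0 < σ := by linarith
  have hσ1 : 0 < 1 - σ := by linarith
  obtain ⟨C, hC0, hC⟩ := exists_tsum_le_of_pos hσ1 hσ0
  refine ⟨C * ((2 + n) * CA), by positivity, fun {u} hu i x y => ?_⟩
  set A := (xNormD 2 ip u).toReal with hA
  have hA0 : 0 ≤ A := ENNReal.toReal_nonneg
  rcases eq_or_ne x y with rfl | hxy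
  · simp [Real.zero_rpow hσ0.ne']
  have hr0 : 0 < ‖x - y‖ := norm_pos_iff.2 (sub_ne_zero.2 hxy)
  set r := ‖x - y‖ with hr
  have hsb : SpecBound M 2 (1 + σ) (CA * A) u := by
    refine hCA hu _ ⟨?_, ?_⟩
    · rw [lowOrder, if_pos h0.le]; push_cast; linarith
    · push_cast; linarith
  -- A single datum serves twice: τ = 1 gives a majorant increasing in j and τ = 0 a decreasing one.
  -- Their crossing produces the power σ of the distance.
  have hb := fun (τ : ℝ) (hτ0 : 0 ≤ τ) (hτ1 : τ ≤ 1) (j : ℤ) =>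
    hsb.abs_sub_le (k := 1) hu (by positivity) hτ0 hτ1 (l := [i]) rfl j hxy
  obtain ⟨hs, hle⟩ := hC (A₁ := (2 + n) * r * (CA * A)) (A₂ := (2 + n) * (CA * A))
    (by positivity) (by positivity)
    (d := fun j => |listDeriv [i] (dyBlock M j u) x - listDeriv [i] (dyBlock M j u) y|)
    (fun j => abs_nonneg _)
    (fun j => by
      refine (hb 1 zero_le_one le_rfl j).trans_eq ?_
      rw [Real.rpow_one]
      have e : ((1 : ℕ) : ℝ) + 1 - (1 + σ) = 1 - σ := by push_cast; ring
      rw [e]; ring)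
    (fun j => by
      refine (hb 0 le_rfl zero_le_one j).trans_eq ?_
      rw [Real.rpow_zero]
      have e : (j : ℝ) * (((1 : ℕ) : ℝ) + 0 - (1 + σ)) = -(j * σ) := by push_cast; ring
      rw [e]; ring)
  refine (abs_sub_le_tsum_of_dyBlock hn (hu.partialDeriv i) hs (M := M) fun j => ?_).trans
    (hle.trans_eq ?_)
  · exact le_of_eq (by rw [listDeriv_dyBlock hu]; rfl)
  · have e : 1 - σ + σ = 1 := by ring
    rw [e, div_one, div_one, mul_right_comm, Real.mul_rpow (by positivity) hr0.le, mul_right_comm,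
      ← Real.rpow_add_of_nonneg (by positivity) hσ0.le hσ1.le]
    have e' : σ + (1 - σ) = 1 := by ring
    rw [e', Real.rpow_one]
    ring

end UniformBounds

end GagNir

namespace GagNir

/-! ### Hölder and L^∞ targets -/

section NegativeTarget

variable {n : ℕ} {ip iq ir : ℝ}

theorem holderOrder_of_sub_one (hn : 0 < n) {μ ν : ℝ} (hμ : μ < 0) (hν : ν < 0)
    (h : n * ν = n * μ - 1) :
    holderOrder n ν = holderOrder n μ + 1 ∧ holderExponent n ν = holderExponent n μ := by
  have h1 := holderOrder_eq hn hμ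
  have h2 := holderOrder_eq hn hν
  have h3 : ⌊(n : ℝ) * ν + 1⌋ = ⌊(n : ℝ) * μ + 1⌋ - 1 := by
    rw [h, ← Int.floor_sub_one]
    congr 1
    ring
  have h4 : holderOrder n ν = holderOrder n μ + 1 := by omega
  refine ⟨h4, ?_⟩
  unfold holderExponent
  rw [h4, h]
  push_cast
  ring

theorem le_sqrt_mul {t X Y : ℝ} (ht : 0 ≤ t) (hX : t ≤ X) (hY : t ≤ Y) : t ≤ √(X * Y) :=
  Real.le_sqrt_of_sq_le (by rw [sq]; exact mul_le_mul hX hY ht (ht.trans hX))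

/-- The top order Hölder seminorm when both data have the order of the target. -/
theorem exists_holder_listDeriv_le_sqrt_of_eq (hn : 0 < n) (hp : ip ≤ 1) (hq : iq < 0)
    (h1 : n * ip = 1 + n * iq) (h2 : n * ir = n * iq - 1) :
    ∃ C : ℝ, 0 ≤ C ∧ ∀ {u : EuclideanSpace ℝ (Fin n) → ℝ}, IsTest u →
      ∀ l : List (Fin n), l.length = holderOrder n iq + 1 → ∀ x y,
        |listDeriv l u x - listDeriv l u y| ≤
          C * √((xNormD 2 ip u).toReal * (xNormD 0 ir u).toReal) *
            ‖x - y‖ ^ holderExponent n iq := by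
  have hn' : (0 : ℝ) < n := by exact_mod_cast hn
  have hnq : n * iq < 0 := mul_neg_of_pos_of_neg hn' hq
  have hr : ir < 0 := by
    by_contra h
    have : 0 ≤ n * ir := mul_nonneg hn'.le (not_lt.1 h)
    linarith
  obtain ⟨hB1, hB2⟩ := holderOrder_of_sub_one hn hq hr h2
  obtain ⟨C, hC0, hC⟩ : ∃ C : ℝ, 0 ≤ C ∧ ∀ {u : EuclideanSpace ℝ (Fin n) → ℝ}, IsTest u →
      ∀ l : List (Fin n), l.length = holderOrder n iq + 1 → ∀ x y,
        |listDeriv l u x - listDeriv l u y| ≤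
          C * (xNormD 2 ip u).toReal * ‖x - y‖ ^ holderExponent n iq := by
    -- For 1/p < 0 the seminorm is part of the norm of the second derivatives. For 1/p ≥ 0 the
    -- target has p₁ = 0, and its seminorm comes from bounded second derivatives (1/p = 0) or from
    -- Morrey's inequality.
    rcases lt_or_ge ip 0 with hip | hip
    · obtain ⟨hA1, hA2⟩ := holderOrder_of_sub_one hn (μ := ip) hip hq (by linarith)
      refine ⟨1, zero_le_one, fun {u} hu l hl x y => ?_⟩
      rw [one_mul, hA2]
      exact holder_listDeriv_le_of_neg hn hu hip (by omega) x y
    · have hnp : 0 ≤ n * ip := mul_nonneg hn'.le hip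
      have hk : holderOrder n iq = 0 := by
        have e := holderOrder_eq hn hq
        have : ⌊(n : ℝ) * iq + 1⌋ = 0 := by
          rw [Int.floor_eq_zero_iff]; constructor <;> linarith
        omega
      have hσ : holderExponent n iq = 1 - n * ip := by
        rw [holderExponent, hk]; push_cast; linarith
      rw [hk, hσ]
      rcases hip.eq_or_lt with h0 | h0
      · refine ⟨n, hn'.le, fun {u} hu l hl x y => ?_⟩
        obtain ⟨i, rfl⟩ := List.length_eq_one_iff.1 hl
        rw [← h0, mul_zero, sub_zero, Real.rpow_one]
        refine abs_sub_le_of_partialDeriv_le (hu.partialDeriv i).differentiable (fun j z => ?_) x y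
        have := eLpNorm_listDeriv_le_of_nonneg hn hu (d := 2) (μ := 0) le_rfl (l := [j, i]) rfl
        rw [if_neg (lt_irrefl _)] at this
        exact (hu.listDeriv [j, i]).abs_le_of_eLpNorm_top_le ENNReal.toReal_nonneg this z
      · obtain ⟨C, hC0, hC⟩ := exists_holder_partialDeriv_le hn h0 hp (by linarith)
        refine ⟨C, hC0, fun {u} hu l hl x y => ?_⟩
        obtain ⟨i, rfl⟩ := List.length_eq_one_iff.1 hl
        exact hC hu i x y
  refine ⟨√C, by positivity, fun {u} hu l hl x y => ?_⟩
  set A := (xNormD 2 ip u).toReal with hA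
  set B := (xNormD 0 ir u).toReal with hB
  have hA0 : 0 ≤ A := ENNReal.toReal_nonneg
  have hB0 : 0 ≤ B := ENNReal.toReal_nonneg
  have hBb := holder_listDeriv_le_of_neg hn hu hr (d := 0) (l := l) (by omega) x y
  rw [hB2] at hBb
  refine (le_sqrt_mul (abs_nonneg _) (hC hu l hl x y) hBb).trans_eq ?_
  set w := ‖x - y‖ ^ holderExponent n iq with hw
  have hw0 : 0 ≤ w := by positivity
  have : C * A * w * (B * w) = C * (A * B) * w ^ 2 := by ring
  rw [this, Real.sqrt_mul (by positivity), Real.sqrt_sq hw0, Real.sqrt_mul hC0]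

/-- The interpolation inequality when the target is a Hölder space. -/
theorem exists_xNorm_partialDeriv_le_of_neg (hn : 0 < n) (hp : ip ≤ 1) (hr : ir ≤ 1)
    (hpqr : 2 * iq = ip + ir) (hq : iq < 0) :
    ∃ C : ℝ, 0 ≤ C ∧ ∀ {u : EuclideanSpace ℝ (Fin n) → ℝ}, IsTest u → ∀ i,
      xNorm iq (partialDeriv i u) ≤
        ENNReal.ofReal (C * √((xNormD 2 ip u).toReal * (xNormD 0 ir u).toReal)) := by
  obtain ⟨hσ0, hσ1⟩ := holderExponent_mem hn hq
  have hkσ := holderOrder_add_holderExponent n iq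
  set k := holderOrder n iq with hk
  set σ := holderExponent n iq with hσ
  have hsum : (n : ℝ) * ip + n * ir = 2 * (n * iq) := by rw [← mul_add, ← hpqr]; ring
  have hk0 : (0 : ℝ) ≤ k := by positivity
  have hsup : ∀ m : Fin (k + 1), ∃ C : ℝ, 0 ≤ C ∧
      ∀ {u : EuclideanSpace ℝ (Fin n) → ℝ}, IsTest u →
      ∀ l : List (Fin n), l.length = m + 1 → ∀ x,
        |listDeriv l u x| ≤ C * √((xNormD 2 ip u).toReal * (xNormD 0 ir u).toReal) := by
    intro m
    have hm : (m : ℝ) ≤ k := by exact_mod_cast Nat.lt_succ_iff.1 m.2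
    refine exists_abs_listDeriv_le_sqrt hn hp hr hpqr (Nat.le_add_left 1 _) ?_ ?_
    · push_cast; linarith
    -- Equality of both orders would force m + 1 = 1 - n/q = k + σ + 1, impossible since m ≤ k and σ
    -- > 0; only the top seminorm can be critical.
    · rintro ⟨h1, h2⟩; push_cast at h1 h2; linarith
  choose C₁ hC10 hC1 using hsup
  obtain ⟨C₂, hC20, hC2⟩ : ∃ C : ℝ, 0 ≤ C ∧ ∀ {u : EuclideanSpace ℝ (Fin n) → ℝ}, IsTest u →
      ∀ l : List (Fin n), l.length = k + 1 → ∀ x y, |listDeriv l u x - listDeriv l u y| ≤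
        C * √((xNormD 2 ip u).toReal * (xNormD 0 ir u).toReal) * ‖x - y‖ ^ σ := by
    by_cases hne : ((k + 1 : ℕ) : ℝ) + σ = 2 - n * ip ∧ ((k + 1 : ℕ) : ℝ) + σ = -(n * ir)
    · obtain ⟨h1, h2⟩ := hne
      push_cast at h1 h2
      exact exists_holder_listDeriv_le_sqrt_of_eq hn hp hq (by linarith) (by linarith)
    · exact exists_holder_listDeriv_le_sqrt hn hp hr hpqr hσ0 hσ1
        (by push_cast; linarith) (by push_cast; linarith) hne
  have hS0 : 0 ≤ ∑ m, C₁ m := Finset.sum_nonneg fun m _ => hC10 m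
  refine ⟨((multiIndices n k).card + 1 : ℕ) * (∑ m, C₁ m + C₂), by positivity,
    fun {u} hu i => ?_⟩
  set G := √((xNormD 2 ip u).toReal * (xNormD 0 ir u).toReal) with hG
  have hG0 : 0 ≤ G := Real.sqrt_nonneg _
  rw [xNorm, if_neg (by linarith), if_neg hq.ne, mul_assoc, ENNReal.ofReal_mul (by positivity),
    ENNReal.ofReal_natCast]
  refine holderNorm_le (fun l hl x => ?_) fun l hl x y => ?_
  · have := hC1 ⟨l.length, Nat.lt_succ_of_le hl⟩ hu (l ++ [i]) (by simp) x
    rw [listDeriv_append] at this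
    refine this.trans (mul_le_mul_of_nonneg_right ?_ hG0)
    have := Finset.single_le_sum (f := C₁) (fun m _ => hC10 m)
      (Finset.mem_univ ⟨l.length, Nat.lt_succ_of_le hl⟩)
    linarith
  · have := hC2 hu (l ++ [i]) (by simp [hl, hk]) x y
    rw [listDeriv_append] at this
    refine this.trans ?_
    have h3 : C₂ ≤ ∑ m, C₁ m + C₂ := by linarith
    have : C₂ * G ≤ (∑ m, C₁ m + C₂) * G := mul_le_mul_of_nonneg_right h3 hG0
    exact mul_le_mul_of_nonneg_right this (by positivity)

/-- The interpolation inequality when the target is `L^∞` and the orders are not critical. -/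
theorem exists_xNorm_partialDeriv_le_of_zero (hn : 0 < n) (hp : ip ≤ 1) (hr : ir ≤ 1)
    (hpr : ip + ir = 0) (hne : n * ip ≠ 1) :
    ∃ C : ℝ, 0 ≤ C ∧ ∀ {u : EuclideanSpace ℝ (Fin n) → ℝ}, IsTest u → ∀ i,
      xNorm 0 (partialDeriv i u) ≤
        ENNReal.ofReal (C * √((xNormD 2 ip u).toReal * (xNormD 0 ir u).toReal)) := by
  obtain ⟨C, hC0, hC⟩ := exists_abs_listDeriv_le_sqrt (iq := 0) hn hp hr (by linarith)
    (m := 1) le_rfl (by simp) (by rintro ⟨h1, -⟩; apply hne; push_cast at h1; linarith)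
  refine ⟨C, hC0, fun {u} hu i => ?_⟩
  rw [xNorm, if_neg (lt_irrefl _), if_pos rfl]
  exact eLpNorm_top_le_of_abs_le (hC hu [i] rfl)

end NegativeTarget

end GagNir

namespace GagNir

/-! ### Lebesgue target, one Hölder datum, different orders -/

section LebesgueTarget

variable {n : ℕ}

/-- Log-convexity of Lebesgue norms, with L^∞ as one endpoint. -/
theorem eLpNorm_le_of_eLpNorm_le_of_abs_le {f : EuclideanSpace ℝ (Fin n) → ℝ} (hf : IsTest f)
    {μ ν a b : ℝ} (hν : 0 < ν) (hνμ : ν ≤ μ) (ha : 0 ≤ a)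
    (h1 : eLpNorm f (ENNReal.ofReal (1 / μ)) volume ≤ ENNReal.ofReal a) (h2 : ∀ x, |f x| ≤ b) :
    eLpNorm f (ENNReal.ofReal (1 / ν)) volume ≤
      ENNReal.ofReal (a ^ (ν / μ) * b ^ (1 - ν / μ)) := by
  have hμ : 0 < μ := hν.trans_le hνμ
  have hb : 0 ≤ b := (abs_nonneg _).trans (h2 0)
  have e : ∀ {τ : ℝ}, 0 < τ → eLpNorm f (ENNReal.ofReal (1 / τ)) volume =
      (∫⁻ x, ‖f x‖ₑ ^ (1 / τ)) ^ τ := by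
    intro τ hτ
    rw [eLpNorm_eq_lintegral_rpow_enorm_toReal (by simpa using hτ) ENNReal.ofReal_ne_top,
      ENNReal.toReal_ofReal (by positivity), one_div_one_div]
  rw [e hμ] at h1
  rw [e hν]
  have hle : (1 : ℝ) / μ ≤ 1 / ν := one_div_le_one_div_of_le hν hνμ
  have hθ : 0 ≤ 1 - ν / μ := by rw [sub_nonneg, div_le_one hμ]; exact hνμ
  have h3 : ∫⁻ x, ‖f x‖ₑ ^ (1 / ν) ≤
      ENNReal.ofReal b ^ (1 / ν - 1 / μ) * ∫⁻ x, ‖f x‖ₑ ^ (1 / μ) := by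
    rw [← lintegral_const_mul _ (hf.continuous.measurable.enorm.pow_const _)]
    refine lintegral_mono fun x => ?_
    have : (1 : ℝ) / ν = (1 / ν - 1 / μ) + 1 / μ := by ring
    conv_lhs => rw [this, ENNReal.rpow_add_of_nonneg _ _ (by linarith) (by positivity)]
    gcongr
    rw [Real.enorm_eq_ofReal_abs]
    exact ENNReal.ofReal_le_ofReal (h2 x)
  have h4 : ∫⁻ x, ‖f x‖ₑ ^ (1 / μ) ≤ ENNReal.ofReal a ^ (1 / μ) := by
    have := ENNReal.rpow_le_rpow h1 (z := 1 / μ) (by positivity)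
    rwa [← ENNReal.rpow_mul, mul_one_div_cancel hμ.ne', ENNReal.rpow_one] at this
  calc _ ≤ (ENNReal.ofReal b ^ (1 / ν - 1 / μ) * ENNReal.ofReal a ^ (1 / μ)) ^ ν := by
        gcongr
        exact h3.trans (by gcongr)
    _ = _ := by
        rw [ENNReal.mul_rpow_of_nonneg _ _ hν.le, ← ENNReal.rpow_mul, ← ENNReal.rpow_mul,
          ENNReal.ofReal_mul (by positivity), ← ENNReal.ofReal_rpow_of_nonneg ha (by positivity),
          ← ENNReal.ofReal_rpow_of_nonneg hb hθ, mul_comm]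
        have e1 : 1 / μ * ν = ν / μ := by ring
        have e2 : (1 / ν - 1 / μ) * ν = 1 - ν / μ := by
          rw [sub_mul, one_div_mul_cancel hν.ne', e1]
        rw [e1, e2]

set_option maxHeartbeats 1000000 in
/-- The interpolation inequality between a Lebesgue datum of order `d` and a Hölder datum of order
`d'`, for a Lebesgue target, when the orders of the data differ. -/
theorem exists_eLpNorm_partialDeriv_le_of_ne (hn : 0 < n) {d d' : ℕ} (hd : d + d' = 2)
    {μ ν τ : ℝ} (hμ0 : 0 < μ) (hμ1 : μ ≤ 1) (hν : ν < 0) (hτ0 : 0 < τ) (hτ : 2 * τ = μ + ν)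
    (hne : d - n * μ ≠ d' - n * ν) :
    ∃ C : ℝ, 0 ≤ C ∧ ∀ {u : EuclideanSpace ℝ (Fin n) → ℝ}, IsTest u → ∀ i,
      eLpNorm (partialDeriv i u) (ENNReal.ofReal (1 / τ)) volume ≤
        ENNReal.ofReal (C * √((xNormD d μ u).toReal * (xNormD d' ν u).toReal)) := by
  have hτμ : τ < μ := by linarith
  set θ := τ / μ with hθ
  have hθ0 : 0 < θ := by positivity
  have hθ2 : θ < 1 / 2 := by rw [hθ, div_lt_iff₀ hμ0]; linarith
  have hθμ : θ * μ = τ := by rw [hθ, div_mul_cancel₀ _ hμ0.ne']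
  set M := max (d + holderOrder n μ) (d' + holderOrder n ν) + 1
  obtain ⟨CE, hCE0, hCE⟩ := exists_specBound hn d hμ1 (M := M)
    (Nat.lt_succ_of_le (le_max_left _ _)) 1
  obtain ⟨CF, hCF0, hCF⟩ := exists_specBound hn d' (by linarith : ν ≤ 1) (M := M)
    (Nat.lt_succ_of_le (le_max_right _ _)) 1
  have hμexp := one_le_exponent hμ1
  rw [if_pos hμ0] at hμexp
  obtain ⟨CL, hCL0, hCL⟩ := exists_eLpNorm_dyBlock_le (n := n) hμexp (M := M) (k := d)
    ((Nat.le_add_right _ _).trans ((le_max_left _ _).trans (Nat.le_succ _))) 1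
  have hd' : (d : ℝ) + d' = 2 := by exact_mod_cast hd
  set Δ := (d' : ℝ) - n * ν - (d - n * μ) with hΔ
  have hΔ0 : Δ ≠ 0 := fun h => hne (by linarith)
  -- Growth exponents of the blocks in the target norm, with weight θ on the Lebesgue norm and 1 - θ
  -- on the supremum: in `e₁` the supremum is controlled by the Hölder datum, in `e₂` by the
  -- Lebesgue datum.
  set e₁ := (1 - (d : ℝ)) * θ + (1 - (d' - n * ν)) * (1 - θ) with he1
  set e₂ := (1 - (d : ℝ)) * θ + (1 - (d - n * μ)) * (1 - θ) with he2
  have he2' : e₂ = Δ / 2 := by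
    have : n * μ * θ = n * τ := by rw [← hθμ]; ring
    have h2 : 2 * ((n : ℝ) * τ) = n * μ + n * ν := by rw [← mul_add, ← hτ]; ring
    rw [he2, hΔ]
    linarith
  have he12 : e₂ - e₁ = Δ * (1 - θ) := by rw [he1, he2, hΔ]; ring
  have he1' : e₁ = Δ * (θ - 1 / 2) := by linarith
  -- As ν < 0 forces θ < 1/2, the values e₁ = Δ(θ - 1/2) and e₂ = Δ/2 have opposite signs, whatever
  -- the sign of Δ.
  have hsign : 0 < e₁ * (-e₂) := by
    have : e₁ * (-e₂) = Δ ^ 2 * ((1 / 2 - θ) / 2) := by rw [he1', he2']; ring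
    rw [this]
    have : 0 < 1 / 2 - θ := by linarith
    positivity
  obtain ⟨C, hC0, hC⟩ := exists_tsum_le hsign
  refine ⟨C * √((CE + CL) * CF), by positivity, fun {u} hu i => ?_⟩
  set E := (xNormD d μ u).toReal with hE
  set F := (xNormD d' ν u).toReal with hF
  have hE0 : 0 ≤ E := ENNReal.toReal_nonneg
  have hF0 : 0 ≤ F := ENNReal.toReal_nonneg
  set E' := (CE + CL) * E with hE'
  set F' := CF * F with hF'
  have hE'0 : 0 ≤ E' := by positivity
  have hF'0 : 0 ≤ F' := by positivity
  have hsE : SpecBound M 1 (d - n * μ) E' u :=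
    (hCE hu _ ⟨lowOrder_le_top, le_rfl⟩).mono (by rw [hE']; nlinarith)
  have hsF : SpecBound M 1 (d' - n * ν) F' u := hCF hu _ ⟨lowOrder_le_top, le_rfl⟩
  have hL : ∀ j : ℤ, eLpNorm (listDeriv [i] (dyBlock M j u)) (ENNReal.ofReal (1 / μ)) volume ≤
      ENNReal.ofReal (2 ^ ((j : ℝ) * (1 - d)) * E') := by
    intro j
    have h1 : ∀ l : List (Fin n), l.length = d →
        eLpNorm (listDeriv l u) (ENNReal.ofReal (1 / μ)) volume ≤ ENNReal.ofReal E := by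
      intro l hl
      have := eLpNorm_listDeriv_le_of_nonneg hn hu hμ0.le hl
      rwa [if_pos hμ0] at this
    have h2 := hCL hu hE0 h1 [i] (by simp) j
    rw [List.length_singleton, Nat.cast_one] at h2
    refine h2.trans (ENNReal.ofReal_le_ofReal ?_)
    have hp : (0 : ℝ) ≤ 2 ^ ((j : ℝ) * (1 - d)) := by positivity
    have hle : CL * E ≤ E' := by
      rw [hE']
      exact mul_le_mul_of_nonneg_right (by linarith) hE0
    exact (le_of_eq (by ring)).trans (mul_le_mul_of_nonneg_left hle hp)
  have hcomb : ∀ {X γ : ℝ}, 0 ≤ X → ∀ j : ℤ,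
      (∀ x, |listDeriv [i] (dyBlock M j u) x| ≤ 2 ^ ((j : ℝ) * γ) * X) →
      eLpNorm (listDeriv [i] (dyBlock M j u)) (ENNReal.ofReal (1 / τ)) volume ≤
        ENNReal.ofReal (2 ^ ((j : ℝ) * ((1 - d) * θ + γ * (1 - θ))) *
          (E' ^ θ * X ^ (1 - θ))) := by
    intro X γ hX j h
    refine (eLpNorm_le_of_eLpNorm_le_of_abs_le ((hu.dyBlock M j).listDeriv [i]) hτ0 hτμ.le
      (by positivity) (hL j) h).trans_eq ?_
    rw [← hθ, Real.mul_rpow (by positivity) hE'0, Real.mul_rpow (by positivity) hX,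
      ← Real.rpow_mul (by norm_num), ← Real.rpow_mul (by norm_num), mul_mul_mul_comm,
      ← Real.rpow_add (by norm_num)]
    congr 3
    ring
  set D : ℤ → ℝ := fun j =>
    (eLpNorm (listDeriv [i] (dyBlock M j u)) (ENNReal.ofReal (1 / τ)) volume).toReal with hD
  have hDtop : ∀ j, eLpNorm (listDeriv [i] (dyBlock M j u)) (ENNReal.ofReal (1 / τ)) volume ≠ ⊤ :=
    fun j => (((hu.dyBlock M j).listDeriv [i]).memLp _).2.ne
  have hbF : ∀ j : ℤ, D j ≤ 2 ^ ((j : ℝ) * e₁) * (E' ^ θ * F' ^ (1 - θ)) := by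
    intro j
    refine ENNReal.toReal_le_of_le_ofReal (by positivity) (hcomb hF'0 j fun x => ?_)
    have := hsF [i] le_rfl j x
    simpa using this
  have hbE : ∀ j : ℤ, D j ≤ 2 ^ (-((j : ℝ) * -e₂)) * E' := by
    intro j
    refine ENNReal.toReal_le_of_le_ofReal (by positivity)
      ((hcomb hE'0 j (γ := 1 - (d - n * μ)) fun x => ?_).trans_eq ?_)
    · have := hsE [i] le_rfl j x
      simpa using this
    · rw [← Real.rpow_add_of_nonneg hE'0 hθ0.le (by linarith), mul_neg, neg_neg]
      congr 2
      rw [add_sub_cancel, Real.rpow_one]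
  obtain ⟨hs, hle⟩ := hC (by positivity) hE'0 (fun j => ENNReal.toReal_nonneg) hbF hbE
  have hτ1 : 1 ≤ ENNReal.ofReal (1 / τ) := by
    have := one_le_exponent (hτμ.le.trans hμ1)
    rwa [if_pos hτ0] at this
  refine (eLpNorm_le_tsum_of_dyBlock hn (hu.partialDeriv i) hs (fun j => ENNReal.toReal_nonneg)
    (M := M) hτ1 fun j => ?_).trans (ENNReal.ofReal_le_ofReal (hle.trans_eq ?_))
  · rw [ENNReal.ofReal_toReal (hDtop j), listDeriv_dyBlock hu]
    exact le_rfl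
  · have hden : e₁ + -e₂ = -(Δ * (1 - θ)) := by linarith
    have h1θ : 1 - θ ≠ 0 := by intro h; linarith
    have x1 : -e₂ / (e₁ + -e₂) = 1 / (2 * (1 - θ)) := by
      rw [hden, he2']; field_simp
    have x2 : e₁ / (e₁ + -e₂) = (1 / 2 - θ) / (1 - θ) := by
      rw [hden, he1']; field_simp; ring
    rw [x1, x2, Real.mul_rpow (by positivity) (by positivity), ← Real.rpow_mul hE'0,
      ← Real.rpow_mul hF'0, mul_right_comm, ← Real.rpow_add_of_nonneg hE'0
      (mul_nonneg hθ0.le (by apply div_nonneg zero_le_one; linarith))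
      (by apply div_nonneg <;> linarith)]
    have x3 : θ * (1 / (2 * (1 - θ))) + (1 / 2 - θ) / (1 - θ) = 1 / 2 := by
      field_simp; ring
    have x4 : (1 - θ) * (1 / (2 * (1 - θ))) = 1 / 2 := by field_simp
    rw [x3, x4, rpow_half_mul_rpow_half hE'0, mul_assoc C, ← Real.sqrt_mul (by positivity)]
    congr 2
    rw [hE', hF']
    ring

end LebesgueTarget

end GagNir

namespace GagNir

/-! ### Truncation: weak type bound and Doob inequality -/

section Truncation

/-- A Doob type inequality: a weak bound of `F` by the excess of `g` over the level gives a strong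
bound. -/
theorem lintegral_rpow_le_of_meas_lt_le {α : Type*} [MeasurableSpace α] {μ : Measure α} [SFinite μ]
    {F g : α → ℝ} (hF : Measurable F) (hF0 : ∀ x, 0 ≤ F x) (hg : Measurable g) (hg0 : ∀ x, 0 ≤ g x)
    {p : ℝ} (hp : 1 < p)
    (h : ∀ t, 0 < t → μ {x | t < F x} ≤
      ENNReal.ofReal t⁻¹ * ∫⁻ x in {x | t < g x}, ENNReal.ofReal (g x) ∂μ) :
    ∫⁻ x, ENNReal.ofReal (F x ^ p) ∂μ ≤
      ENNReal.ofReal (p / (p - 1)) * ∫⁻ x, ENNReal.ofReal (g x ^ p) ∂μ := by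
  have hp0 : 0 < p := by linarith
  have hp1 : 0 < p - 1 := by linarith
  rw [lintegral_rpow_eq_lintegral_meas_lt_mul μ (.of_forall hF0) hF.aemeasurable hp0]
  have hms : ∀ t, MeasurableSet {x | t < g x} := fun t => measurableSet_lt measurable_const hg
  set K : ℝ → α → ℝ≥0∞ := fun t x =>
    ENNReal.ofReal (t ^ (p - 2)) * Set.indicator {x | t < g x} (fun x => ENNReal.ofReal (g x)) x
    with hK
  have hKm : Measurable (Function.uncurry K) := by
    have e : Function.uncurry K = fun q : ℝ × α => ENNReal.ofReal (q.1 ^ (p - 2)) *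
        Set.indicator {q : ℝ × α | q.1 < g q.2} (fun q => ENNReal.ofReal (g q.2)) q := by
      ext ⟨t, x⟩
      simp [K, Set.indicator]
    rw [e]
    refine (by fun_prop : Measurable fun q : ℝ × α => ENNReal.ofReal (q.1 ^ (p - 2))).mul ?_
    exact (hg.comp measurable_snd).ennreal_ofReal.indicator
      (measurableSet_lt measurable_fst (hg.comp measurable_snd))
  have h1 : ∫⁻ t in Set.Ioi 0, μ {x | t < F x} * ENNReal.ofReal (t ^ (p - 1)) ≤
      ∫⁻ t in Set.Ioi 0, ∫⁻ x, K t x ∂μ := by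
    refine setLIntegral_mono hKm.lintegral_prod_right' fun t ht => ?_
    have ht : 0 < t := ht
    rw [hK]
    dsimp only
    rw [lintegral_const_mul _ (hg.ennreal_ofReal.indicator (hms t)), lintegral_indicator (hms t)]
    refine (mul_le_mul_left (h t ht) _).trans_eq ?_
    rw [mul_right_comm, ← ENNReal.ofReal_mul (by positivity)]
    congr 2
    rw [← Real.rpow_neg_one, ← Real.rpow_add ht]
    congr 1
    ring
  have h2 : ∀ x, ∫⁻ t in Set.Ioi 0, K t x = ENNReal.ofReal ((p - 1)⁻¹) *
      ENNReal.ofReal (g x ^ p) := by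
    intro x
    have e : ∀ t ∈ Set.Ioi (0 : ℝ), K t x = (Set.Ioo 0 (g x)).indicator
        (fun t => ENNReal.ofReal (t ^ (p - 2) * g x)) t := by
      intro t ht
      have ht : 0 < t := ht
      by_cases hx : t < g x
      · simp [K, Set.indicator, hx, ht, ENNReal.ofReal_mul (Real.rpow_nonneg ht.le _)]
      · simp [K, Set.indicator, hx]
    rw [setLIntegral_congr_fun measurableSet_Ioi e, setLIntegral_indicator measurableSet_Ioo,
      Set.inter_eq_left.2 Set.Ioo_subset_Ioi_self, setLIntegral_congr Ioo_ae_eq_Ioc]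
    have hi : IntervalIntegrable (fun t => t ^ (p - 2) * g x) volume 0 (g x) :=
      (intervalIntegral.intervalIntegrable_rpow' (by linarith)).mul_const _
    rw [← ofReal_integral_eq_lintegral_ofReal hi.1, ← ENNReal.ofReal_mul (by positivity)]
    · rw [← intervalIntegral.integral_of_le (hg0 x), intervalIntegral.integral_mul_const,
        integral_rpow (Or.inl (by linarith))]
      congr 1
      rw [show p - 2 + 1 = p - 1 by ring, Real.zero_rpow hp1.ne', sub_zero]
      rcases (hg0 x).eq_or_lt with h0 | h0
      · rw [← h0, Real.zero_rpow hp0.ne']; simp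
      · rw [Real.rpow_sub_one h0.ne']
        field_simp
    · filter_upwards [ae_restrict_mem measurableSet_Ioc] with t ht
      exact mul_nonneg (Real.rpow_nonneg ht.1.le _) (hg0 x)
  calc _ ≤ ENNReal.ofReal p * ∫⁻ t in Set.Ioi 0, ∫⁻ x, K t x ∂μ := by gcongr
    _ = ENNReal.ofReal p * (ENNReal.ofReal ((p - 1)⁻¹) * ∫⁻ x, ENNReal.ofReal (g x ^ p) ∂μ) := by
        rw [lintegral_lintegral_swap hKm.aemeasurable, lintegral_congr h2,
          lintegral_const_mul _ (by fun_prop)]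
    _ = _ := by rw [← mul_assoc, ← ENNReal.ofReal_mul hp0.le, div_eq_mul_inv]

variable {n : ℕ}

theorem integral_partialDeriv {f : EuclideanSpace ℝ (Fin n) → ℝ} (hf : IsTest f)
    (i : Fin n) : ∫ x, partialDeriv i f x = 0 := by
  have h := integral_mul_fderiv_eq_neg_fderiv_mul_of_integrable (μ := volume)
    (f := fun _ : EuclideanSpace ℝ (Fin n) => (1 : ℝ)) (g := f) (v := EuclideanSpace.single i 1)
    (by simp) (by simpa using! (hf.partialDeriv i).integrable) (by simpa using hf.integrable)
    (fun _ _ => differentiableAt_const _) (fun x _ => hf.differentiable x)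
  simpa [partialDeriv] using h

/-- The derivative moves to the kernel at the price δ⁻¹. The new kernel has integral zero, so u(x)
may be subtracted, and the Hölder condition at distance δ gains δ^s. -/
theorem exists_abs_mollify_partialDeriv_le (n : ℕ) :
    ∃ C : ℝ, 0 < C ∧ ∀ {u : EuclideanSpace ℝ (Fin n) → ℝ}, IsTest u → ∀ {H s : ℝ}, 0 ≤ H → 0 < s →
      (∀ x y, |u x - u y| ≤ H * ‖x - y‖ ^ s) → ∀ (i : Fin n) {δ : ℝ}, 0 < δ → ∀ x,
        |mollify δ (partialDeriv i u) x| ≤ C * H * δ ^ (s - 1) := by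
  -- The summand 1 keeps the constant strictly positive, as the truncation estimate requires of `K`.
  refine ⟨1 + ∑ i : Fin n, ∫ z, |partialDeriv i (moll n) z|, ?_, ?_⟩
  · have : 0 ≤ ∑ i : Fin n, ∫ z, |partialDeriv i (moll n) z| :=
      Finset.sum_nonneg fun i _ => integral_nonneg fun z => abs_nonneg _
    linarith
  intro u hu H s hH hs h i δ hδ x
  have hm := isTest_moll (n := n)
  have e : mollify δ (partialDeriv i u) = δ⁻¹ • conv (dil δ (partialDeriv i (moll n))) u := by
    rw [mollify, ← partialDeriv_conv_right (hm.dil hδ) hu, partialDeriv_conv_left (hm.dil hδ) hu,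
      partialDeriv_dil hm, conv_smul_left]
  have hi1 : Integrable fun z => partialDeriv i (moll n) z * u (x - δ • z) :=
    Continuous.integrable_of_hasCompactSupport
      ((hm.partialDeriv i).continuous.mul (hu.continuous.comp (by fun_prop)))
      ((hm.partialDeriv i).compact.mul_right)
  have hi2 : Integrable fun z => partialDeriv i (moll n) z * u x :=
    (hm.partialDeriv i).integrable.mul_const _
  have e2 : conv (dil δ (partialDeriv i (moll n))) u x =
      ∫ z, partialDeriv i (moll n) z * (u (x - δ • z) - u x) := by
    simp only [mul_sub]
    rw [conv_dil_apply hδ, integral_sub hi1 hi2, integral_mul_const, integral_partialDeriv hm,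
      zero_mul, sub_zero]
  have hz : ∀ z, partialDeriv i (moll n) z ≠ 0 → ‖z‖ ≤ 1 := by
    intro z hz
    have h1 : z ∈ tsupport (moll n) := by
      refine tsupport_fderiv_subset ℝ (subset_tsupport _ fun h0 => hz ?_)
      simp [partialDeriv, h0]
    rw [moll, ContDiffBump.tsupport_normed_eq] at h1
    simpa using h1
  have e3 : |conv (dil δ (partialDeriv i (moll n))) u x| ≤
      (∫ z, |partialDeriv i (moll n) z|) * (H * δ ^ s) := by
    rw [e2, ← integral_mul_const]
    refine (abs_integral_le_integral_abs).trans (integral_mono_of_nonneg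
      (.of_forall fun z => abs_nonneg _) ((hm.partialDeriv i).integrable.abs.mul_const _)
      (.of_forall fun z => ?_))
    dsimp only
    rw [abs_mul]
    by_cases h0 : partialDeriv i (moll n) z = 0
    · simp [h0]
    refine mul_le_mul_of_nonneg_left ((h _ _).trans ?_) (abs_nonneg _)
    have : ‖x - δ • z - x‖ ≤ δ := by
      rw [sub_sub_cancel_left, norm_neg, norm_smul, Real.norm_of_nonneg hδ.le]
      have := hz z h0
      nlinarith
    gcongr
  rw [e, Pi.smul_apply, smul_eq_mul, abs_mul, abs_of_pos (inv_pos.2 hδ), Real.rpow_sub_one hδ.ne']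
  have hle : ∫ z, |partialDeriv i (moll n) z| ≤
      1 + ∑ i : Fin n, ∫ z, |partialDeriv i (moll n) z| := by
    have := Finset.single_le_sum (f := fun i : Fin n => ∫ z, |partialDeriv i (moll n) z|)
      (fun i _ => integral_nonneg fun z => abs_nonneg _) (Finset.mem_univ i)
    linarith
  calc _ ≤ δ⁻¹ * ((∫ z, |partialDeriv i (moll n) z|) * (H * δ ^ s)) := by gcongr
    _ ≤ δ⁻¹ * ((1 + ∑ i : Fin n, ∫ z, |partialDeriv i (moll n) z|) * (H * δ ^ s)) := by gcongr
    _ = _ := by rw [div_eq_mul_inv]; ring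

/-- The weak type bound behind the truncation argument. -/
theorem meas_lt_abs_le {f : EuclideanSpace ℝ (Fin n) → ℝ} (hf : IsTest f) {t δ : ℝ} (ht : 0 < t)
    (hδ : 0 < δ) (h : ∀ x, |mollify δ f x| ≤ 2 * t * δ) :
    volume {x | 4 * t * δ < |f x|} ≤ ENNReal.ofReal t⁻¹ *
      ∫⁻ x in {x | t < (gradSum f x).toReal}, ENNReal.ofReal (gradSum f x).toReal := by
  have hgm : Measurable (gradSum f) := hf.measurable_gradSum
  have hfin : ∀ x, gradSum f x ≠ ⊤ := fun x =>
    ENNReal.sum_ne_top.2 fun i _ => enorm_ne_top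
  simp only [ENNReal.ofReal_toReal (hfin _)]
  have hS : MeasurableSet {x | t < (gradSum f x).toReal} :=
    measurableSet_lt measurable_const hgm.ennreal_toReal
  -- Only the gradient above the level `t` is kept; the part below contributes at most `t` to every
  -- average.
  set G := {x | t < (gradSum f x).toReal}.indicator (gradSum f) with hG
  have hGm : Measurable G := hgm.indicator hS
  have hle : ∀ x, gradSum f x ≤ ENNReal.ofReal t + G x := by
    intro x
    by_cases hx : t < (gradSum f x).toReal
    · rw [hG, Set.indicator_of_mem (by exact hx)]; exact le_add_self
    · refine le_add_right ?_
      rw [← ENNReal.ofReal_toReal (hfin x)]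
      exact ENNReal.ofReal_le_ofReal (not_lt.1 hx)
  set T := fun x => ∫⁻ p, G (x - (p.2 * δ) • p.1) ∂(segMeasure n) with hT
  have hTm : Measurable T := by
    have hm : Measurable fun q : EuclideanSpace ℝ (Fin n) × (EuclideanSpace ℝ (Fin n) × ℝ) =>
      G (q.1 - (q.2.2 * δ) • q.2.1) := hGm.comp (by fun_prop)
    exact hm.lintegral_prod_right'
  -- Where |f| exceeds 4tδ the mollification accounts for at most 2tδ, so the error is at least 2tδ.
  -- As it is at most δ(t + T), the average `T` of the kept part is at least `t`, and Markov's
  -- inequality applies.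
  have hsub : {x | 4 * t * δ < |f x|} ⊆ {x | ENNReal.ofReal t ≤ T x} := by
    intro x hx
    have hx : 4 * t * δ < |f x| := hx
    have h1 := enorm_mollErr_le_average hδ hf x
    have h2 : ∫⁻ p, gradSum f (x - (p.2 * δ) • p.1) ∂(segMeasure n) ≤ ENNReal.ofReal t + T x := by
      refine (lintegral_mono fun p => hle _).trans_eq ?_
      rw [lintegral_add_left measurable_const, lintegral_const, segMeasure_univ, mul_one]
    have h3 : 2 * t * δ ≤ |mollErr δ f x| := by
      have h4 : |f x| ≤ |mollErr δ f x| + |mollify δ f x| := by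
        have : f x = mollErr δ f x + mollify δ f x := by simp [mollErr]
        conv_lhs => rw [this]
        exact abs_add_le _ _
      have := h x
      linarith
    by_contra hlt
    have hlt : T x < ENNReal.ofReal t := not_le.1 hlt
    have h5 : ENNReal.ofReal (2 * t * δ) < ENNReal.ofReal (2 * t * δ) := by
      calc ENNReal.ofReal (2 * t * δ) ≤ ‖mollErr δ f x‖ₑ := by
            rw [Real.enorm_eq_ofReal_abs]; exact ENNReal.ofReal_le_ofReal h3
        _ ≤ ENNReal.ofReal δ * (ENNReal.ofReal t + T x) := h1.trans (by gcongr)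
        _ < ENNReal.ofReal δ * (ENNReal.ofReal t + ENNReal.ofReal t) := by
            refine ENNReal.mul_lt_mul_right (by simpa using hδ) ENNReal.ofReal_ne_top ?_
            exact ENNReal.add_lt_add_left ENNReal.ofReal_ne_top hlt
        _ = _ := by
            rw [← ENNReal.ofReal_add ht.le ht.le, ← ENNReal.ofReal_mul hδ.le]
            congr 1; ring
    exact lt_irrefl _ h5
  have hTint : ∫⁻ x, T x ≤ ∫⁻ x, G x := by
    have := eLpNorm_lintegral_translate_le (segMeasure n)
      (Y := fun p : EuclideanSpace ℝ (Fin n) × ℝ => (p.2 * δ) • p.1) (by fun_prop) hGm le_rfl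
    rw [segMeasure_univ, one_mul] at this
    simpa [eLpNorm_one_eq_lintegral_enorm] using this
  calc _ ≤ volume {x | ENNReal.ofReal t ≤ T x} := measure_mono hsub
    _ ≤ (∫⁻ x, T x) / ENNReal.ofReal t :=
        meas_ge_le_lintegral_div hTm.aemeasurable (by simpa using ht) ENNReal.ofReal_ne_top
    _ ≤ (∫⁻ x, G x) / ENNReal.ofReal t := by gcongr
    _ = _ := by
        rw [hG, lintegral_indicator hS, ENNReal.div_eq_inv_mul, ENNReal.ofReal_inv_of_pos ht]

end Truncation

end GagNir

namespace GagNir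

/-! ### Lebesgue target at the Sobolev exponents -/

section Critical

variable {n : ℕ}

/-- The truncation estimate: `‖f‖_q ≤ C K^b ‖∇f‖_p^{1-b}` if the mollifications of `f` at scale `δ`
are at most `K δ^(s-1)`, where `b = 1/(2-s)` and `p = q (1-b)`. -/
theorem eLpNorm_le_of_abs_mollify_le {f : EuclideanSpace ℝ (Fin n) → ℝ} (hf : IsTest f)
    {K A s p : ℝ} (hK : 0 < K) (hA : 0 ≤ A) (hs1 : s < 1) (hp : 1 < p)
    (h : ∀ {δ : ℝ}, 0 < δ → ∀ x, |mollify δ f x| ≤ K * δ ^ (s - 1))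
    (hg : eLpNorm (gradSum f) (ENNReal.ofReal p) volume ≤ ENNReal.ofReal A) :
    eLpNorm f (ENNReal.ofReal (p * ((2 - s) / (1 - s)))) volume ≤
      ENNReal.ofReal (4 * (K / 2) ^ (1 / (2 - s)) *
        ((p / (p - 1)) ^ ((1 - s) / (2 - s) / p) * A ^ ((1 - s) / (2 - s)))) := by
  have h1s : 0 < 1 - s := by linarith
  have h2s : 0 < 2 - s := by linarith
  have hp0 : 0 < p := by linarith
  have hp1 : 0 < p - 1 := by linarith
  set b := 1 / (2 - s) with hb
  set a := (2 - s) / (1 - s) with ha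
  have ha0 : 0 < a := by positivity
  have hainv : (1 - s) / (2 - s) = a⁻¹ := by rw [ha, inv_div]
  have hab : 1 - b = a⁻¹ := by rw [← hainv, hb]; field_simp; ring
  set κ := 4 * (K / 2) ^ b with hκ
  have hκ0 : 0 < κ := by positivity
  have hfin : ∀ x, gradSum f x ≠ ⊤ := fun x => ENNReal.sum_ne_top.2 fun i _ => enorm_ne_top
  have hfm : Measurable f := hf.continuous.measurable
  have hweak : ∀ t, 0 < t → volume {x | t < (|f x| / κ) ^ a} ≤ ENNReal.ofReal t⁻¹ *
      ∫⁻ x in {x | t < (gradSum f x).toReal}, ENNReal.ofReal (gradSum f x).toReal := by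
    intro t ht
    -- The scale at which K δ^(s-1) = 2tδ. Then 4tδ = κ t^(1-b), so the level sets of |f| become
    -- those of (|f| / κ)^a.
    set δ := (K / (2 * t)) ^ b with hδ
    have hδ0 : 0 < δ := by positivity
    have hKδ : K * δ ^ (s - 1) = 2 * t * δ := by
      have e : δ ^ (2 - s) = K / (2 * t) := by
        rw [hδ, ← Real.rpow_mul (by positivity), hb, one_div_mul_cancel h2s.ne', Real.rpow_one]
      have e2 : δ ^ (s - 1) = δ / δ ^ (2 - s) := by
        rw [← Real.rpow_one_sub' hδ0.le (by linarith)]; congr 1; ring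
      rw [e2, e]
      field_simp
    refine le_trans (measure_mono fun x hx => ?_)
      (meas_lt_abs_le hf ht hδ0 fun x => (h hδ0 x).trans_eq hKδ)
    have hx : t < (|f x| / κ) ^ a := hx
    have h1 : t ^ a⁻¹ < |f x| / κ := by
      have := Real.rpow_lt_rpow ht.le hx (inv_pos.2 ha0)
      rwa [← Real.rpow_mul (by positivity), mul_inv_cancel₀ ha0.ne', Real.rpow_one] at this
    rw [lt_div_iff₀ hκ0] at h1
    refine lt_of_le_of_lt (le_of_eq ?_) h1
    have e3 : K / (2 * t) = K / 2 / t := by rw [div_div]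
    rw [hδ, hκ, ← hab, Real.rpow_sub ht, Real.rpow_one, e3, Real.div_rpow (by positivity) ht.le]
    ring
  have hmain := lintegral_rpow_le_of_meas_lt_le (μ := volume)
    (F := fun x => (|f x| / κ) ^ a) (g := fun x => (gradSum f x).toReal)
    (by fun_prop) (fun x => by positivity) hf.measurable_gradSum.ennreal_toReal
    (fun x => ENNReal.toReal_nonneg) hp hweak
  have hG : ∫⁻ x, ENNReal.ofReal ((gradSum f x).toReal ^ p) ≤ ENNReal.ofReal (A ^ p) := by
    have e : ∀ x, ENNReal.ofReal ((gradSum f x).toReal ^ p) = gradSum f x ^ p := fun x => by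
      rw [← ENNReal.ofReal_rpow_of_nonneg ENNReal.toReal_nonneg hp0.le,
        ENNReal.ofReal_toReal (hfin x)]
    rw [eLpNorm_eq_lintegral_rpow_enorm_toReal (by simpa using hp0) ENNReal.ofReal_ne_top,
      ENNReal.toReal_ofReal hp0.le] at hg
    have := ENNReal.rpow_le_rpow hg hp0.le
    rw [← ENNReal.rpow_mul, one_div_mul_cancel hp0.ne', ENNReal.rpow_one,
      ENNReal.ofReal_rpow_of_nonneg hA hp0.le] at this
    simpa only [e, enorm_eq_self] using this
  have hpa : 0 < p * a := by positivity
  have hF : ∀ x, ‖f x‖ₑ ^ (p * a) =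
      ENNReal.ofReal (κ ^ (p * a)) * ENNReal.ofReal (((|f x| / κ) ^ a) ^ p) := by
    intro x
    rw [Real.enorm_eq_ofReal_abs, ENNReal.ofReal_rpow_of_nonneg (abs_nonneg _) hpa.le,
      ← ENNReal.ofReal_mul (by positivity), ← Real.rpow_mul (by positivity), mul_comm a p,
      ← Real.mul_rpow hκ0.le (by positivity), mul_div_cancel₀ _ hκ0.ne']
  rw [eLpNorm_eq_lintegral_rpow_enorm_toReal (by simpa using hpa) ENNReal.ofReal_ne_top,
    ENNReal.toReal_ofReal hpa.le, lintegral_congr hF, lintegral_const_mul _ (by fun_prop)]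
  have h3 : ENNReal.ofReal (κ ^ (p * a)) * ∫⁻ x, ENNReal.ofReal (((|f x| / κ) ^ a) ^ p) ≤
      ENNReal.ofReal (κ ^ (p * a) * (p / (p - 1) * A ^ p)) := by
    rw [ENNReal.ofReal_mul (by positivity)]
    refine mul_le_mul_right (hmain.trans ?_) _
    rw [ENNReal.ofReal_mul (by positivity)]
    gcongr
  refine (ENNReal.rpow_le_rpow h3 (by positivity)).trans_eq ?_
  rw [ENNReal.ofReal_rpow_of_nonneg (by positivity) (by positivity)]
  congr 1
  rw [Real.mul_rpow (by positivity) (by positivity), ← Real.rpow_mul hκ0.le,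
    mul_one_div_cancel hpa.ne', Real.rpow_one, Real.mul_rpow (by positivity) (by positivity),
    ← Real.rpow_mul hA, hainv]
  congr 3
  · field_simp
  · field_simp

/-- The first bound has too large a power of `B`. Weights (2 - s)/2 and s/2 on the two bounds make
both powers 1/2. -/
theorem le_mul_sqrt_of_le_of_le {s C₁ C₂ A B X : ℝ} (hs0 : 0 < s) (hs1 : s < 1) (hC₁ : 0 ≤ C₁)
    (hC₂ : 0 ≤ C₂) (hA : 0 ≤ A) (hB : 0 ≤ B) (hX : 0 ≤ X)
    (h1 : X ≤ C₁ * (B ^ (1 / (2 - s)) * A ^ ((1 - s) / (2 - s)))) (h2 : X ≤ C₂ * A) :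
    X ≤ C₁ ^ ((2 - s) / 2) * C₂ ^ (s / 2) * √(A * B) := by
  have h1s : 0 < 1 - s := by linarith
  have h2s : 0 < 2 - s := by linarith
  have e1 : X = X ^ ((2 - s) / 2) * X ^ (s / 2) := by
    rw [← Real.rpow_add_of_nonneg hX (by positivity) (by positivity),
      show (2 - s) / 2 + s / 2 = 1 by ring, Real.rpow_one]
  have e2 : 1 / (2 - s) * ((2 - s) / 2) = 1 / 2 := by field_simp
  have e3 : A ^ ((1 - s) / (2 - s) * ((2 - s) / 2)) * A ^ (s / 2) = A ^ (1 / 2 : ℝ) := by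
    rw [← Real.rpow_add_of_nonneg hA (by positivity) (by positivity)]
    congr 1
    field_simp
    ring
  rw [e1]
  calc _ ≤ (C₁ * (B ^ (1 / (2 - s)) * A ^ ((1 - s) / (2 - s)))) ^ ((2 - s) / 2) *
        (C₂ * A) ^ (s / 2) := by gcongr
    _ = _ := by
      rw [Real.mul_rpow (by positivity) (by positivity), Real.mul_rpow (by positivity)
        (by positivity), Real.mul_rpow hC₂ hA, ← Real.rpow_mul hB, ← Real.rpow_mul hA,
        Real.sqrt_mul hA, Real.sqrt_eq_rpow, Real.sqrt_eq_rpow, e2, ← e3]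
      ring

set_option maxHeartbeats 400000 in
/-- The interpolation inequality at the critical exponents of the Sobolev inequality. -/
theorem exists_eLpNorm_partialDeriv_le_of_critical {ip iq ir : ℝ} (hn : 0 < n) (hp : ip ≤ 1)
    (hr : ir < 0) (hq : 0 < iq) (hpqr : 2 * iq = ip + ir) (heq : n * ip - n * ir = 2) :
    ∃ C : ℝ, 0 ≤ C ∧ ∀ {u : EuclideanSpace ℝ (Fin n) → ℝ}, IsTest u → ∀ i,
      eLpNorm (partialDeriv i u) (ENNReal.ofReal (1 / iq)) volume ≤
        ENNReal.ofReal (C * √((xNormD 2 ip u).toReal * (xNormD 0 ir u).toReal)) := by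
  have hn' : (0 : ℝ) < n := by exact_mod_cast hn
  have hip : 0 < ip := by linarith
  set s := -(n * ir) with hs
  have hs0 : 0 < s := by have := mul_neg_of_pos_of_neg hn' hr; linarith
  have hnp : n * ip = 2 - s := by linarith
  have hnq : n * iq = 1 - s := by
    have : 2 * (n * iq) = n * ip + n * ir := by rw [← mul_add, ← hpqr]; ring
    linarith
  have h1s : 0 < 1 - s := by rw [← hnq]; positivity
  have h2s : 0 < 2 - s := by linarith
  -- The Doob inequality needs p > 1. If p = 1, then n = 2 - s would be an integer strictly between
  -- 1 and 2.
  have hip1 : ip < 1 := by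
    refine lt_of_le_of_ne hp fun h => ?_
    rw [h, mul_one] at hnp
    have h1 : (1 : ℝ) < n := by linarith
    have h2 : (n : ℝ) < 2 := by linarith
    have h1' : 1 < n := by exact_mod_cast h1
    have h2' : n < 2 := by exact_mod_cast h2
    omega
  have hord : holderOrder n ir = 0 := by
    have e := holderOrder_eq hn hr
    have : ⌊(n : ℝ) * ir + 1⌋ = 0 := by
      rw [Int.floor_eq_zero_iff]; constructor <;> linarith
    omega
  have hexp : holderExponent n ir = s := by rw [holderExponent, hord]; push_cast; linarith
  obtain ⟨Cm, hCm0, hCm⟩ := exists_abs_mollify_partialDeriv_le n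
  set p := 1 / ip with hpdef
  have hp1 : 1 < p := by rw [hpdef]; exact one_lt_one_div hip hip1
  have hp0 : 0 < p := by linarith
  have hqp : 1 / iq = p * ((2 - s) / (1 - s)) := by
    rw [hpdef, ← hnp, ← hnq]; field_simp
  set CS : ℝ≥0 := SNormLESNormFDerivOfEqConst ℝ
    (volume : Measure (EuclideanSpace ℝ (Fin n))) (p.toNNReal : ℝ≥0) with hCS
  set b := 1 / (2 - s) with hb
  have hb0 : 0 < b := by positivity
  have hb' : (1 - s) / (2 - s) = 1 - b := by rw [hb]; field_simp; ring
  have hb1 : 0 < 1 - b := by rw [← hb']; positivity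
  set C₁ := 4 * (Cm / 2) ^ b * ((p / (p - 1)) ^ ((1 - b) / p) * n ^ (1 - b)) with hC₁
  have hpp : 0 < p / (p - 1) := div_pos hp0 (by linarith)
  have hC₁0 : 0 < C₁ := by positivity
  set C₂ : ℝ := CS * n with hC₂
  have hC₂0 : 0 ≤ C₂ := by positivity
  refine ⟨C₁ ^ ((2 - s) / 2) * C₂ ^ (s / 2), by positivity, fun {u} hu i => ?_⟩
  set A := (xNormD 2 ip u).toReal with hA
  set B := (xNormD 0 ir u).toReal with hB
  have hA0 : 0 ≤ A := ENNReal.toReal_nonneg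
  have hB0 : 0 ≤ B := ENNReal.toReal_nonneg
  have hhol : ∀ x y, |u x - u y| ≤ B * ‖x - y‖ ^ s := by
    intro x y
    have := holder_listDeriv_le_of_neg hn hu hr (d := 0) (l := []) (by simp [hord]) x y
    rwa [hexp] at this
  have hf : IsTest (partialDeriv i u) := hu.partialDeriv i
  have hgrad : eLpNorm (gradSum (partialDeriv i u)) (ENNReal.ofReal p) volume ≤
      ENNReal.ofReal (n * A) := by
    have := eLpNorm_gradSum_le hf (t := ENNReal.ofReal p) (A := ENNReal.ofReal A)
      (by rw [← ENNReal.ofReal_one]; exact ENNReal.ofReal_le_ofReal hp1.le) fun j => by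
        have := eLpNorm_listDeriv_le_of_nonneg hn hu (d := 2) (μ := ip) hip.le (l := [j, i]) rfl
        rwa [if_pos hip] at this
    rwa [ENNReal.ofReal_mul hn'.le, ENNReal.ofReal_natCast]
  set X := eLpNorm (partialDeriv i u) (ENNReal.ofReal (1 / iq)) volume with hX
  have hXtop : X ≠ ⊤ := (hf.memLp _).2.ne
  rcases hB0.eq_or_lt with hBz | hBpos
  · have hconst : u = fun _ => u 0 := by
      ext x
      have := hhol x 0
      rw [← hBz, zero_mul] at this
      exact sub_eq_zero.1 (abs_nonpos_iff.1 this)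
    have : partialDeriv i u = 0 := by
      rw [hconst]; ext x; simp [partialDeriv]
    rw [hX, this, eLpNorm_zero]
    exact zero_le
  have hX1 : X.toReal ≤ C₁ * (B ^ b * A ^ (1 - b)) := by
    refine ENNReal.toReal_le_of_le_ofReal (by positivity) ?_
    have := eLpNorm_le_of_abs_mollify_le hf (K := Cm * B) (A := n * A) (by positivity)
      (by positivity) (by linarith) hp1 (fun hδ x => hCm hu hB0 hs0 hhol i hδ x) hgrad
    rw [← hqp] at this
    refine this.trans_eq ?_
    rw [hb', ← hb, mul_div_right_comm, Real.mul_rpow (by positivity) hB0,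
      Real.mul_rpow hn'.le hA0, hC₁]
    congr 1
    ring
  have hX2 : X.toReal ≤ C₂ * A := by
    refine ENNReal.toReal_le_of_le_ofReal (by positivity) ?_
    -- From n/p = 2 - s and n/q = 1 - s follows the Sobolev relation 1/q = 1/p - 1/n.
    have hq' : (((1 / iq).toNNReal : ℝ≥0) : ℝ)⁻¹ = ((p.toNNReal : ℝ≥0) : ℝ)⁻¹ -
        (Module.finrank ℝ (EuclideanSpace ℝ (Fin n)) : ℝ)⁻¹ := by
      rw [Real.coe_toNNReal _ (by positivity), Real.coe_toNNReal _ hp0.le,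
        finrank_euclideanSpace_fin, hpdef, one_div, one_div, inv_inv, inv_inv]
      field_simp
      linarith
    have := eLpNorm_le_eLpNorm_fderiv_of_eq (volume : Measure (EuclideanSpace ℝ (Fin n)))
      (hf.smooth.of_le (by simp)) hf.compact (p := p.toNNReal) (p' := (1 / iq).toNNReal)
      (by rw [← NNReal.coe_le_coe, Real.coe_toNNReal _ hp0.le]; exact hp1.le)
      (by rw [finrank_euclideanSpace_fin]; exact hn) hq'
    refine this.trans ?_
    rw [hC₂, mul_assoc, ENNReal.ofReal_mul (by positivity), ENNReal.ofReal_coe_nnreal]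
    refine mul_le_mul_right (le_trans ?_ hgrad) _
    refine eLpNorm_mono_enorm fun x => ?_
    rw [enorm_eq_self]
    exact enorm_fderiv_le_gradSum x
  rw [← ENNReal.ofReal_toReal hXtop]
  refine ENNReal.ofReal_le_ofReal ?_
  exact le_mul_sqrt_of_le_of_le hs0 (by linarith) hC₁0.le hC₂0 hA0 hB0 ENNReal.toReal_nonneg
    (by rwa [hb']) hX2

end Critical

end GagNir

namespace GagNir

/-! ### Covering and local interpolation on the line -/

section Line

/-- A covering argument: a bound on small balls centred at the points of `S` gives a global bound. -/
theorem exists_lintegral_le_of_closedBall_le : ∃ N : ℕ, ∀ {h F G : ℝ → ℝ≥0∞} {S : Set ℝ} {R : ℝ}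
    {s t : ℝ} {K : ℝ≥0∞}, 0 ≤ s → 0 ≤ t → s + t = 1 →
    (∀ x ∈ S, ∃ r, 0 < r ∧ r ≤ R ∧ ∫⁻ y in Metric.closedBall x r, h y ≤
      K * ((∫⁻ y in Metric.closedBall x r, F y) ^ s * (∫⁻ y in Metric.closedBall x r, G y) ^ t)) →
    ∫⁻ y in S, h y ≤ N * (K * ((∫⁻ y, F y) ^ s * (∫⁻ y, G y) ^ t)) := by
  obtain ⟨N, τ, hτ, hN⟩ := HasBesicovitchCovering.no_satelliteConfig (α := ℝ)
  refine ⟨N, fun {h F G S R s t K} hs ht hst H => ?_⟩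
  choose! r hr0 hrR hr using H
  let P : Besicovitch.BallPackage S ℝ :=
    { c := fun x => x
      r := fun x => r x
      rpos := fun x => hr0 x x.2
      r_bound := R
      r_le := fun x => hrR x x.2 }
  obtain ⟨T, hT, hcov⟩ := Besicovitch.exist_disjoint_covering_families hτ hN P
  have hS : S ⊆ ⋃ i : Fin N, ⋃ j ∈ T i, Metric.closedBall (P.c j) (P.r j) := by
    intro x hx
    have := hcov ⟨⟨x, hx⟩, rfl⟩
    simp only [Set.mem_iUnion] at this ⊢
    obtain ⟨i, j, hj, hxj⟩ := this
    exact ⟨i, j, hj, Metric.ball_subset_closedBall hxj⟩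
  have hfam : ∀ i, ∫⁻ y in ⋃ j ∈ T i, Metric.closedBall (P.c j) (P.r j), h y ≤
      K * ((∫⁻ y, F y) ^ s * (∫⁻ y, G y) ^ t) := by
    intro i
    have hc : (T i).Countable := (hT i).countable_of_nonempty_interior fun j _ =>
      (Metric.nonempty_ball.2 (P.rpos j)).mono Metric.ball_subset_interior_closedBall
    have := hc.to_subtype
    have hsum : ∀ F : ℝ → ℝ≥0∞, ∑' j : T i, ∫⁻ y in Metric.closedBall (P.c j) (P.r j), F y ≤
        ∫⁻ y, F y := by
      intro F
      rw [← lintegral_biUnion hc (fun j _ => measurableSet_closedBall) (hT i)]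
      exact setLIntegral_le_lintegral _ _
    rw [Set.biUnion_eq_iUnion]
    refine (lintegral_iUnion_le _ _).trans ?_
    refine (ENNReal.tsum_le_tsum fun j : T i => hr j.1.1 j.1.2).trans ?_
    rw [ENNReal.tsum_mul_left]
    refine mul_le_mul_right ?_ _
    -- Hölder's inequality for the sum over one disjoint family; s + t = 1 lets the local integrals
    -- add up to at most the global ones.
    have := ENNReal.lintegral_mul_norm_pow_le (μ := Measure.count (α := T i))
      (f := fun j => ∫⁻ y in Metric.closedBall (P.c j) (P.r j), F y)
      (g := fun j => ∫⁻ y in Metric.closedBall (P.c j) (P.r j), G y)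
      (measurable_of_countable _).aemeasurable (measurable_of_countable _).aemeasurable hs ht hst
    simp only [lintegral_count] at this
    refine this.trans ?_
    gcongr
    · exact hsum F
    · exact hsum G
  calc ∫⁻ y in S, h y ≤ ∫⁻ y in ⋃ i : Fin N, ⋃ j ∈ T i, Metric.closedBall (P.c j) (P.r j), h y :=
        lintegral_mono_set hS
    _ ≤ ∑' i : Fin N, ∫⁻ y in ⋃ j ∈ T i, Metric.closedBall (P.c j) (P.r j), h y :=
        lintegral_iUnion_le _ _
    _ ≤ ∑' _ : Fin N, K * ((∫⁻ y, F y) ^ s * (∫⁻ y, G y) ^ t) := ENNReal.tsum_le_tsum hfam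
    _ = _ := by rw [tsum_fintype, Finset.sum_const, Finset.card_univ, Fintype.card_fin, nsmul_eq_mul]

variable {v w z : ℝ → ℝ}

/-- The local interpolation inequality on an interval. -/
theorem abs_deriv_le_integral (hv : ∀ x, HasDerivAt v (w x) x) (hw : ∀ x, HasDerivAt w (z x) x)
    (hz : Continuous z) {c d y : ℝ} (hcd : c < d) (hy : y ∈ Set.Icc c d) :
    |w y| ≤ 9 / (d - c) ^ 2 * (∫ x in c..d, |v x|) + ∫ x in c..d, |z x| := by
  have hvc : Continuous v := continuous_iff_continuousAt.2 fun x => (hv x).continuousAt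
  have hwc : Continuous w := continuous_iff_continuousAt.2 fun x => (hw x).continuousAt
  set m := (d - c) / 3 with hm
  have hm0 : 0 < m := by rw [hm]; linarith
  -- In each outer third |v| is somewhere at most its mean. The two points are at distance at least
  -- `m`, so the mean value theorem gives a point where the slope is small.
  have hex : ∀ a : ℝ, ∃ s ∈ Set.Icc a (a + m), m * |v s| ≤ ∫ x in a..(a + m), |v x| := by
    intro a
    obtain ⟨s, hs, hmin⟩ := (isCompact_Icc (a := a) (b := a + m)).exists_isMinOn
      (Set.nonempty_Icc.2 (by linarith)) hvc.abs.continuousOn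
    refine ⟨s, hs, ?_⟩
    have := intervalIntegral.integral_mono_on (a := a) (b := a + m)
      (μ := volume) (by linarith) (f := fun _ => |v s|) (g := fun x => |v x|) intervalIntegrable_const
      (hvc.abs.intervalIntegrable _ _) fun x hx => hmin hx
    simpa using this
  have hii : ∀ {f : ℝ → ℝ}, Continuous f → ∀ a b, IntervalIntegrable (fun x => |f x|) volume a b :=
    fun hf a b => hf.abs.intervalIntegrable a b
  obtain ⟨s, hs, hs'⟩ := hex c
  obtain ⟨t, ht, ht'⟩ := hex (d - m)
  rw [sub_add_cancel] at ht ht'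
  have hst : s + m ≤ t := by have := hs.2; have := ht.1; linarith
  obtain ⟨ξ, hξ, hξe⟩ := exists_hasDerivAt_eq_slope v w (by linarith : s < t) hvc.continuousOn
    fun x _ => hv x
  have hsplit : (∫ x in c..(c + m), |v x|) + ∫ x in (d - m)..d, |v x| ≤ ∫ x in c..d, |v x| := by
    rw [← intervalIntegral.integral_add_adjacent_intervals (hii hvc c (c + m)) (hii hvc (c + m) d),
      ← intervalIntegral.integral_add_adjacent_intervals (hii hvc (c + m) (d - m))
        (hii hvc (d - m) d)]
    have : 0 ≤ ∫ x in (c + m)..(d - m), |v x| :=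
      intervalIntegral.integral_nonneg (by linarith) fun x _ => abs_nonneg _
    linarith
  have h1 : |w ξ| ≤ 9 / (d - c) ^ 2 * ∫ x in c..d, |v x| := by
    have e : 9 / (d - c) ^ 2 = 1 / (m * m) := by rw [hm]; field_simp; norm_num
    have hvv : |v t - v s| ≤ |v t| + |v s| := abs_sub _ _
    rw [hξe, abs_div, abs_of_pos (by linarith : 0 < t - s), e, div_mul_eq_mul_div, one_mul,
      div_le_div_iff₀ (by linarith) (by positivity)]
    have h2 : m * |v t - v s| ≤ ∫ x in c..d, |v x| := by nlinarith
    have h3 : m * (m * |v t - v s|) ≤ m * ∫ x in c..d, |v x| := mul_le_mul_of_nonneg_left h2 hm0.le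
    have h4 : m * (∫ x in c..d, |v x|) ≤ (t - s) * ∫ x in c..d, |v x| :=
      mul_le_mul_of_nonneg_right (by linarith)
        (intervalIntegral.integral_nonneg hcd.le fun x _ => abs_nonneg _)
    linarith
  have h2 : |w y - w ξ| ≤ ∫ x in c..d, |z x| := by
    have hξ' : ξ ∈ Set.Icc c d :=
      ⟨hs.1.trans hξ.1.le, hξ.2.le.trans ht.2⟩
    rw [← intervalIntegral.integral_eq_sub_of_hasDerivAt (fun x _ => hw x)
      (hz.intervalIntegrable _ _)]
    rw [← Real.norm_eq_abs]
    refine intervalIntegral.norm_integral_le_integral_norm_uIoc.trans ?_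
    simp only [Real.norm_eq_abs]
    rw [intervalIntegral.integral_of_le hcd.le]
    refine setIntegral_mono_set ((hii hz c d).1) (.of_forall fun x => abs_nonneg _) ?_
    refine LE.le.eventuallyLE (Set.Ioc_subset_Ioc ?_ ?_)
    · exact le_min hξ'.1 hy.1
    · exact max_le hξ'.2 hy.2
  have h3 : |w y| ≤ |w y - w ξ| + |w ξ| := by
    have := abs_add_le (w y - w ξ) (w ξ)
    rwa [sub_add_cancel] at this
  linarith

/-- If a sum of a quantity that is small near `0` and one that is small at `R` has a lower bound,
then they agree somewhere in between. -/
theorem exists_eq_of_le_add {a b : ℝ → ℝ} {W R : ℝ} (hR : 0 < R) (hW : 0 < W)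
    (ha : ContinuousOn a (Set.Ioi 0)) (hb : Continuous b) (hb0 : b 0 = 0)
    (hab : ∀ r, 0 < r → W ≤ a r + b r) (haR : a R < W / 2) :
    ∃ r, 0 < r ∧ r ≤ R ∧ a r = b r := by
  -- Near 0 the lower bound forces a > W/2 > b, while at `R` it forces b > W/2 > a.
  have hev : ∀ᶠ r in nhdsWithin (0 : ℝ) (Set.Ioi 0), b r < W / 2 ∧ r ∈ Set.Ioc 0 R := by
    refine Filter.Eventually.and ?_ (Ioc_mem_nhdsGT hR)
    refine Filter.Eventually.filter_mono nhdsWithin_le_nhds ?_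
    exact hb.continuousAt.eventually_lt continuousAt_const (by rw [hb0]; linarith)
  obtain ⟨ε, hε, hε0, hεR⟩ := hev.exists
  have hc : ContinuousOn (fun r => b r - a r) (Set.Icc ε R) :=
    hb.continuousOn.sub (ha.mono fun r hr => hε0.trans_le hr.1)
  have h1 := hab ε hε0
  have h2 := hab R hR
  obtain ⟨r, hr, hr'⟩ := intermediate_value_Icc hεR hc
    (⟨by linarith, by linarith⟩ : (0 : ℝ) ∈ Set.Icc (b ε - a ε) (b R - a R))
  exact ⟨r, hε0.trans_le hr.1, hr.2, by simp only at hr'; linarith⟩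

end Line

end GagNir

namespace GagNir

/-! ### Nirenberg's inequality on the line -/

section Line

variable {ρ π q : ℝ}

/-- The one-dimensional interpolation inequality. The functions `F` and `G` control `v` and its
second derivative through Hölder's inequality. -/
theorem exists_lintegral_deriv_rpow_le (hρ : 0 ≤ ρ) (hπ0 : 0 ≤ π) (hπ1 : π ≤ 1) (hq : 0 < q)
    (hqρπ : q * (ρ + π) = 2) : ∃ N : ℝ, 0 ≤ N ∧ ∀ {v w z F G : ℝ → ℝ} {A B : ℝ},
    (∀ x, HasDerivAt v (w x) x) → (∀ x, HasDerivAt w (z x) x) → Continuous z →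
    Continuous F → Continuous G → (∀ x, 0 ≤ F x) → (∀ x, 0 ≤ G x) → Integrable F → Integrable G →
    0 ≤ A → 0 ≤ B →
    (∀ c d, c < d → ∫ x in c..d, |v x| ≤ B * ((d - c) ^ (1 - ρ) * (∫ x in c..d, F x) ^ ρ)) →
    (∀ c d, c < d → ∫ x in c..d, |z x| ≤ A * ((d - c) ^ (1 - π) * (∫ x in c..d, G x) ^ π)) →
    ∫⁻ x, ‖w x‖ₑ ^ q ≤ ENNReal.ofReal (N * (A * B) ^ (q / 2)) *
      ((∫⁻ x, ENNReal.ofReal (F x)) ^ (q * ρ / 2) * (∫⁻ x, ENNReal.ofReal (G x)) ^ (q * π / 2)) := by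
  obtain ⟨N, hN⟩ := exists_lintegral_le_of_closedBall_le
  refine ⟨N * 36 ^ (q / 2), by positivity, ?_⟩
  intro v w z F G A B hv hw hz hF hG hF0 hG0 hFi hGi hA hB hvF hzG
  have hwc : Continuous w := continuous_iff_continuousAt.2 fun x => (hw x).continuousAt
  set K := ENNReal.ofReal ((36 * (A * B)) ^ (q / 2)) with hK
  set J := (∫⁻ x, ENNReal.ofReal (F x)) ^ (q * ρ / 2) *
    (∫⁻ x, ENNReal.ofReal (G x)) ^ (q * π / 2) with hJ
  have hs0 : 0 ≤ q * ρ / 2 := by positivity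
  have ht0 : 0 ≤ q * π / 2 := by positivity
  have hst : q * ρ / 2 + q * π / 2 = 1 := by linarith
  have hgoal : ENNReal.ofReal (N * 36 ^ (q / 2) * (A * B) ^ (q / 2)) * J = N * (K * J) := by
    rw [hK, mul_assoc, ENNReal.ofReal_mul (by positivity), ENNReal.ofReal_natCast,
      Real.mul_rpow (x := 36) (y := A * B) (by norm_num) (by positivity), mul_assoc]
  rw [hgoal]
  have hcont : ∀ {f : ℝ → ℝ}, Continuous f → ∀ x, Continuous fun r => ∫ y in (x - r)..(x + r), f y := by
    intro f hf x
    have h := fun a b => hf.intervalIntegrable (μ := volume) a b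
    have e : (fun r => ∫ y in (x - r)..(x + r), f y) =
        fun r => (∫ y in (0 : ℝ)..(x + r), f y) - ∫ y in (0 : ℝ)..(x - r), f y := by
      ext r
      rw [intervalIntegral.integral_interval_sub_left (h _ _) (h _ _)]
    rw [e]
    have hp := intervalIntegral.continuous_primitive (μ := volume) h 0
    exact (hp.comp (by fun_prop : Continuous fun r => x + r)).sub
      (hp.comp (by fun_prop : Continuous fun r => x - r))
  have hnn : ∀ {f : ℝ → ℝ}, (∀ x, 0 ≤ f x) → ∀ {x r : ℝ}, 0 ≤ r → 0 ≤ ∫ y in (x - r)..(x + r), f y :=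
    fun {f} hf {x r} hr => intervalIntegral.integral_nonneg (by linarith) fun y _ => hf y
  have hlint : ∀ {f : ℝ → ℝ}, Continuous f → (∀ x, 0 ≤ f x) → ∀ {x r : ℝ}, 0 < r →
      ENNReal.ofReal (∫ y in (x - r)..(x + r), f y) =
        ∫⁻ y in Metric.closedBall x r, ENNReal.ofReal (f y) := by
    intro f hf hf0 x r hr
    rw [intervalIntegral.integral_of_le (by linarith), ← integral_Icc_eq_integral_Ioc,
      Real.closedBall_eq_Icc, ofReal_integral_eq_lintegral_ofReal hf.integrableOn_Icc
      (.of_forall hf0)]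
  have hlow : ∀ {x r y : ℝ}, 0 < r → y ∈ Metric.closedBall x r → |w y| ≤
      9 * B * ((2 * r) ^ (-1 - ρ) * (∫ y in (x - r)..(x + r), F y) ^ ρ) +
        A * ((2 * r) ^ (1 - π) * (∫ y in (x - r)..(x + r), G y) ^ π) := by
    intro x r y hr hy
    rw [Real.closedBall_eq_Icc] at hy
    have hlt : x - r < x + r := by linarith
    have h1 := abs_deriv_le_integral hv hw hz hlt hy
    have h2 := hvF _ _ hlt
    have h3 := hzG _ _ hlt
    rw [show x + r - (x - r) = 2 * r by ring] at h1 h2 h3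
    refine h1.trans (add_le_add ?_ h3)
    refine (mul_le_mul_of_nonneg_left h2 (by positivity)).trans_eq ?_
    have e : (2 * r) ^ (-1 - ρ) = (2 * r) ^ (1 - ρ) / (2 * r) ^ 2 := by
      rw [← Real.rpow_natCast (2 * r) 2, ← Real.rpow_sub (by positivity)]
      congr 1
      push_cast
      ring
    rw [e]
    ring
  have hbal : ∀ {x r : ℝ}, 0 < r →
      9 * B * ((2 * r) ^ (-1 - ρ) * (∫ y in (x - r)..(x + r), F y) ^ ρ) =
        A * ((2 * r) ^ (1 - π) * (∫ y in (x - r)..(x + r), G y) ^ π) →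
      ∫⁻ y in Metric.closedBall x r, ‖w y‖ₑ ^ q ≤
        K * ((∫⁻ y in Metric.closedBall x r, ENNReal.ofReal (F y)) ^ (q * ρ / 2) *
          (∫⁻ y in Metric.closedBall x r, ENNReal.ofReal (G y)) ^ (q * π / 2)) := by
    intro x r hr heq
    rw [← hlint hF hF0 hr, ← hlint hG hG0 hr]
    have hU0 := hnn hF0 (x := x) hr.le
    have hV0 := hnn hG0 (x := x) hr.le
    set U := ∫ y in (x - r)..(x + r), F y
    set V := ∫ y in (x - r)..(x + r), G y
    have hpt : ∀ y ∈ Metric.closedBall x r, ‖w y‖ₑ ^ q ≤ ENNReal.ofReal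
        ((36 * (A * B)) ^ (q / 2) * ((2 * r)⁻¹ * (U ^ (q * ρ / 2) * V ^ (q * π / 2)))) := by
      intro y hy
      rw [Real.enorm_eq_ofReal_abs, ENNReal.ofReal_rpow_of_nonneg (abs_nonneg _) hq.le]
      refine ENNReal.ofReal_le_ofReal ?_
      have h1 := hlow hr hy
      have h2 : |w y| ^ 2 ≤ 36 * (A * B) * ((2 * r) ^ (-(ρ + π)) * (U ^ ρ * V ^ π)) := by
        have e : (2 * r) ^ (-(ρ + π)) = (2 * r) ^ (-1 - ρ) * (2 * r) ^ (1 - π) := by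
          rw [← Real.rpow_add (by positivity)]; congr 1; ring
        refine (pow_le_pow_left₀ (abs_nonneg _) h1 2).trans_eq ?_
        rw [e]
        set a := 9 * B * ((2 * r) ^ (-1 - ρ) * U ^ ρ) with ha
        set b := A * ((2 * r) ^ (1 - π) * V ^ π) with hb
        -- Balance turns the sum into a product; the constant 36 is this 4 times the 9 of the local
        -- inequality.
        have : (a + b) ^ 2 = 4 * (a * b) := by rw [heq]; ring
        rw [this, ha, hb]
        ring
      have h3 : |w y| ^ q = (|w y| ^ 2) ^ (q / 2) := by
        rw [← Real.rpow_natCast, ← Real.rpow_mul (abs_nonneg _)]; congr 1; push_cast; ring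
      rw [h3]
      refine (Real.rpow_le_rpow (by positivity) h2 (by positivity)).trans_eq ?_
      -- Since q(ρ + π) = 2, the length enters with the power -1, cancelled by the measure of the
      -- ball.
      rw [Real.mul_rpow (x := 36 * (A * B)) (by positivity) (by positivity),
        Real.mul_rpow (z := q / 2) (x := (2 * r) ^ (-(ρ + π))) (by positivity) (by positivity),
        Real.mul_rpow (x := U ^ ρ) (by positivity) (by positivity),
        ← Real.rpow_mul (by positivity), ← Real.rpow_mul hU0, ← Real.rpow_mul hV0,
        show -(ρ + π) * (q / 2) = -1 by linarith, Real.rpow_neg_one]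
      congr 4 <;> ring
    refine (setLIntegral_mono measurable_const hpt).trans_eq ?_
    rw [setLIntegral_const, Real.volume_closedBall, ← ENNReal.ofReal_mul (by positivity),
      ENNReal.ofReal_rpow_of_nonneg hU0 hs0, ENNReal.ofReal_rpow_of_nonneg hV0 ht0, hK,
      ← ENNReal.ofReal_mul (by positivity), ← ENNReal.ofReal_mul (by positivity)]
    congr 1
    field_simp
  -- The covering needs bounded radii. Where |w| exceeds a fixed level, the decay of the first term,
  -- with the total integral of `F`, gives one `R` for all points; the bound is independent of `R`
  -- and of the level.
  have hlevel : ∀ k : ℕ, ∫⁻ x in {x | 1 / ((k : ℝ) + 1) < |w x|}, ‖w x‖ₑ ^ q ≤ N * (K * J) := by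
    intro k
    set W : ℝ := 1 / ((k : ℝ) + 1) with hW
    have hW0 : 0 < W := by positivity
    have hlim : Filter.Tendsto (fun r : ℝ => 9 * B * ((2 * r) ^ (-1 - ρ) * (∫ y, F y) ^ ρ))
        Filter.atTop (nhds 0) := by
      have h1 : Filter.Tendsto (fun r : ℝ => (2 * r) ^ (-(1 + ρ))) Filter.atTop (nhds 0) :=
        (tendsto_rpow_neg_atTop (by linarith : 0 < 1 + ρ)).comp
          (Filter.tendsto_id.const_mul_atTop (by norm_num : (0 : ℝ) < 2))
      have := (h1.mul_const ((∫ y, F y) ^ ρ)).const_mul (9 * B)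
      rw [show -(1 + ρ) = -1 - ρ by ring, zero_mul, mul_zero] at this
      simpa only [mul_assoc] using this
    obtain ⟨R, hRW, hR⟩ := ((hlim.eventually (gt_mem_nhds (half_pos hW0))).and
      (Filter.eventually_gt_atTop 0)).exists
    refine hN hs0 ht0 hst (R := R) fun x hx => ?_
    have hx : W < |w x| := hx
    suffices h : ∃ r, 0 < r ∧ r ≤ R ∧
        9 * B * ((2 * r) ^ (-1 - ρ) * (∫ y in (x - r)..(x + r), F y) ^ ρ) =
          A * ((2 * r) ^ (1 - π) * (∫ y in (x - r)..(x + r), G y) ^ π) by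
      obtain ⟨r, hr0, hrR, hr⟩ := h
      exact ⟨r, hr0, hrR, hbal hr0 hr⟩
    refine exists_eq_of_le_add
      (a := fun r => 9 * B * ((2 * r) ^ (-1 - ρ) * (∫ y in (x - r)..(x + r), F y) ^ ρ))
      (b := fun r => A * ((2 * r) ^ (1 - π) * (∫ y in (x - r)..(x + r), G y) ^ π)) hR hW0 ?_ ?_ ?_
      (fun r hr => hx.le.trans (hlow hr (Metric.mem_closedBall_self hr.le))) ?_
    · refine continuousOn_const.mul (ContinuousOn.mul ?_ ?_)
      · refine ContinuousOn.rpow_const (by fun_prop) fun r hr => Or.inl ?_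
        have hr : 0 < r := hr
        positivity
      · exact ((hcont hF x).rpow_const fun _ => Or.inr hρ).continuousOn
    · exact continuous_const.mul (((continuous_const.mul continuous_id).rpow_const
        fun _ => Or.inr (by linarith)).mul ((hcont hG x).rpow_const fun _ => Or.inr hπ0))
    -- At r = 0 the second term vanishes through the length if π = 0 and through the integral if π >
    -- 0; for π = 1 the length contributes `0 ^ 0 = 1`.
    · rcases hπ0.eq_or_lt with h0 | h0
      · simp [← h0]
      · simp [Real.zero_rpow h0.ne']
    · refine lt_of_le_of_lt ?_ hRW
      refine mul_le_mul_of_nonneg_left (mul_le_mul_of_nonneg_left ?_ (by positivity))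
        (by positivity)
      refine Real.rpow_le_rpow (hnn hF0 hR.le) ?_ hρ
      rw [intervalIntegral.integral_of_le (by linarith)]
      exact setIntegral_le_integral hFi (.of_forall hF0)
  have hun : ∫⁻ x, ‖w x‖ₑ ^ q =
      ∫⁻ x in ⋃ k : ℕ, {x | 1 / ((k : ℝ) + 1) < |w x|}, ‖w x‖ₑ ^ q := by
    rw [← lintegral_indicator]
    · refine lintegral_congr fun x => ?_
      by_cases hx : w x = 0
      · simp [hx, hq, Set.indicator]
      · rw [Set.indicator_of_mem]
        obtain ⟨k, hk⟩ := exists_nat_one_div_lt (abs_pos.2 hx)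
        exact Set.mem_iUnion.2 ⟨k, hk⟩
    · exact MeasurableSet.iUnion fun k => measurableSet_lt measurable_const hwc.abs.measurable
  rw [hun, setLIntegral_iUnion_of_directed]
  · exact iSup_le hlevel
  · refine Monotone.directed_le fun j k hjk x hx => ?_
    have hx : 1 / ((j : ℝ) + 1) < |w x| := hx
    have : 1 / ((k : ℝ) + 1) ≤ 1 / ((j : ℝ) + 1) := by gcongr
    exact this.trans_lt hx

end Line

end GagNir

namespace GagNir

/-! ### Integration over parallel lines -/

section Slab

variable {n : ℕ}

/-- The slab of the points whose `i`-th coordinate lies in `[0, 1)`. -/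
def slab (i : Fin n) : Set (EuclideanSpace ℝ (Fin n)) := {x | 0 ≤ x i ∧ x i < 1}

theorem measurableSet_slab (i : Fin n) : MeasurableSet (slab i) := by
  have hm : Measurable fun x : EuclideanSpace ℝ (Fin n) => x i := by fun_prop
  exact (measurableSet_le measurable_const hm).inter (measurableSet_lt hm measurable_const)

/-- Integration over the lines in the direction of the `i`-th coordinate vector. -/
theorem lintegral_eq_lintegral_slab (i : Fin n) {g : EuclideanSpace ℝ (Fin n) → ℝ≥0∞}
    (hg : Measurable g) :
    ∫⁻ x in slab i, ∫⁻ t : ℝ, g (x + t • EuclideanSpace.single i 1) = ∫⁻ x, g x := by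
  set e : EuclideanSpace ℝ (Fin n) := EuclideanSpace.single i 1 with he
  have hS := measurableSet_slab i
  set χ : EuclideanSpace ℝ (Fin n) → ℝ≥0∞ := (slab i).indicator 1 with hχ
  have hχm : Measurable χ := measurable_one.indicator hS
  -- Each line parallel to the axis spends parameter length one in the slab, so Tonelli's theorem
  -- suffices and no splitting of coordinates is needed.
  have hline : ∀ y, ∫⁻ t : ℝ, χ (y - t • e) = 1 := by
    classical
    intro y
    have h1 : ∀ t : ℝ, χ (y - t • e) = (Set.Ioc (y i - 1) (y i)).indicator 1 t := by
      intro t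
      have h2 : (y - t • e) i = y i - t := by simp [he]
      rw [hχ, Set.indicator_apply, Set.indicator_apply]
      refine if_congr ?_ rfl rfl
      simp only [slab, Set.mem_ofPred_eq, h2, Set.mem_Ioc]
      constructor <;> rintro ⟨h3, h4⟩ <;> constructor <;> linarith
    rw [lintegral_congr h1, lintegral_indicator_one measurableSet_Ioc, Real.volume_Ioc]
    simp
  calc ∫⁻ x in slab i, ∫⁻ t : ℝ, g (x + t • e)
      = ∫⁻ x, ∫⁻ t : ℝ, χ x * g (x + t • e) := by
        rw [← lintegral_indicator hS]
        refine lintegral_congr fun x => ?_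
        by_cases hx : x ∈ slab i <;> simp [hχ, hx]
    _ = ∫⁻ t : ℝ, ∫⁻ x, χ x * g (x + t • e) := by
        refine lintegral_lintegral_swap (Measurable.aemeasurable ?_)
        exact (hχm.comp measurable_fst).mul (hg.comp (by fun_prop))
    _ = ∫⁻ t : ℝ, ∫⁻ y, χ (y - t • e) * g y := by
        refine lintegral_congr fun t => ?_
        rw [← lintegral_add_right_eq_self (fun y => χ (y - t • e) * g y) (t • e)]
        simp
    _ = ∫⁻ y, ∫⁻ t : ℝ, χ (y - t • e) * g y := by
        refine lintegral_lintegral_swap (Measurable.aemeasurable ?_)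
        exact (hχm.comp (by fun_prop)).mul (hg.comp measurable_snd)
    _ = ∫⁻ y, g y := by
        refine lintegral_congr fun y => ?_
        have hm : Measurable fun t : ℝ => χ (y - t • e) := hχm.comp (by fun_prop)
        rw [lintegral_mul_const _ hm, hline, one_mul]

end Slab

/-! ### Lebesgue data on the line, including the exponent ∞ -/

section Density

/-- The density whose integral to the power `ρ` is the `L^(1/ρ)` norm; it is irrelevant for
`ρ = 0`. -/
noncomputable def lpDensity {α : Type*} (ρ : ℝ) (g : α → ℝ) (x : α) : ℝ :=
  if ρ = 0 then 0 else |g x| ^ (1 / ρ)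

theorem lpDensity_nonneg {α : Type*} (ρ : ℝ) (g : α → ℝ) (x : α) : 0 ≤ lpDensity ρ g x := by
  unfold lpDensity
  split_ifs <;> positivity

theorem continuous_lpDensity {α : Type*} [TopologicalSpace α] {ρ : ℝ} (hρ : 0 ≤ ρ) {g : α → ℝ}
    (hg : Continuous g) : Continuous (lpDensity ρ g) := by
  unfold lpDensity
  split_ifs
  · exact continuous_const
  · exact hg.abs.rpow_const fun _ => Or.inr (by positivity)

theorem integrable_lpDensity {ρ : ℝ} (hρ : 0 ≤ ρ) {g : ℝ → ℝ} (hg : Continuous g)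
    (hgc : HasCompactSupport g) : Integrable (lpDensity ρ g) := by
  refine (continuous_lpDensity hρ hg).integrable_of_hasCompactSupport (hgc.mono fun x hx h0 => hx ?_)
  unfold lpDensity
  split_ifs with h
  · rfl
  · rw [h0, abs_zero, Real.zero_rpow (one_div_ne_zero h)]

/-- Hölder's inequality on the interval. For ρ = 0 the density is zero, `0 ^ 0 = 1` removes it, and
the prefactor carries the supremum, so both cases have one form. -/
theorem integral_abs_le_lpDensity {ρ : ℝ} (hρ0 : 0 ≤ ρ) (hρ1 : ρ ≤ 1) {g : ℝ → ℝ}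
    (hg : Continuous g) {Y : ℝ} (hY : ρ = 0 → ∀ x, |g x| ≤ Y) {c d : ℝ} (hcd : c < d) :
    ∫ x in c..d, |g x| ≤ (if ρ = 0 then Y else 1) *
      ((d - c) ^ (1 - ρ) * (∫ x in c..d, lpDensity ρ g x) ^ ρ) := by
  have hdc : 0 < d - c := by linarith
  split_ifs with h
  · have := intervalIntegral.integral_mono_on (a := c) (b := d) (μ := volume) hcd.le
      (hg.abs.intervalIntegrable _ _) (g := fun _ => Y) intervalIntegrable_const
      fun x _ => hY h x
    simpa [h, mul_comm] using this
  · have hρ : 0 < ρ := lt_of_le_of_ne hρ0 (Ne.symm h)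
    have ht : 1 ≤ 1 / ρ := by rw [le_div_iff₀ hρ]; linarith
    have hgd : ∀ x, lpDensity ρ g x = |g x| ^ (1 / ρ) := fun x => by rw [lpDensity, if_neg h]
    simp only [hgd]
    rw [one_mul, intervalIntegral.integral_of_le hcd.le, intervalIntegral.integral_of_le hcd.le]
    have hc : Continuous fun x => |g x| ^ (1 / ρ) :=
      hg.abs.rpow_const fun _ => Or.inr (by positivity)
    have h1 := lintegral_rpow_le_measure_univ_rpow_mul (volume.restrict (Set.Ioc c d))
      (g := fun x => ENNReal.ofReal |g x|) (by fun_prop) ht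
    have e : ∀ x, ENNReal.ofReal |g x| ^ (1 / ρ) = ENNReal.ofReal (|g x| ^ (1 / ρ)) :=
      fun x => ENNReal.ofReal_rpow_of_nonneg (abs_nonneg _) (by positivity)
    have i1 : IntegrableOn (fun x => |g x|) (Set.Ioc c d) :=
      hg.abs.integrableOn_Icc.mono_set Set.Ioc_subset_Icc_self
    have i2 : IntegrableOn (fun x => |g x| ^ (1 / ρ)) (Set.Ioc c d) :=
      hc.integrableOn_Icc.mono_set Set.Ioc_subset_Icc_self
    have n1 : 0 ≤ ∫ x in Set.Ioc c d, |g x| := integral_nonneg fun x => abs_nonneg _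
    have n2 : 0 ≤ ∫ x in Set.Ioc c d, |g x| ^ (1 / ρ) := integral_nonneg fun x => by positivity
    simp only [e] at h1
    rw [← ofReal_integral_eq_lintegral_ofReal i1 (.of_forall fun x => abs_nonneg _),
      ← ofReal_integral_eq_lintegral_ofReal i2 (.of_forall fun x => by positivity),
      Measure.restrict_apply_univ, Real.volume_Ioc,
      ENNReal.ofReal_rpow_of_nonneg n1 (by positivity),
      ENNReal.ofReal_rpow_of_nonneg hdc.le (by linarith), ← ENNReal.ofReal_mul (by positivity),
      ENNReal.ofReal_le_ofReal_iff (by positivity)] at h1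
    have h2 := Real.rpow_le_rpow (by positivity) h1 hρ0
    rw [← Real.rpow_mul n1, one_div_mul_cancel h, Real.rpow_one,
      Real.mul_rpow (by positivity) n2, ← Real.rpow_mul hdc.le] at h2
    rwa [show (1 / ρ - 1) * ρ = 1 - ρ by field_simp] at h2

variable {n : ℕ}

theorem lintegral_lpDensity_rpow_le {g : EuclideanSpace ℝ (Fin n) → ℝ} {ρ q Y : ℝ} (hρ : 0 ≤ ρ)
    (hq : 0 < q) (hY : 0 ≤ Y)
    (h : eLpNorm g (if 0 < ρ then ENNReal.ofReal (1 / ρ) else ⊤) volume ≤ ENNReal.ofReal Y) :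
    ENNReal.ofReal ((if ρ = 0 then Y else 1) ^ (q / 2)) *
      (∫⁻ x, ENNReal.ofReal (lpDensity ρ g x)) ^ (q * ρ / 2) ≤ ENNReal.ofReal (Y ^ (q / 2)) := by
  rcases hρ.eq_or_lt with h0 | h0
  · simp [← h0]
  · rw [if_pos h0, eLpNorm_eq_lintegral_rpow_enorm_toReal (by simpa using h0)
      ENNReal.ofReal_ne_top, ENNReal.toReal_ofReal (by positivity), one_div_one_div] at h
    have e : ∀ x, ENNReal.ofReal (lpDensity ρ g x) = ‖g x‖ₑ ^ (1 / ρ) := fun x => by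
      rw [lpDensity, if_neg h0.ne', Real.enorm_eq_ofReal_abs,
        ENNReal.ofReal_rpow_of_nonneg (abs_nonneg _) (by positivity)]
    rw [if_neg h0.ne', Real.one_rpow, ENNReal.ofReal_one, one_mul, lintegral_congr e,
      show q * ρ / 2 = ρ * (q / 2) by ring, ENNReal.rpow_mul,
      ← ENNReal.ofReal_rpow_of_nonneg hY (by positivity)]
    gcongr

end Density

end GagNir

namespace GagNir

/-! ### Two Lebesgue data, and the one-dimensional endpoint -/

section Nirenberg

variable {n : ℕ} {u : EuclideanSpace ℝ (Fin n) → ℝ}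

theorem IsTest.hasDerivAt_line (hu : IsTest u) (i : Fin n) (x : EuclideanSpace ℝ (Fin n)) (t : ℝ) :
    HasDerivAt (fun t : ℝ => u (x + t • EuclideanSpace.single i 1))
      (GagNir.partialDeriv i u (x + t • EuclideanSpace.single i 1)) t := by
  have h1 : HasDerivAt (fun t : ℝ => x + t • EuclideanSpace.single i (1 : ℝ))
      (EuclideanSpace.single i 1) t := by
    simpa using ((hasDerivAt_id t).smul_const (EuclideanSpace.single i (1 : ℝ))).const_add x
  exact (hu.differentiable _).hasFDerivAt.comp_hasDerivAt t h1

theorem IsTest.continuous_line (hu : IsTest u) (i : Fin n) (x : EuclideanSpace ℝ (Fin n)) :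
    Continuous fun t : ℝ => u (x + t • EuclideanSpace.single i 1) :=
  hu.continuous.comp (by fun_prop)

theorem IsTest.hasCompactSupport_line (hu : IsTest u) (i : Fin n) (x : EuclideanSpace ℝ (Fin n)) :
    HasCompactSupport fun t : ℝ => u (x + t • EuclideanSpace.single i 1) := by
  have he : EuclideanSpace.single i (1 : ℝ) ≠ 0 := by simp
  exact hu.compact.comp_isClosedEmbedding
    ((Homeomorph.addLeft x).isClosedEmbedding.comp (isClosedEmbedding_smul_left (𝕜 := ℝ) he))

/-- Nirenberg's inequality for Lebesgue norms, involving only one pure second derivative. -/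
theorem exists_eLpNorm_partialDeriv_le_of_lp (n : ℕ) {π ρ τ : ℝ} (hπ0 : 0 ≤ π) (hπ1 : π ≤ 1)
    (hρ0 : 0 ≤ ρ) (hρ1 : ρ ≤ 1) (hτ0 : 0 < τ) (hτ : 2 * τ = π + ρ) :
    ∃ C : ℝ, 0 ≤ C ∧ ∀ {u : EuclideanSpace ℝ (Fin n) → ℝ}, IsTest u → ∀ (i : Fin n) {X Y : ℝ},
      0 ≤ X → 0 ≤ Y →
      eLpNorm (partialDeriv i (partialDeriv i u)) (if 0 < π then ENNReal.ofReal (1 / π) else ⊤)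
        volume ≤ ENNReal.ofReal X →
      eLpNorm u (if 0 < ρ then ENNReal.ofReal (1 / ρ) else ⊤) volume ≤ ENNReal.ofReal Y →
      eLpNorm (partialDeriv i u) (ENNReal.ofReal (1 / τ)) volume ≤
        ENNReal.ofReal (C * √(X * Y)) := by
  set q := 1 / τ with hq
  have hq0 : 0 < q := by positivity
  have hqρπ : q * (ρ + π) = 2 := by
    rw [add_comm, ← hτ, hq]; field_simp
  obtain ⟨N, hN0, hN⟩ := exists_lintegral_deriv_rpow_le hρ0 hπ0 hπ1 hq0 hqρπ
  refine ⟨N ^ τ, by positivity, fun {u} hu i {X Y} hX hY hXn hYn => ?_⟩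
  set e : EuclideanSpace ℝ (Fin n) := EuclideanSpace.single i 1 with he
  have hf : IsTest (partialDeriv i u) := hu.partialDeriv i
  have hz : IsTest (partialDeriv i (partialDeriv i u)) := hf.partialDeriv i
  set z := partialDeriv i (partialDeriv i u) with hzdef
  set A : ℝ := if π = 0 then X else 1 with hA
  set B : ℝ := if ρ = 0 then Y else 1 with hB
  have hA0 : 0 ≤ A := by rw [hA]; split_ifs <;> positivity
  have hB0 : 0 ≤ B := by rw [hB]; split_ifs <;> positivity
  have hzX : π = 0 → ∀ x, |z x| ≤ X := fun h => by
    rw [h, if_neg (lt_irrefl _)] at hXn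
    exact hz.abs_le_of_eLpNorm_top_le hX hXn
  have huY : ρ = 0 → ∀ x, |u x| ≤ Y := fun h => by
    rw [h, if_neg (lt_irrefl _)] at hYn
    exact hu.abs_le_of_eLpNorm_top_le hY hYn
  set F := lpDensity ρ u with hF
  set G := lpDensity π z with hG
  have hFm : Measurable fun x => ENNReal.ofReal (F x) :=
    (continuous_lpDensity hρ0 hu.continuous).measurable.ennreal_ofReal
  have hGm : Measurable fun x => ENNReal.ofReal (G x) :=
    (continuous_lpDensity hπ0 hz.continuous).measurable.ennreal_ofReal
  have hline : ∀ x, ∫⁻ t : ℝ, ‖partialDeriv i u (x + t • e)‖ₑ ^ q ≤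
      ENNReal.ofReal (N * (A * B) ^ (q / 2)) *
        ((∫⁻ t : ℝ, ENNReal.ofReal (F (x + t • e))) ^ (q * ρ / 2) *
          (∫⁻ t : ℝ, ENNReal.ofReal (G (x + t • e))) ^ (q * π / 2)) := fun x =>
    hN (hu.hasDerivAt_line i x) (hf.hasDerivAt_line i x) (hz.continuous_line i x)
      (continuous_lpDensity hρ0 (hu.continuous_line i x))
      (continuous_lpDensity hπ0 (hz.continuous_line i x)) (lpDensity_nonneg _ _)
      (lpDensity_nonneg _ _)
      (integrable_lpDensity hρ0 (hu.continuous_line i x) (hu.hasCompactSupport_line i x))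
      (integrable_lpDensity hπ0 (hz.continuous_line i x) (hz.hasCompactSupport_line i x)) hA0 hB0
      (fun c d hcd => integral_abs_le_lpDensity hρ0 hρ1 (hu.continuous_line i x)
        (fun h t => huY h _) hcd)
      (fun c d hcd => integral_abs_le_lpDensity hπ0 hπ1 (hz.continuous_line i x)
        (fun h t => hzX h _) hcd)
  have hmF : Measurable fun x => ∫⁻ t : ℝ, ENNReal.ofReal (F (x + t • e)) := by
    have : Measurable fun p : EuclideanSpace ℝ (Fin n) × ℝ =>
      ENNReal.ofReal (F (p.1 + p.2 • e)) :=
        hFm.comp (g := fun x => ENNReal.ofReal (F x)) (by fun_prop)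
    exact this.lintegral_prod_right'
  have hmG : Measurable fun x => ∫⁻ t : ℝ, ENNReal.ofReal (G (x + t • e)) := by
    have : Measurable fun p : EuclideanSpace ℝ (Fin n) × ℝ =>
      ENNReal.ofReal (G (p.1 + p.2 • e)) :=
        hGm.comp (g := fun x => ENNReal.ofReal (G x)) (by fun_prop)
    exact this.lintegral_prod_right'
  have hmain : ∫⁻ x, ‖partialDeriv i u x‖ₑ ^ q ≤ ENNReal.ofReal (N * (X * Y) ^ (q / 2)) := by
    calc ∫⁻ x, ‖partialDeriv i u x‖ₑ ^ q
        = ∫⁻ x in slab i, ∫⁻ t : ℝ, ‖partialDeriv i u (x + t • e)‖ₑ ^ q :=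
          (lintegral_eq_lintegral_slab i (hf.continuous.measurable.enorm.pow_const _)).symm
      _ ≤ ∫⁻ x in slab i, ENNReal.ofReal (N * (A * B) ^ (q / 2)) *
          ((∫⁻ t : ℝ, ENNReal.ofReal (F (x + t • e))) ^ (q * ρ / 2) *
            (∫⁻ t : ℝ, ENNReal.ofReal (G (x + t • e))) ^ (q * π / 2)) := lintegral_mono hline
      _ ≤ ENNReal.ofReal (N * (A * B) ^ (q / 2)) *
          ((∫⁻ x, ENNReal.ofReal (F x)) ^ (q * ρ / 2) *
            (∫⁻ x, ENNReal.ofReal (G x)) ^ (q * π / 2)) := by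
          rw [lintegral_const_mul' _ _ ENNReal.ofReal_ne_top,
            ← lintegral_eq_lintegral_slab i hFm, ← lintegral_eq_lintegral_slab i hGm]
          -- The exponents qρ/2 and qπ/2 add up to 1, so Hölder's inequality over the slab recovers
          -- the full integrals.
          refine mul_le_mul_right (ENNReal.lintegral_mul_norm_pow_le hmF.aemeasurable
            hmG.aemeasurable (by positivity) (by positivity) (by linarith)) _
      _ = ENNReal.ofReal N *
          ((ENNReal.ofReal (A ^ (q / 2)) * (∫⁻ x, ENNReal.ofReal (G x)) ^ (q * π / 2)) *
          (ENNReal.ofReal (B ^ (q / 2)) * (∫⁻ x, ENNReal.ofReal (F x)) ^ (q * ρ / 2))) := by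
          rw [Real.mul_rpow hA0 hB0, ENNReal.ofReal_mul hN0, ENNReal.ofReal_mul (by positivity)]
          ring
      _ ≤ ENNReal.ofReal N * (ENNReal.ofReal (X ^ (q / 2)) * ENNReal.ofReal (Y ^ (q / 2))) := by
          refine mul_le_mul_right (mul_le_mul' ?_ ?_) _
          · exact lintegral_lpDensity_rpow_le hπ0 hq0 hX hXn
          · exact lintegral_lpDensity_rpow_le hρ0 hq0 hY hYn
      _ = _ := by
          rw [Real.mul_rpow hX hY, ENNReal.ofReal_mul hN0, ENNReal.ofReal_mul (by positivity)]
  rw [eLpNorm_eq_lintegral_rpow_enorm_toReal (by simpa using hq0) ENNReal.ofReal_ne_top,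
    ENNReal.toReal_ofReal hq0.le]
  refine (ENNReal.rpow_le_rpow hmain (by positivity)).trans_eq ?_
  have e1 : 1 / q = τ := by rw [hq, one_div_one_div]
  rw [ENNReal.ofReal_rpow_of_nonneg (by positivity) (by positivity), e1,
    Real.mul_rpow hN0 (by positivity), ← Real.rpow_mul (by positivity), Real.sqrt_eq_rpow,
    show q / 2 * τ = 1 / 2 by rw [hq]; field_simp]

/-- The one-dimensional endpoint `p = 1`, `r = -1`, `q = ∞`. -/
theorem exists_xNorm_partialDeriv_le_of_one : ∃ C : ℝ, 0 ≤ C ∧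
    ∀ {u : EuclideanSpace ℝ (Fin 1) → ℝ}, IsTest u → ∀ i, xNorm 0 (partialDeriv i u) ≤
      ENNReal.ofReal (C * √((xNormD 2 1 u).toReal * (xNormD 0 (-1) u).toReal)) := by
  -- In dimension one the slab is a bounded interval of base points of the same line; only 0 < c < ∞
  -- is needed.
  set c := volume (slab (0 : Fin 1)) with hc
  have hctop : c ≠ ⊤ := by
    refine ne_top_of_le_ne_top measure_closedBall_lt_top.ne
      (measure_mono (fun x hx => ?_ : slab (0 : Fin 1) ⊆ Metric.closedBall 0 1))
    rw [mem_closedBall_zero_iff, EuclideanSpace.norm_eq]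
    simp only [Finset.univ_unique, Fin.default_eq_zero, Finset.sum_singleton, Real.norm_eq_abs,
      sq_abs]
    rw [Real.sqrt_sq hx.1]
    exact hx.2.le
  have hc0 : c ≠ 0 := by
    have hcont : Continuous fun x : EuclideanSpace ℝ (Fin 1) => x 0 := by fun_prop
    have ho : IsOpen {x : EuclideanSpace ℝ (Fin 1) | 0 < x 0 ∧ x 0 < 1} :=
      (isOpen_lt continuous_const hcont).inter (isOpen_lt hcont continuous_const)
    have hpos := ho.measure_pos volume ⟨EuclideanSpace.single 0 (1 / 2), by norm_num⟩
    exact (hpos.trans_le (measure_mono (fun x hx => ⟨hx.1.le, hx.2⟩ :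
      {x : EuclideanSpace ℝ (Fin 1) | 0 < x 0 ∧ x 0 < 1} ⊆ slab 0))).ne'
  have hcpos : 0 < c.toReal := ENNReal.toReal_pos hc0 hctop
  refine ⟨√(c.toReal⁻¹), by positivity, fun {u} hu i => ?_⟩
  obtain rfl : i = 0 := Subsingleton.elim _ _
  set A := (xNormD 2 1 u).toReal with hA
  set B := (xNormD 0 (-1) u).toReal with hB
  have hA0 : 0 ≤ A := ENNReal.toReal_nonneg
  have hB0 : 0 ≤ B := ENNReal.toReal_nonneg
  have hf : IsTest (partialDeriv 0 u) := hu.partialDeriv 0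
  have hz : IsTest (partialDeriv 0 (partialDeriv 0 u)) := hf.partialDeriv 0
  rw [xNorm, if_neg (lt_irrefl _), if_pos rfl]
  refine eLpNorm_top_le_of_abs_le fun x => ?_
  -- Here |u'(x)| is at most the integral of |u''| along the line, whatever its base point;
  -- averaging over the slab returns the integral over the space.
  have h1 : |partialDeriv 0 u x| ≤ c.toReal⁻¹ * A := by
    have hx' : ∀ x' : EuclideanSpace ℝ (Fin 1), ‖partialDeriv 0 u x‖ₑ ≤
        ∫⁻ t : ℝ, ‖partialDeriv 0 (partialDeriv 0 u) (x' + t • EuclideanSpace.single 0 1)‖ₑ := by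
      intro x'
      have hd := hf.hasDerivAt_line 0 x'
      have hcd : ContDiff ℝ 1 fun t : ℝ =>
          partialDeriv 0 u (x' + t • EuclideanSpace.single 0 1) := by
        rw [contDiff_one_iff_deriv]
        refine ⟨fun t => (hd t).differentiableAt, ?_⟩
        rw [funext fun t => (hd t).deriv]
        exact hz.continuous_line 0 x'
      have := (hf.hasCompactSupport_line 0 x').enorm_le_lintegral_Ici_deriv hcd (x 0 - x' 0)
      rw [funext fun t => (hd t).deriv] at this
      have e : x' + (x 0 - x' 0) • EuclideanSpace.single 0 1 = x := by
        ext j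
        obtain rfl : j = 0 := Subsingleton.elim _ _
        simp
      rw [e] at this
      exact this.trans (setLIntegral_le_lintegral _ _)
    have h2 : ‖partialDeriv 0 u x‖ₑ * c ≤ ENNReal.ofReal A := by
      have h3 := eLpNorm_listDeriv_le_of_nonneg one_pos hu (d := 2) (μ := 1) zero_le_one
        (l := [0, 0]) rfl
      rw [if_pos one_pos, div_one, ENNReal.ofReal_one, eLpNorm_one_eq_lintegral_enorm] at h3
      refine le_trans ?_ h3
      change _ ≤ ∫⁻ y, ‖partialDeriv 0 (partialDeriv 0 u) y‖ₑ
      rw [← lintegral_eq_lintegral_slab 0 hz.continuous.measurable.enorm, hc, ← setLIntegral_const]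
      exact lintegral_mono hx'
    rw [Real.enorm_eq_ofReal_abs, ← ENNReal.ofReal_toReal hctop,
      ← ENNReal.ofReal_mul (abs_nonneg _), ENNReal.ofReal_le_ofReal_iff hA0] at h2
    rw [inv_mul_eq_div, le_div_iff₀ hcpos]
    exact h2
  have h2 : |partialDeriv 0 u x| ≤ B := by
    have hord : holderOrder 1 (-1) = 0 := by simp [holderOrder]
    have hexp : holderExponent 1 (-1) = 1 := by simp [holderExponent, hord]
    have hL : LipschitzWith B.toNNReal u := by
      refine LipschitzWith.of_dist_le_mul fun y y' => ?_
      have := holder_listDeriv_le_of_neg one_pos hu (d := 0) (μ := -1) (by norm_num) (l := [])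
        (by simp [hord]) y y'
      rw [hexp, Real.rpow_one] at this
      rw [Real.dist_eq, dist_eq_norm, Real.coe_toNNReal _ hB0]
      exact this
    have h3 := (fderiv ℝ u x).le_opNorm (EuclideanSpace.single 0 1)
    have h4 := norm_fderiv_le_of_lipschitz ℝ hL (x₀ := x)
    rw [Real.coe_toNNReal _ hB0] at h4
    refine h3.trans ?_
    simpa using h4
  refine (le_sqrt_mul (abs_nonneg _) h1 h2).trans_eq ?_
  rw [mul_assoc, Real.sqrt_mul (by positivity)]

end Nirenberg

end GagNir

namespace GagNir

/-! ### Assembly of the cases -/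

section Main

variable {n : ℕ} {ip iq ir : ℝ}

theorem exists_xNorm_partialDeriv_le_of_pos (hn : 0 < n) (hp : ip ≤ 1) (hr : ir ≤ 1)
    (hpqr : 2 * iq = ip + ir) (hq : 0 < iq) :
    ∃ C : ℝ, 0 ≤ C ∧ ∀ {u : EuclideanSpace ℝ (Fin n) → ℝ}, IsTest u → ∀ i,
      xNorm iq (partialDeriv i u) ≤
        ENNReal.ofReal (C * √((xNormD 2 ip u).toReal * (xNormD 0 ir u).toReal)) := by
  have hn' : (0 : ℝ) < n := by exact_mod_cast hn
  simp only [xNorm, if_pos hq]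
  rcases lt_or_ge ip 0 with hip | hip
  -- The orders always differ here: -n/r < 0 < 2 - n/p.
  · obtain ⟨C, hC0, hC⟩ := exists_eLpNorm_partialDeriv_le_of_ne hn (d := 0) (d' := 2) rfl
      (by linarith : 0 < ir) hr hip hq (by linarith) (by
        have := mul_neg_of_pos_of_neg hn' hip
        have := mul_pos hn' (by linarith : 0 < ir)
        push_cast
        intro h
        linarith)
    refine ⟨C, hC0, fun {u} hu i => ?_⟩
    rw [mul_comm (xNormD 2 ip u).toReal]
    exact hC hu i
  rcases lt_or_ge ir 0 with hir | hir
  · by_cases heq : n * ip - n * ir = 2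
    · exact exists_eLpNorm_partialDeriv_le_of_critical hn hp hir hq hpqr heq
    · exact exists_eLpNorm_partialDeriv_le_of_ne hn (d := 2) (d' := 0) rfl (by linarith) hp hir hq
        hpqr (by push_cast; intro h; apply heq; linarith)
  · obtain ⟨C, hC0, hC⟩ := exists_eLpNorm_partialDeriv_le_of_lp n hip hp hir hr hq hpqr
    exact ⟨C, hC0, fun {u} hu i => hC hu i ENNReal.toReal_nonneg ENNReal.toReal_nonneg
      (eLpNorm_listDeriv_le_of_nonneg hn hu (d := 2) hip (l := [i, i]) rfl)
      (eLpNorm_listDeriv_le_of_nonneg hn hu (d := 0) hir (l := []) rfl)⟩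

theorem exists_xNorm_partialDeriv_le (hn : 0 < n) (hp : ip ≤ 1) (hr : ir ≤ 1)
    (hpqr : 2 * iq = ip + ir)
    (hexc : ¬ (2 ≤ n ∧ ip = 1 / (n : ℝ) ∧ ir = -(1 / (n : ℝ)))) :
    ∃ C : ℝ, 0 ≤ C ∧ ∀ {u : EuclideanSpace ℝ (Fin n) → ℝ}, IsTest u → ∀ i,
      xNorm iq (partialDeriv i u) ≤
        ENNReal.ofReal (C * √((xNormD 2 ip u).toReal * (xNormD 0 ir u).toReal)) := by
  have hn' : (0 : ℝ) < n := by exact_mod_cast hn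
  rcases lt_trichotomy iq 0 with hq | rfl | hq
  · exact exists_xNorm_partialDeriv_le_of_neg hn hp hr hpqr hq
  -- When 1/q = 0 the two orders agree exactly for n/p = 1, which is the exceptional pair and leaves
  -- only n = 1.
  · by_cases hne : n * ip = 1
    · have h1 : ip = 1 / n := by field_simp; linarith
      have h2 : ir = -(1 / n) := by rw [← h1]; linarith
      have hn1 : n = 1 := by
        by_contra h
        exact hexc ⟨by omega, h1, h2⟩
      subst hn1
      norm_num at h1 h2
      subst h1 h2
      exact exists_xNorm_partialDeriv_le_of_one
    · exact exists_xNorm_partialDeriv_le_of_zero hn hp hr (by linarith) hne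
  · exact exists_xNorm_partialDeriv_le_of_pos hn hp hr hpqr hq

theorem xNormD_one_le {u : EuclideanSpace ℝ (Fin n) → ℝ} {μ : ℝ} {X : ℝ≥0∞}
    (h : ∀ i, xNorm μ (partialDeriv i u) ≤ X) :
    xNormD 1 μ u ≤ (multiIndices n 1).card * X := by
  rw [xNormD, ← nsmul_eq_mul]
  refine Finset.sum_le_card_nsmul _ _ _ fun α hα => ?_
  obtain ⟨l, hl, e⟩ := exists_multiDeriv_eq_listDeriv α
  rw [(mem_multiIndices α).1 hα] at hl
  obtain ⟨i, rfl⟩ := List.length_eq_one_iff.1 hl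
  rw [e]
  exact h i

end Main

end GagNir

theorem lemma4p1 (n : ℕ) (hn : 0 < n)
    -- `ip`, `iq`, `ir` are the reciprocals `1/p`, `1/q`, `1/r`
    (ip iq ir : ℝ) (hp : ip ≤ 1) (hq : iq ≤ 1) (hr : ir ≤ 1)
    (hpqr : 2 * iq = ip + ir)
    (hexc : ¬ (2 ≤ n ∧ ip = 1 / (n : ℝ) ∧ ir = -(1 / (n : ℝ)))) :
    ∃ C : ℝ≥0, ∀ u : EuclideanSpace ℝ (Fin n) → ℝ,
      ContDiff ℝ ∞ u → HasCompactSupport u →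
      GagNir.MemXk 2 ip u → GagNir.MemX ir u →
        GagNir.MemXk 1 iq u ∧
        GagNir.xNormD 1 iq u ^ 2 ≤ (C : ℝ≥0∞) * GagNir.xNormD 2 ip u * GagNir.xNorm ir u := by
  obtain ⟨C, hC0, hC⟩ := GagNir.exists_xNorm_partialDeriv_le hn hp hr hpqr hexc
  refine ⟨(((GagNir.multiIndices n 1).card * C) ^ 2).toNNReal, fun u hu hc _ _ => ?_⟩
  have ht : GagNir.IsTest u := ⟨hu, hc⟩
  refine ⟨ht.memXk hn 1 iq, ?_⟩
  rw [← GagNir.xNormD_zero ir u, ← ENNReal.ofReal_toReal (ht.xNormD_lt_top hn 2 ip).ne,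
    ← ENNReal.ofReal_toReal (ht.xNormD_lt_top hn 0 ir).ne]
  refine (pow_le_pow_left' (GagNir.xNormD_one_le (hC ht)) 2).trans_eq ?_
  set A := (GagNir.xNormD 2 ip u).toReal
  set B := (GagNir.xNormD 0 ir u).toReal
  have hA : 0 ≤ A := ENNReal.toReal_nonneg
  have hB : 0 ≤ B := ENNReal.toReal_nonneg
  rw [← ENNReal.ofReal_natCast, ← ENNReal.ofReal_mul (by positivity),
    ← ENNReal.ofReal_pow (by positivity), mul_assoc, ← ENNReal.ofReal_mul hA,
    ← ENNReal.ofReal.eq_def, ← ENNReal.ofReal_mul (by positivity)]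
  congr 1
  rw [← mul_assoc, mul_pow, Real.sq_sqrt (by positivity)]
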